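/- **Setting.** Let $R\subset V=\mathbb C^N$ be one of the root systems $A_{N-1}=\{e_i-e_j\}_{i\ne j}$, $B_N=\{\pm e_i\pm e_j\}_{i\neq j}\cup\{\pm e_i\}$, $D_N=\{\pm e_i\pm e_j\}_{i\ne j}$, let $W$ be the group generated by the orthogonal reflections $s_\alpha$ ($\alpha\in R$), $R_+\subset R$ a positive subsystem, $c\colon R\to\mathbb C$ a $W$-invariant function, $\omega\in\mathbb C$, and $(\cdot,\cdot)$ the standard bilinear form on $V$. Let $$\nabla_\xi=\partial_\xi-\sum_{\alpha\in R_+}\frac{c_\alpha(\alpha,\xi)}{(\alpha,x)}(1-s_\alpha),\qquad \nabla_i=\nabla_{e_i},$$ be the Dunkl operators. Let $\Gamma_0$ be a set of simple roots, $W_0\subseteq W$ the subgroup generated by $s_\beta$, $\beta\in\Gamma_0$, let $\pi=\{x\in V:(\beta,x)=0\ \forall\beta\in\Gamma_0\}$ and $D=\bigcup_{w\in W}w(\pi)$. Assume that the ideal of polynomials vanishing on $D$ is invariant under the rational Cherednik algebra, i.e. under $W$ and all the Dunkl operators. Let $x_0\in\pi$ be generic: every mirror $(\alpha,x)=0$,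 $\alpha\in R$, that contains $x_0$ contains $\pi$. Let $U$ be any complex vector space with a right action of $W$, and let $P_\alpha$ denote the action of $s_\alpha$ on $U$. Let $\mathcal C$ be the space of germs of analytic functions on $D$ near the points of the orbit $Wx_0$, and let $W$ act diagonally on $U\otimes\mathcal C$ by $(wF)(x)=F(w^{-1}x)\cdot w^{-1}$. Let $\mathcal C_{x_0}$ be the space of germs of analytic functions on $\pi$ at $x_0$, and $(U\otimes\mathcal C_{x_0})^{W_0}$ the subspace of $W_0$-invariants, where $W_0$ acts on $U$ only. **Theorem.** Restriction to $x_0$ is a bijection $(U\otimes\mathcal C)^W\to (U\otimes\mathcal C_{x_0})^{W_0}$, and the Dunkl operators act on $\mathcal C$ (by application to an arbitrary analytic extension to $V$ and restriction of the result to $D$). Put $$h_i=(\nabla_i+\omega x_i)(\nabla_i-\omega x_i),\qquad K_m=\sum_{i=1}^N h_i^m\ (m\in\mathbb Z_{\ge0}),\qquad \widetilde K_1=\sum_{i=1}^N(\nabla_i^2-\omega^2x_i^2).$$ For $a=\sum_i\nabla_i^2$, $a=\widetilde K_1$ and $a=K_m$ $(m\ge0)$ the operator $\mathrm{id}\otimes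 a$ preserves $(U\otimes\mathcal C)^W$, and hence defines an operator $\widetilde{\mathrm{Res}}_\pi a$ on $(U\otimes\mathcal C_{x_0})^{W_0}$. Moreover: 1. There are orthonormal coordinates $y=(y_1,\dots,y_n)$ on $\pi$, and in any such coordinates $H_2=\widetilde{\mathrm{Res}}_\pi\sum_i\nabla_i^2$ is the generalised spin Calogero–Moser operator $$H_2=\Delta_y-\sum_{\alpha\in R_+,\ \widehat\alpha\ne0}\frac{2c_\alpha}{(\widehat\alpha,y)}\partial_{\widehat\alpha}+\sum_{\alpha\in R_+,\ \widehat\alpha\neq0}\frac{c_\alpha(\alpha,\alpha)}{(\widehat\alpha,y)^2}(1-P_\alpha),$$ where $\widehat\alpha$ is the orthogonal projection of $\alpha$ onto $\pi$. 2. $H^{\mathrm{hm}}:=\widetilde{\mathrm{Res}}_\pi\widetilde K_1=H_2-\omega^2(y,y)$. 3. The operators $H^{\mathrm{hm}}_m=\widetilde{\mathrm{Res}}_\pi K_m$, $m\in\mathbb Z_{\ge0}$, commute with $H^{\mathrm{hm}}$ and with each other. -/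

import Mathlib

open scoped TensorProduct Matrix Topology

noncomputable section

namespace SpinCM

/-! ### Root systems and reflection groups in `V = ℂ^N` -/

/-- The space `V = ℂ^N`; the standard bilinear form `(x, y)` is the dot product `x ⬝ᵥ y`. -/
abbrev V (N : ℕ) : Type := Fin N → ℂ

/-- The standard basis vector `e_i`. -/
def e {N : ℕ} (i : Fin N) : V N := Pi.single i 1

open Classical in
/-- The root system `A_{N-1} = {e_i - e_j : i ≠ j}`. -/
def rootsA (N : ℕ) : Finset (V N) :=
  (Finset.univ.filter fun p : Fin N × Fin N => p.1 ≠ p.2).image fun p => e p.1 - e p.2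

open Classical in
/-- The root system `D_N = {±e_i ± e_j : i ≠ j}`. -/
def rootsD (N : ℕ) : Finset (V N) :=
  rootsA N ∪
    ((Finset.univ.filter fun p : Fin N × Fin N => p.1 ≠ p.2).image fun p => e p.1 + e p.2) ∪
    ((Finset.univ.filter fun p : Fin N × Fin N => p.1 ≠ p.2).image fun p => -(e p.1 + e p.2))

open Classical in
/-- The root system `B_N = {±e_i ± e_j : i ≠ j} ∪ {±e_i}`. -/
def rootsB (N : ℕ) : Finset (V N) :=
  rootsD N ∪ (Finset.univ.image fun i => e i) ∪ (Finset.univ.image fun i => -e i)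

/-- The root systems `A_{N-1}`, `B_N` and `D_N`, realised in `ℂ^N`. -/
def IsClassical {N : ℕ} (R : Finset (V N)) : Prop :=
  R = rootsA N ∨ R = rootsB N ∨ R = rootsD N

/-- The linear functional `x ↦ (a, x)`. -/
def dotForm {N : ℕ} (a : V N) : V N →ₗ[ℂ] ℂ where
  toFun x := a ⬝ᵥ x
  map_add' := dotProduct_add a
  map_smul' c x := dotProduct_smul c a x

/-- The reflection `x ↦ x - 2 (α, x) / (α, α) α`, as a linear map. -/
def reflectionMap {N : ℕ} (α : V N) : V N →ₗ[ℂ] V N :=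
  LinearMap.id - (2 / (α ⬝ᵥ α)) • (dotForm α).smulRight α

theorem reflectionMap_apply {N : ℕ} (α x : V N) :
    reflectionMap α x = x - (2 * (α ⬝ᵥ x) / (α ⬝ᵥ α)) • α := by
  simp [reflectionMap, dotForm, smul_smul]
  ring_nf

theorem reflectionMap_involutive {N : ℕ} (α : V N) :
    Function.Involutive (reflectionMap α) := by
  intro x
  rw [reflectionMap_apply, reflectionMap_apply, dotProduct_sub, dotProduct_smul, smul_eq_mul,
    sub_sub, ← add_smul]
  by_cases h : α ⬝ᵥ α = 0
  · simp [h]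
  · have h0 : 2 * (α ⬝ᵥ x) / (α ⬝ᵥ α) +
        2 * (α ⬝ᵥ x - 2 * (α ⬝ᵥ x) / (α ⬝ᵥ α) * (α ⬝ᵥ α)) / (α ⬝ᵥ α) = 0 := by
      field_simp
      ring
    rw [h0, zero_smul, sub_zero]

/-- The orthogonal reflection `s_α` about the hyperplane `(α, x) = 0`. -/
def reflection {N : ℕ} (α : V N) : V N ≃ₗ[ℂ] V N :=
  LinearEquiv.ofInvolutive (reflectionMap α) (reflectionMap_involutive α)

theorem reflection_apply {N : ℕ} (α x : V N) :
    reflection α x = x - (2 * (α ⬝ᵥ x) / (α ⬝ᵥ α)) • α :=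
  reflectionMap_apply α x

/-- The group generated by the reflections `s_α`, `α ∈ S`. -/
def reflGroup {N : ℕ} (S : Finset (V N)) : Subgroup (V N ≃ₗ[ℂ] V N) :=
  Subgroup.closure (reflection '' (S : Set (V N)))

/-- The value at `α` of the real linear functional with coefficients `t`. -/
def height {N : ℕ} (t : Fin N → ℝ) (α : V N) : ℝ := ∑ i, t i * (α i).re

open Classical in
/-- The positive subsystem `R_+` cut out by the linear functional with coefficients `t`
(assumed not to vanish on `R`). -/
def posRoots {N : ℕ} (R : Finset (V N)) (t : Fin N → ℝ) : Finset (V N) :=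
  R.filter fun α => 0 < height t α

theorem mem_of_mem_posRoots {N : ℕ} {R : Finset (V N)} {t : Fin N → ℝ} {α : V N}
    (h : α ∈ posRoots R t) : α ∈ R := (Finset.mem_filter.mp h).1

/-- Simple roots: positive roots that are not sums of two positive roots. -/
def IsSimpleRoot {N : ℕ} (R : Finset (V N)) (t : Fin N → ℝ) (β : V N) : Prop :=
  β ∈ posRoots R t ∧ ∀ γ ∈ posRoots R t, ∀ δ ∈ posRoots R t, β ≠ γ + δ

/-- The reflection `s_α`, `α ∈ R`, as an element of the group `W` generated by the
reflections of `R`. -/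
def reflElt {N : ℕ} {R : Finset (V N)} {α : V N} (h : α ∈ R) : reflGroup R :=
  ⟨reflection α, Subgroup.subset_closure ⟨α, h, rfl⟩⟩

/-! ### Parabolic strata and invariance of the parabolic ideal -/

/-- The subspace `π = {x : (β, x) = 0 for all β ∈ Γ₀}`. -/
def flat {N : ℕ} (Γ₀ : Finset (V N)) : Submodule ℂ (V N) where
  carrier := {x | ∀ β ∈ Γ₀, β ⬝ᵥ x = 0}
  add_mem' hx hy β hβ := by rw [dotProduct_add, hx β hβ, hy β hβ, add_zero]
  zero_mem' β _ := dotProduct_zero β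
  smul_mem' c x hx β hβ := by rw [dotProduct_smul, hx β hβ, smul_zero]

/-- The parabolic stratum `D = ⋃_{w ∈ W} w(π)`. -/
def stratum {N : ℕ} (R Γ₀ : Finset (V N)) : Set (V N) :=
  {x | ∃ w ∈ reflGroup R, ∃ y ∈ flat Γ₀, x = w y}

open Classical in
/-- The Dunkl operator
`∇_ξ = ∂_ξ - ∑_{α ∈ R_+} c_α (α, ξ) / (α, x) (1 - s_α)` on functions on `V`.
On the hyperplane `(α, x) = 0` the quotient `(f(x) - f(s_α x)) / (α, x)` is given the value
`2 ∂_α f(x) / (α, α)`, by which it extends continuously (and analytically) if `f` is analytic. -/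
def dunkl {N : ℕ} (Rp : Finset (V N)) (c : V N → ℂ) (ξ : V N) (f : V N → ℂ) : V N → ℂ :=
  fun x => fderiv ℂ f x ξ - ∑ α ∈ Rp, c α * (α ⬝ᵥ ξ) *
    (if α ⬝ᵥ x = 0 then 2 / (α ⬝ᵥ α) * fderiv ℂ f x α
      else (f x - f (reflection α x)) / (α ⬝ᵥ x))

/-- The parabolic ideal of polynomials vanishing on the stratum is invariant under the rational
Cherednik algebra, i.e. under its generators: polynomials (being an ideal), the group `W`, and
the Dunkl operators. -/
def IdealInvariant {N : ℕ} (R Rp Γ₀ : Finset (V N)) (c : V N → ℂ) : Prop :=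
  ∀ p ∈ MvPolynomial.vanishingIdeal ℂ (stratum R Γ₀),
    (∀ w ∈ reflGroup R, ∃ q ∈ MvPolynomial.vanishingIdeal ℂ (stratum R Γ₀),
      ∀ x, MvPolynomial.eval x q = MvPolynomial.eval (w⁻¹ x) p) ∧
    (∀ ξ : V N, ∃ q ∈ MvPolynomial.vanishingIdeal ℂ (stratum R Γ₀),
      ∀ x, MvPolynomial.eval x q = dunkl Rp c ξ (fun z => MvPolynomial.eval z p) x)

/-- `x₀` is generic in `π`: a mirror which contains `x₀` contains `π`. -/
def IsGeneric {N : ℕ} (R Γ₀ : Finset (V N)) (x₀ : flat Γ₀) : Prop :=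
  ∀ α ∈ R, α ⬝ᵥ (x₀ : V N) = 0 → ∀ y ∈ flat Γ₀, α ⬝ᵥ y = 0

/-- The orbit `W x₀`. -/
def orbit {N : ℕ} (R : Finset (V N)) (x₀ : V N) : Set (V N) :=
  {x | ∃ w ∈ reflGroup R, x = w x₀}

/-! ### Germs of analytic functions -/

section Germs

variable {E E' : Type*} [NormedAddCommGroup E] [NormedSpace ℂ E]
  [NormedAddCommGroup E'] [NormedSpace ℂ E']

/-- Functions that are analytic in a neighbourhood of `S`. -/
def analyticNear (S : Set E) : Subalgebra ℂ (E → ℂ) where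
  carrier := {f | AnalyticOnNhd ℂ f S}
  mul_mem' hf hg := hf.mul hg
  add_mem' hf hg := hf.add hg
  algebraMap_mem' _ := analyticOnNhd_const

/-- Those of them that vanish on `D` near `S`. -/
def vanishingNear (S D : Set E) : Ideal (analyticNear S) where
  carrier := {f | ∀ᶠ x in 𝓝ˢ S, x ∈ D → (f : E → ℂ) x = 0}
  add_mem' {f g} hf hg := by
    have hf' : ∀ᶠ x in 𝓝ˢ S, x ∈ D → (f : E → ℂ) x = 0 := hf
    have hg' : ∀ᶠ x in 𝓝ˢ S, x ∈ D → (g : E → ℂ) x = 0 := hg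
    change ∀ᶠ x in 𝓝ˢ S, x ∈ D → (f : E → ℂ) x + (g : E → ℂ) x = 0
    filter_upwards [hf', hg'] with x h1 h2 hx
    rw [h1 hx, h2 hx, add_zero]
  zero_mem' := by
    change ∀ᶠ x in 𝓝ˢ S, x ∈ D → (0 : ℂ) = 0
    exact Filter.Eventually.of_forall fun _ _ => rfl
  smul_mem' a f hf := by
    have hf' : ∀ᶠ x in 𝓝ˢ S, x ∈ D → (f : E → ℂ) x = 0 := hf
    change ∀ᶠ x in 𝓝ˢ S, x ∈ D → (a : E → ℂ) x * (f : E → ℂ) x = 0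
    filter_upwards [hf'] with x h1 hx
    rw [h1 hx, mul_zero]

/-- Germs near `S` of analytic functions on `D`, i.e. of restrictions to `D` of analytic functions
on the ambient space. For finite `S ⊆ D` this is the direct sum over `x ∈ S` of the spaces of
germs at `x` of analytic functions on `D`. -/
def Germs (S D : Set E) : Type _ := analyticNear S ⧸ vanishingNear S D

instance (S D : Set E) : CommRing (Germs S D) :=
  inferInstanceAs (CommRing (analyticNear S ⧸ vanishingNear S D))

instance (S D : Set E) : Algebra ℂ (Germs S D) :=
  inferInstanceAs (Algebra ℂ (analyticNear S ⧸ vanishingNear S D))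

/-- The quotient map from functions that are analytic near `S` to germs. -/
def mkGerm (S D : Set E) : analyticNear S →ₐ[ℂ] Germs S D :=
  Ideal.Quotient.mkₐ ℂ (vanishingNear S D)

theorem mkGerm_surjective (S D : Set E) : Function.Surjective (mkGerm S D) :=
  Ideal.Quotient.mk_surjective

theorem mkGerm_eq_zero_iff {S D : Set E} {f : analyticNear S} :
    mkGerm S D f = 0 ↔ ∀ᶠ x in 𝓝ˢ S, x ∈ D → (f : E → ℂ) x = 0 :=
  Ideal.Quotient.eq_zero_iff_mem

theorem mkGerm_eq_iff {S D : Set E} {f g : analyticNear S} :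
    mkGerm S D f = mkGerm S D g ↔ ∀ᶠ x in 𝓝ˢ S, x ∈ D → (f : E → ℂ) x = (g : E → ℂ) x := by
  rw [← sub_eq_zero, ← map_sub, mkGerm_eq_zero_iff]
  exact Filter.eventually_congr (Filter.Eventually.of_forall fun x =>
    imp_congr_right fun _ => sub_eq_zero)

/-- The germ of a function that is analytic near `S`. -/
def germ {S : Set E} (D : Set E) (f : E → ℂ) (hf : AnalyticOnNhd ℂ f S) : Germs S D :=
  mkGerm S D ⟨f, hf⟩

theorem analyticOnNhd_linear [FiniteDimensional ℂ E] {F : Type*} [NormedAddCommGroup F]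
    [NormedSpace ℂ F] (φ : E →ₗ[ℂ] F) (S : Set E) : AnalyticOnNhd ℂ φ S :=
  (LinearMap.toContinuousLinearMap φ).analyticOnNhd S

/-- The germ of a linear functional. -/
def linGerm [FiniteDimensional ℂ E] (S D : Set E) (φ : E →ₗ[ℂ] ℂ) : Germs S D :=
  germ D φ (analyticOnNhd_linear φ S)

/-- Pull-back `f ↦ f ∘ φ` of functions. -/
def pullbackFun [FiniteDimensional ℂ E'] {S : Set E} {S' : Set E'} (φ : E' →ₗ[ℂ] E)
    (hS : Set.MapsTo φ S' S) : analyticNear S →ₐ[ℂ] analyticNear S' where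
  toFun f := ⟨fun x => (f : E → ℂ) (φ x), fun x hx =>
    (f.2 (φ x) (hS hx)).comp (analyticOnNhd_linear φ S' x hx)⟩
  map_one' := rfl
  map_mul' _ _ := rfl
  map_zero' := rfl
  map_add' _ _ := rfl
  commutes' _ := rfl

/-- Pull-back `[f] ↦ [f ∘ φ]` of germs along a linear map. -/
def pullback [FiniteDimensional ℂ E'] {S D : Set E} {S' D' : Set E'} (φ : E' →ₗ[ℂ] E)
    (hS : Set.MapsTo φ S' S) (hD : Set.MapsTo φ D' D) : Germs S D →ₐ[ℂ] Germs S' D' :=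
  Ideal.quotientMapₐ (vanishingNear S' D') (pullbackFun φ hS) (by
    intro f hf
    have hφ : Filter.Tendsto φ (𝓝ˢ S') (𝓝ˢ S) :=
      (LinearMap.toContinuousLinearMap φ).continuous.tendsto_nhdsSet hS
    have hf' : ∀ᶠ x in 𝓝ˢ S, x ∈ D → (f : E → ℂ) x = 0 := hf
    change ∀ᶠ x in 𝓝ˢ S', x ∈ D' → (f : E → ℂ) (φ x) = 0
    filter_upwards [hφ.eventually hf'] with x hx hxD using hx (hD hxD))

theorem analyticOnNhd_dirDeriv {S : Set E} {f : E → ℂ} (hf : AnalyticOnNhd ℂ f S) (v : E) :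
    AnalyticOnNhd ℂ (fun x => fderiv ℂ f x v) S := fun x hx =>
  ((ContinuousLinearMap.apply ℂ ℂ v).analyticAt _).comp (hf.fderiv x hx)

theorem eventually_differentiableAt {S : Set E} {f : E → ℂ} (hf : AnalyticOnNhd ℂ f S) :
    ∀ᶠ x in 𝓝ˢ S, DifferentiableAt ℂ f x :=
  eventually_nhdsSet_iff_forall.mpr fun x hx =>
    (hf x hx).eventually_analyticAt.mono fun _ h => h.differentiableAt

/-- The directional derivative `f ↦ [∂_v f]`, from functions to germs. -/
def dirDerivFun (S : Set E) (v : E) : analyticNear S →ₗ[ℂ] Germs S (Set.univ : Set E) where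
  toFun f := germ Set.univ (fun x => fderiv ℂ (f : E → ℂ) x v) (analyticOnNhd_dirDeriv f.2 v)
  map_add' f g := by
    unfold germ
    rw [← map_add, mkGerm_eq_iff]
    filter_upwards [eventually_differentiableAt f.2, eventually_differentiableAt g.2]
      with x hf hg _
    change fderiv ℂ ((f : E → ℂ) + (g : E → ℂ)) x v =
      fderiv ℂ (f : E → ℂ) x v + fderiv ℂ (g : E → ℂ) x v
    rw [fderiv_add hf hg]
    rfl
  map_smul' c f := by
    unfold germ
    rw [RingHom.id_apply, ← map_smul, mkGerm_eq_iff]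
    filter_upwards [eventually_differentiableAt f.2] with x hf _
    change fderiv ℂ (c • (f : E → ℂ)) x v = c • fderiv ℂ (f : E → ℂ) x v
    rw [fderiv_const_smul hf]
    rfl

/-- The directional derivative `[f] ↦ [∂_v f]` on germs of analytic functions. -/
def dirDeriv (S : Set E) (v : E) : Module.End ℂ (Germs S (Set.univ : Set E)) :=
  ((vanishingNear S (Set.univ : Set E)).restrictScalars ℂ).liftQ (dirDerivFun S v) (by
    intro f hf
    have hf' : ∀ᶠ x in 𝓝ˢ S, x ∈ Set.univ → (f : E → ℂ) x = 0 := hf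
    rw [LinearMap.mem_ker]
    refine mkGerm_eq_zero_iff.mpr ?_
    change ∀ᶠ x in 𝓝ˢ S, x ∈ Set.univ → fderiv ℂ (f : E → ℂ) x v = 0
    rw [eventually_nhdsSet_iff_forall] at hf' ⊢
    intro x hx
    filter_upwards [(hf' x hx).eventually_nhds] with y hy _
    have : (f : E → ℂ) =ᶠ[𝓝 y] fun _ => (0 : ℂ) := hy.mono fun z hz => hz trivial
    rw [this.fderiv_eq]
    simp)

end Germs

/-! ### The spaces on which the operators act -/

section Spaces

variable {N : ℕ}

/-- Scalar germs on the stratum `D` near the orbit `W x₀`. -/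
abbrev OrbitGerms (R Γ₀ : Finset (V N)) (x₀ : flat Γ₀) : Type :=
  Germs (orbit R (x₀ : V N)) (stratum R Γ₀)

/-- Scalar germs at `x₀` of analytic functions on `π`. (For generic `x₀`, the stratum `D`
coincides with `π` near `x₀`.) -/
abbrev FlatGerms (Γ₀ : Finset (V N)) (x₀ : flat Γ₀) : Type :=
  Germs ({x₀} : Set (flat Γ₀)) (Set.univ : Set (flat Γ₀))

theorem mapsTo_orbit (R : Finset (V N)) (x₀ : V N) (w : reflGroup R) :
    Set.MapsTo ((w⁻¹ : reflGroup R) : V N ≃ₗ[ℂ] V N) (orbit R x₀) (orbit R x₀) := by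
  rintro x ⟨u, hu, rfl⟩
  exact ⟨_, (reflGroup R).mul_mem (w⁻¹).2 hu, rfl⟩

theorem mapsTo_stratum (R Γ₀ : Finset (V N)) (w : reflGroup R) :
    Set.MapsTo ((w⁻¹ : reflGroup R) : V N ≃ₗ[ℂ] V N) (stratum R Γ₀) (stratum R Γ₀) := by
  rintro x ⟨u, hu, y, hy, rfl⟩
  exact ⟨_, (reflGroup R).mul_mem (w⁻¹).2 hu, y, hy, rfl⟩

/-- The action of `W` on scalar germs, `(w f)(x) = f(w⁻¹ x)`. -/
def weylAct (R Γ₀ : Finset (V N)) (x₀ : flat Γ₀) (w : reflGroup R) :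
    OrbitGerms R Γ₀ x₀ →ₐ[ℂ] OrbitGerms R Γ₀ x₀ :=
  pullback (((w⁻¹ : reflGroup R) : V N ≃ₗ[ℂ] V N) : V N →ₗ[ℂ] V N)
    (mapsTo_orbit R x₀ w) (mapsTo_stratum R Γ₀ w)

theorem mapsTo_subtype_orbit (R Γ₀ : Finset (V N)) (x₀ : flat Γ₀) :
    Set.MapsTo (flat Γ₀).subtype {x₀} (orbit R (x₀ : V N)) := by
  rintro x rfl
  exact ⟨1, (reflGroup R).one_mem, rfl⟩

theorem mapsTo_subtype_stratum (R Γ₀ : Finset (V N)) :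
    Set.MapsTo (flat Γ₀).subtype Set.univ (stratum R Γ₀) := fun x _ =>
  ⟨1, (reflGroup R).one_mem, x, x.2, rfl⟩

/-- Restriction of scalar germs near `W x₀` to `π` near `x₀`. -/
def restrictScalar (R Γ₀ : Finset (V N)) (x₀ : flat Γ₀) :
    OrbitGerms R Γ₀ x₀ →ₐ[ℂ] FlatGerms Γ₀ x₀ :=
  pullback (flat Γ₀).subtype (mapsTo_subtype_orbit R Γ₀ x₀) (mapsTo_subtype_stratum R Γ₀)

variable {U : Type*} [AddCommGroup U] [Module ℂ U] {R : Finset (V N)}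

/-- The diagonal action of `W` on `U`-valued germs, `(w F)(x) = F(w⁻¹ x) · w⁻¹`. Here `U`-valued
germs form the tensor product of `U` with scalar germs, and the right `W`-module structure on `U`
is a representation `ρ` of the opposite group, `u · w = ρ(w) u`. -/
def diagAct (ρ : Representation ℂ (reflGroup R)ᵐᵒᵖ U) (Γ₀ : Finset (V N)) (x₀ : flat Γ₀)
    (w : reflGroup R) : Module.End ℂ (U ⊗[ℂ] OrbitGerms R Γ₀ x₀) :=
  TensorProduct.map (ρ (MulOpposite.op w⁻¹)) (weylAct R Γ₀ x₀ w).toLinearMap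

/-- The space of `U`-valued germs near `W x₀` that are invariant under the diagonal action
of `W`. -/
def orbitInv (ρ : Representation ℂ (reflGroup R)ᵐᵒᵖ U) (Γ₀ : Finset (V N)) (x₀ : flat Γ₀) :
    Submodule ℂ (U ⊗[ℂ] OrbitGerms R Γ₀ x₀) where
  carrier := {F | ∀ w, diagAct ρ Γ₀ x₀ w F = F}
  add_mem' hF hG w := by rw [map_add, hF w, hG w]
  zero_mem' w := map_zero _
  smul_mem' a F hF w := by rw [map_smul, hF w]

/-- The space of `U`-valued germs on `π` at `x₀` that are invariant under the parabolic subgroup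
`W₀` generated by the reflections of `Γ₀` (which fixes `π` pointwise). -/
def flatInv (ρ : Representation ℂ (reflGroup R)ᵐᵒᵖ U) (Γ₀ : Finset (V N)) (x₀ : flat Γ₀) :
    Submodule ℂ (U ⊗[ℂ] FlatGerms Γ₀ x₀) where
  carrier := {F | ∀ w : reflGroup R, (w : V N ≃ₗ[ℂ] V N) ∈ reflGroup Γ₀ →
    (ρ (MulOpposite.op w⁻¹)).rTensor (FlatGerms Γ₀ x₀) F = F}
  add_mem' hF hG w hw := by rw [map_add, hF w hw, hG w hw]
  zero_mem' w _ := map_zero _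
  smul_mem' a F hF w hw := by rw [map_smul, hF w hw]

theorem parabolic_fixes {Γ₀ : Finset (V N)} {w : V N ≃ₗ[ℂ] V N} (hw : w ∈ reflGroup Γ₀)
    {y : V N} (hy : y ∈ flat Γ₀) : w y = y := by
  induction hw using Subgroup.closure_induction with
  | mem w h =>
    obtain ⟨β, hβ, rfl⟩ := h
    rw [reflection_apply, hy β hβ]
    simp
  | one => rfl
  | mul u w _ _ hu hw => rw [LinearEquiv.mul_apply, hw, hu]
  | inv w _ hw =>
    have h : w⁻¹ (w y) = y := w.symm_apply_apply y
    rwa [hw] at h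

theorem restrictScalar_weylAct {Γ₀ : Finset (V N)} {x₀ : flat Γ₀} {w : reflGroup R}
    (hw : (w : V N ≃ₗ[ℂ] V N) ∈ reflGroup Γ₀) (f : OrbitGerms R Γ₀ x₀) :
    restrictScalar R Γ₀ x₀ (weylAct R Γ₀ x₀ w f) = restrictScalar R Γ₀ x₀ f := by
  obtain ⟨f, rfl⟩ := mkGerm_surjective _ _ f
  change mkGerm _ _ _ = mkGerm _ _ _
  congr 1
  apply Subtype.ext
  funext y
  change (f : V N → ℂ) (((w : V N ≃ₗ[ℂ] V N)⁻¹) y) = (f : V N → ℂ) y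
  rw [parabolic_fixes ((reflGroup Γ₀).inv_mem hw) y.2]

/-- Restriction of `W`-invariant `U`-valued germs near `W x₀` to their part at `x₀`, a germ on `π`
which is invariant under `W₀`. -/
def restrict (ρ : Representation ℂ (reflGroup R)ᵐᵒᵖ U) (Γ₀ : Finset (V N)) (x₀ : flat Γ₀) :
    orbitInv ρ Γ₀ x₀ →ₗ[ℂ] flatInv ρ Γ₀ x₀ :=
  ((restrictScalar R Γ₀ x₀).toLinearMap.lTensor U).restrict (by
    intro F hF w hw
    have key : ((ρ (MulOpposite.op w⁻¹)).rTensor (FlatGerms Γ₀ x₀)) ∘ₗ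
        (restrictScalar R Γ₀ x₀).toLinearMap.lTensor U =
        (restrictScalar R Γ₀ x₀).toLinearMap.lTensor U ∘ₗ diagAct ρ Γ₀ x₀ w := by
      apply TensorProduct.ext'
      intro u f
      simp [diagAct, restrictScalar_weylAct hw]
    have h := LinearMap.congr_fun key F
    rw [LinearMap.comp_apply, LinearMap.comp_apply, hF w] at h
    exact h)

/-- The operator `T` on `W₀`-invariant germs on `π` at `x₀` is the restriction to `π` of the
operator `a` on scalar germs: `id ⊗ a` preserves the diagonal `W`-invariants, and `T` is its
action on them, transported by restriction to `x₀`. -/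
def IsRes (ρ : Representation ℂ (reflGroup R)ᵐᵒᵖ U) {Γ₀ : Finset (V N)} {x₀ : flat Γ₀}
    (a : Module.End ℂ (OrbitGerms R Γ₀ x₀)) (T : Module.End ℂ (flatInv ρ Γ₀ x₀)) : Prop :=
  ∀ F : orbitInv ρ Γ₀ x₀,
    ∃ h : a.lTensor U (F : U ⊗[ℂ] OrbitGerms R Γ₀ x₀) ∈ orbitInv ρ Γ₀ x₀,
      T (restrict ρ Γ₀ x₀ F) = restrict ρ Γ₀ x₀ ⟨_, h⟩

end Spaces

/-! ### The operators -/

section Operators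

variable {N : ℕ}

/-- `T` is the action of the Dunkl operator `∇_ξ` on germs on the stratum: apply `∇_ξ` to any
analytic extension to the ambient space, and restrict the (analytic) result to the stratum. -/
def IsDunklAction {R Γ₀ : Finset (V N)} {x₀ : flat Γ₀} (Rp : Finset (V N)) (c : V N → ℂ)
    (ξ : V N) (T : Module.End ℂ (OrbitGerms R Γ₀ x₀)) : Prop :=
  ∀ (f : V N → ℂ) (hf : AnalyticOnNhd ℂ f (orbit R (x₀ : V N))),
    ∃ h : AnalyticOnNhd ℂ (dunkl Rp c ξ f) (orbit R (x₀ : V N)),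
      T (germ (stratum R Γ₀) f hf) = germ (stratum R Γ₀) (dunkl Rp c ξ f) h

/-- Multiplication by the coordinate `x_i`. -/
def coordOp (R Γ₀ : Finset (V N)) (x₀ : flat Γ₀) (i : Fin N) :
    Module.End ℂ (OrbitGerms R Γ₀ x₀) :=
  LinearMap.mulLeft ℂ (linGerm _ _ (LinearMap.proj i))

variable {R Γ₀ : Finset (V N)} {x₀ : flat Γ₀}

/-- `K_m = ∑_i h_i^m`, where `h_i = ∇_i⁺ ∇_i⁻` and `∇_i^± = ∇_i ± ω x_i`. -/
def K (nabla : Fin N → Module.End ℂ (OrbitGerms R Γ₀ x₀)) (ω : ℂ) (m : ℕ) :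
    Module.End ℂ (OrbitGerms R Γ₀ x₀) :=
  ∑ i, ((nabla i + ω • coordOp R Γ₀ x₀ i) * (nabla i - ω • coordOp R Γ₀ x₀ i)) ^ m

/-- `∑_i (∇_i² - ω² x_i²)`. -/
def KTilde (nabla : Fin N → Module.End ℂ (OrbitGerms R Γ₀ x₀)) (ω : ℂ) :
    Module.End ℂ (OrbitGerms R Γ₀ x₀) :=
  ∑ i, (nabla i ^ 2 - ω ^ 2 • coordOp R Γ₀ x₀ i ^ 2)

/-- `b` is an orthonormal basis of `π`; it gives orthonormal coordinates `y_j` on `π`. -/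
def IsOrthonormal {n : ℕ} (b : Module.Basis (Fin n) ℂ (flat Γ₀)) : Prop :=
  ∀ j k, (b j : V N) ⬝ᵥ (b k : V N) = if j = k then 1 else 0

/-- The orthogonal projection `α̂ = ∑_j (α, b_j) b_j` of `α` onto `π`. -/
def orthProj {n : ℕ} (b : Module.Basis (Fin n) ℂ (flat Γ₀)) (α : V N) : flat Γ₀ :=
  ∑ j, (α ⬝ᵥ (b j : V N)) • b j

/-- The germ at `x₀` of the linear function `y ↦ (a, y)` on `π`. -/
def dotGerm (x₀ : flat Γ₀) (a : V N) : FlatGerms Γ₀ x₀ :=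
  linGerm _ _ (dotForm a ∘ₗ (flat Γ₀).subtype)

/-- The germ at `x₀` of the quadratic function `y ↦ (y, y)` on `π`. -/
def sqGerm (x₀ : flat Γ₀) : FlatGerms Γ₀ x₀ :=
  ∑ i, dotGerm x₀ (e i) ^ 2

variable {U : Type*} [AddCommGroup U] [Module ℂ U]

open Classical in
/-- The generalised spin Calogero--Moser operator on `U`-valued germs on `π` at `x₀`:
`Δ_y - ∑ 2 c_α / (α̂, y) ∂_α̂ + ∑ c_α (α, α) / (α̂, y)² (1 - P_α)`,
where both sums are over the positive roots `α` with `α̂ ≠ 0`, and `P_α u = u · s_α`.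
(`Ring.inverse` is the inverse of a unit in the ring of germs.) -/
def spinCM (ρ : Representation ℂ (reflGroup R)ᵐᵒᵖ U) (t : Fin N → ℝ) (c : V N → ℂ) {n : ℕ}
    (b : Module.Basis (Fin n) ℂ (flat Γ₀)) (x₀ : flat Γ₀) :
    Module.End ℂ (U ⊗[ℂ] FlatGerms Γ₀ x₀) :=
  (∑ j, dirDeriv {x₀} (b j) ^ 2).lTensor U
    - ∑ α : posRoots R t, (if orthProj b α = 0 then 0 else
        (2 * c α) • (LinearMap.mulLeft ℂ (Ring.inverse (dotGerm x₀ (orthProj b α : V N))) *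
          dirDeriv {x₀} (orthProj b α)).lTensor U)
    + ∑ α : posRoots R t, (if orthProj b α = 0 then 0 else
        (c α * ((α : V N) ⬝ᵥ (α : V N))) •
          TensorProduct.map
            (1 - ρ (MulOpposite.op (reflElt (mem_of_mem_posRoots α.2))))
            (LinearMap.mulLeft ℂ (Ring.inverse (dotGerm x₀ (orthProj b α : V N)) ^ 2)))

end Operators

end SpinCM

end

/-! All computations take place on germs of analytic functions on the ambient space near the orbit
`Wx₀`, and are pushed down to `D` and then to `π`. On ambient germs the Dunkl operator is `nab`:
`∂_ξ` minus half the sum over all roots of `c_α (α, ξ) q_α`, where `q_α` (`quot`) is the difference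
quotient `(1 - s_α) / (α, x)`. It is well defined because divided differences of analytic functions
are analytic across the mirror (`analyticAt_divRefl`).

Bijectivity. Near each point `w x₀` the stratum is the single flat `w(π)` (`IsGeneric.map_flat_eq`),
so a germ on `D` is zero iff all its `W`-translates vanish on `π` near `x₀` (`toOrbit_eq_zero_iff`).
An invariant germ is therefore determined by its part at `x₀`. Conversely, a `W₀`-invariant germ is
extended by averaging over `W`; this reproduces it at `x₀` because the stabilizer of `x₀` is exactly
`W₀` (`mem_parabolic_of_fixes`).

Descent of the Dunkl operators. For a root orthogonal to `π`, the quotient `q_α` restricts to a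
multiple of `∂_α`. Hence on `π` the operator `∇_ξ` becomes the derivative along a vector `flatDir
ξ`, plus terms that only see the restrictions to `π` of translates of the germ (`toFlat_nab`).
Feeding a polynomial `(β, x) q` of the ideal, with `q(x₀) ≠ 0`, into the invariance hypothesis
forces `flatDir ξ ∈ π` (`flatDir_mem`). So `∇_ξ` descends to `D` (`exists_induces_nab`), and
`flatDir ξ` is the orthogonal projection of `ξ` (`flatDir_eq_orthProj`).

The formula for `H₂`. The quadratic terms `q_α q_β` cancel in `∑ ∇_i²` (`sum_quot_quot_eq_zero`),
leaving `Δ` minus half the sum of `c_α (∂_α q_α + q_α ∂_α)`. On `π`, the roots orthogonal to `π`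
cancel exactly the transversal second derivatives of `Δ`; the transversal first derivatives cancel
by the symmetry under these reflections (`sum_smul_inverse_dotGerm`). The result is
`toFlat_sum_nab_sq`. For an invariant `U`-valued germ, `s_α` acting on the argument equals `P_α`
acting on `U` (`lTensor_weylAct_of_mem`).

Commutativity. Already on ambient germs, `h_i h_j - h_j h_i = T_ij (h_j - h_i)`, where `T_ij`
interchanges `h_i` and `h_j` (`hOp_commutator`, `swapOp_mul_hOp`). These relations alone make all
power sums of the `h_i` commute (`commute_power_sums`). The operator `∑ (∇_i² - ω² x_i²)` differs
from `K_1` by a constant and a multiple of `∑ c_α s_α`, both of which commute with every `K_m`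
(`sum_sq_sub_sq`). Commutation survives descent to `D` and restriction to `π`. -/

open scoped TensorProduct Matrix Topology

noncomputable section

namespace SpinCM

section

/-! ### Analyticity of divided differences -/

section DividedDifference

variable {E : Type*} [NormedAddCommGroup E] [NormedSpace ℂ E]

/-- The power series of the divided difference `(f (x + h) - f (x + T h)) / l h`,
where `T h = h - l h • v` and `p` is the power series of `f` at `x`. -/
def dividedSeries (p : FormalMultilinearSeries ℂ E ℂ) (T : E →L[ℂ] E) (v : E) :
    FormalMultilinearSeries ℂ E ℂ := fun m =>
  ∑ k : Fin (m + 1), ((p (m + 1)).curryMid k v).compContinuousLinearMap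
    fun j : Fin m => if j.castSucc < k then ContinuousLinearMap.id ℂ E else T

theorem map_insertNth_sub {m : ℕ} (q : ContinuousMultilinearMap ℂ (fun _ : Fin (m + 1) => E) ℂ)
    (k : Fin (m + 1)) (a b : E) :
    q (k.insertNth (a - b) fun j : Fin m => if j.castSucc < k then a else b) =
      q (fun j => if (j : ℕ) < k + 1 then a else b) -
        q (fun j => if (j : ℕ) < k then a else b) := by
  have h1 : (k.insertNth (a - b) fun j : Fin m => if j.castSucc < k then a else b) =
      Function.update (fun j : Fin (m + 1) => if (j : ℕ) < k then a else b) k (a - b) := by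
    rw [Fin.insertNth_eq_iff]
    refine ⟨by simp, ?_⟩
    funext j
    rw [Fin.removeNth_apply, Function.update_of_ne (Fin.succAbove_ne k j)]
    by_cases h : j.castSucc < k
    · have h' : (j : ℕ) < k := h
      rw [Fin.succAbove_of_castSucc_lt _ _ h]
      simp [h, h']
    · rw [Fin.succAbove_of_le_castSucc _ _ (not_lt.mp h)]
      have h' : ¬ ((j : ℕ) + 1 < k) := by
        intro h2
        exact h (by rw [Fin.lt_def, Fin.val_castSucc]; omega)
      simp [h, h']
  rw [h1, q.map_update_sub]
  congr 2
  · funext j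
    by_cases h : j = k
    · subst h; simp
    · have : (j : ℕ) ≠ k := fun h' => h (Fin.ext h')
      rw [Function.update_of_ne h]
      by_cases h2 : (j : ℕ) < k
      · rw [if_pos h2, if_pos (by omega)]
      · rw [if_neg h2, if_neg (by omega)]
  · funext j
    by_cases h : j = k
    · subst h; simp
    · rw [Function.update_of_ne h]

/-- Telescoping: replace the arguments `h` by `T h` one slot at a time. Each step changes one slot
by `h - T h = l h • v`, from which the factor `l h` comes out by multilinearity. -/
theorem dividedSeries_apply (p : FormalMultilinearSeries ℂ E ℂ) {l : E →L[ℂ] ℂ} {v : E}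
    {T : E →L[ℂ] E} (hT : ∀ h, T h = h - l h • v) (m : ℕ) (h : E) :
    l h * dividedSeries p T v m (fun _ => h) = p (m + 1) (fun _ => h) - p (m + 1) fun _ => T h := by
  have hterm : ∀ k : Fin (m + 1), l h * ((p (m + 1)).curryMid k v).compContinuousLinearMap
      (fun j : Fin m => if j.castSucc < k then ContinuousLinearMap.id ℂ E else T) (fun _ => h) =
      p (m + 1) (fun j => if (j : ℕ) < k + 1 then h else T h) -
        p (m + 1) (fun j => if (j : ℕ) < k then h else T h) := by
    intro k
    rw [← map_insertNth_sub, ← smul_eq_mul,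
      ContinuousMultilinearMap.compContinuousLinearMap_apply, ← _root_.smul_apply,
      ← ContinuousLinearMap.map_smul, ContinuousMultilinearMap.curryMid_apply]
    congr 1
    have h2 : h - T h = l h • v := by rw [hT]; abel
    rw [h2]
    congr 1
    funext j
    split_ifs <;> rfl
  rw [dividedSeries, _root_.sum_apply, Finset.mul_sum,
    Finset.sum_congr rfl fun k _ => hterm k,
    Fin.sum_univ_eq_sum_range (fun k => p (m + 1) (fun j => if (j : ℕ) < k + 1 then h else T h) -
        p (m + 1) (fun j => if (j : ℕ) < k then h else T h)) (m + 1),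
    Finset.sum_range_sub (fun k => p (m + 1) (fun j => if (j : ℕ) < k then h else T h))]
  congr 2
  funext j
  rw [if_pos j.2]

theorem dividedSeries_radius_pos {p : FormalMultilinearSeries ℂ E ℂ} (hp : 0 < p.radius)
    (T : E →L[ℂ] E) (v : E) : 0 < (dividedSeries p T v).radius := by
  obtain ⟨C, r, hC, hr, hb⟩ := p.le_mul_pow_of_radius_pos hp
  set B : ℝ := 1 + ‖T‖ with hB
  have hB1 : 1 ≤ B := by rw [hB]; linarith [norm_nonneg T]
  have hBpos : 0 < B := by linarith
  have hnorm : ∀ m, ‖dividedSeries p T v m‖ ≤ (m + 1) * (C * r ^ (m + 1) * ‖v‖ * B ^ m) := by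
    intro m
    refine (norm_sum_le _ _).trans ?_
    refine (Finset.sum_le_card_nsmul _ _ (C * r ^ (m + 1) * ‖v‖ * B ^ m) ?_).trans (by simp)
    intro k _
    refine (ContinuousMultilinearMap.norm_compContinuousLinearMap_le _ _).trans ?_
    have h1 : ‖(p (m + 1)).curryMid k v‖ ≤ C * r ^ (m + 1) * ‖v‖ := by
      refine (ContinuousLinearMap.le_opNorm _ _).trans ?_
      rw [ContinuousMultilinearMap.norm_curryMid]
      exact mul_le_mul_of_nonneg_right (hb _) (norm_nonneg _)
    have h2 : ∏ j : Fin m, ‖if j.castSucc < k then ContinuousLinearMap.id ℂ E else T‖ ≤ B ^ m := by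
      refine (Finset.prod_le_prod (g := fun _ => B) (fun _ _ => norm_nonneg _) ?_).trans (by simp)
      intro j _
      split_ifs
      · exact ContinuousLinearMap.norm_id_le.trans hB1
      · rw [hB]; linarith [norm_nonneg T]
    exact mul_le_mul h1 h2 (Finset.prod_nonneg fun _ _ => norm_nonneg _) (by positivity)
  -- The extra factor 2 absorbs the number `m + 1` of telescoping terms, since `m + 1 ≤ 2 ^ m`.
  have hρ : 0 < 1 / (2 * r * B) := by positivity
  let ρ : NNReal := ⟨1 / (2 * r * B), hρ.le⟩
  refine lt_of_lt_of_le (b := (ρ : ENNReal)) ?_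
    (FormalMultilinearSeries.le_radius_of_bound _ (C * r * ‖v‖) (r := ρ) ?_)
  · exact_mod_cast hρ
  · intro m
    change _ * (1 / (2 * r * B)) ^ m ≤ _
    refine (mul_le_mul_of_nonneg_right (hnorm m) (by positivity)).trans ?_
    have h3 : ((m : ℝ) + 1) * (C * r ^ (m + 1) * ‖v‖ * B ^ m) * (1 / (2 * r * B)) ^ m =
        C * r * ‖v‖ * (((m : ℝ) + 1) / 2 ^ m) := by
      rw [one_div, inv_pow, mul_pow, mul_pow, pow_succ]
      field_simp
    rw [h3]
    have h4 : ((m : ℝ) + 1) / 2 ^ m ≤ 1 := by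
      rw [div_le_one (by positivity)]
      exact_mod_cast Nat.lt_two_pow_self
    exact mul_le_of_le_one_right (by positivity) h4

/-- Divided differences of an analytic function in a fixed direction are analytic. -/
theorem _root_.AnalyticAt.exists_divided_difference {f : E → ℂ} {x : E} (hf : AnalyticAt ℂ f x)
    (l : E →L[ℂ] ℂ) (v : E) : ∃ g : E → ℂ, AnalyticAt ℂ g x ∧
      ∀ᶠ y in 𝓝 x, f y - f (y - l (y - x) • v) = l (y - x) * g y := by
  obtain ⟨p, R, hp⟩ := hf
  set T : E →L[ℂ] E := ContinuousLinearMap.id ℂ E - l.smulRight v with hTdef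
  have hT : ∀ h, T h = h - l h • v := fun h => by simp [hTdef]
  set P := dividedSeries p T v
  have hP : 0 < P.radius := dividedSeries_radius_pos (hp.r_pos.trans_le hp.r_le) T v
  have hPs := P.hasFPowerSeriesOnBall hP
  have htend : Filter.Tendsto (fun y => y - x) (𝓝 x) (𝓝 0) := by
    have : Continuous fun y => y - x := by fun_prop
    simpa using this.tendsto x
  refine ⟨fun y => P.sum (y - x), ?_, ?_⟩
  · have h0 : AnalyticAt ℂ P.sum (x - x) := by rw [sub_self]; exact hPs.analyticAt
    exact h0.comp_of_eq (f := fun y => y - x) (analyticAt_id.sub analyticAt_const) rfl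
  · have hb1 : ∀ᶠ h in 𝓝 (0 : E), h ∈ Metric.eball (0 : E) R := Metric.eball_mem_nhds _ hp.r_pos
    have hb2 : ∀ᶠ h in 𝓝 (0 : E), T h ∈ Metric.eball (0 : E) R := by
      have : Filter.Tendsto T (𝓝 0) (𝓝 0) := by simpa using T.continuous.tendsto 0
      exact this.eventually hb1
    have hb3 : ∀ᶠ h in 𝓝 (0 : E), h ∈ Metric.eball (0 : E) P.radius :=
      Metric.eball_mem_nhds _ hP
    filter_upwards [htend.eventually hb1, htend.eventually hb2, htend.eventually hb3]
      with y h1 h2 h3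
    have s1 := hp.hasSum h1
    have s2 := hp.hasSum h2
    have s3 := (P.hasSum h3).mul_left (l (y - x))
    have e2 : x + T (y - x) = y - l (y - x) • v := by rw [hT]; abel
    rw [add_sub_cancel] at s1
    rw [e2] at s2
    have s4 := s1.sub s2
    -- The constant terms of the two series agree, so the difference starts in degree 1; this is the
    -- degree shift in `dividedSeries`.
    rw [← hasSum_nat_add_iff' 1] at s4
    have e3 : (fun n => l (y - x) * P n fun _ => y - x) =
        fun n => p (n + 1) (fun _ => y - x) - p (n + 1) fun _ => T (y - x) :=
      funext fun n => dividedSeries_apply p hT n (y - x)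
    rw [e3] at s3
    have := s4.unique s3
    rw [← this]
    have e4 : (fun _ : Fin 0 => y - x) = fun _ : Fin 0 => T (y - x) := funext fun i => i.elim0
    simp [e4]

end DividedDifference

end

section

/-! ### Derivations, pull-backs and units in rings of germs -/

section GermCalculus

variable {E E' : Type*} [NormedAddCommGroup E] [NormedSpace ℂ E]
  [NormedAddCommGroup E'] [NormedSpace ℂ E']

theorem germ_eq_iff {S D : Set E} {f g : E → ℂ} {hf : AnalyticOnNhd ℂ f S}
    {hg : AnalyticOnNhd ℂ g S} :
    germ D f hf = germ D g hg ↔ ∀ᶠ x in 𝓝ˢ S, x ∈ D → f x = g x :=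
  mkGerm_eq_iff

theorem germ_congr {S D : Set E} {f g : E → ℂ} {hf : AnalyticOnNhd ℂ f S}
    {hg : AnalyticOnNhd ℂ g S} (h : ∀ᶠ x in 𝓝ˢ S, f x = g x) : germ D f hf = germ D g hg :=
  germ_eq_iff.mpr (h.mono fun _ h _ => h)

theorem exists_germ {S D : Set E} (F : Germs S D) :
    ∃ (f : E → ℂ) (hf : AnalyticOnNhd ℂ f S), germ D f hf = F := by
  obtain ⟨f, rfl⟩ := mkGerm_surjective S D F
  exact ⟨f, f.2, rfl⟩

theorem dirDeriv_germ {S : Set E} (v : E) {f : E → ℂ} (hf : AnalyticOnNhd ℂ f S) :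
    dirDeriv S v (germ Set.univ f hf) =
      germ Set.univ (fun x => fderiv ℂ f x v) (analyticOnNhd_dirDeriv hf v) := rfl

theorem dirDeriv_add (S : Set E) (v w : E) : dirDeriv S (v + w) = dirDeriv S v + dirDeriv S w := by
  ext F
  obtain ⟨f, hf, rfl⟩ := exists_germ F
  exact germ_congr (Filter.Eventually.of_forall fun x => map_add (fderiv ℂ f x) v w)

theorem dirDeriv_smul (S : Set E) (a : ℂ) (v : E) : dirDeriv S (a • v) = a • dirDeriv S v := by
  ext F
  obtain ⟨f, hf, rfl⟩ := exists_germ F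
  exact germ_congr (Filter.Eventually.of_forall fun x => map_smul (fderiv ℂ f x) a v)

/-- The directional derivative as a linear function of the direction. -/
def dirDerivₗ (S : Set E) : E →ₗ[ℂ] Module.End ℂ (Germs S (Set.univ : Set E)) where
  toFun := dirDeriv S
  map_add' := dirDeriv_add S
  map_smul' := dirDeriv_smul S

@[simp] theorem dirDerivₗ_apply (S : Set E) (v : E) : dirDerivₗ S v = dirDeriv S v := rfl

theorem dirDeriv_mul {S : Set E} (v : E) (F G : Germs S (Set.univ : Set E)) :
    dirDeriv S v (F * G) = dirDeriv S v F * G + F * dirDeriv S v G := by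
  obtain ⟨f, hf, rfl⟩ := exists_germ F
  obtain ⟨g, hg, rfl⟩ := exists_germ G
  refine germ_congr ?_
  filter_upwards [eventually_differentiableAt hf, eventually_differentiableAt hg] with x h1 h2
  change fderiv ℂ (f * g) x v = fderiv ℂ f x v * g x + f x * fderiv ℂ g x v
  rw [fderiv_mul h1 h2]
  simp
  ring

theorem dirDeriv_linGerm [FiniteDimensional ℂ E] {S : Set E} (v : E) (φ : E →ₗ[ℂ] ℂ) :
    dirDeriv S v (linGerm S Set.univ φ) = algebraMap ℂ _ (φ v) := by
  refine germ_congr (Filter.Eventually.of_forall fun x => ?_)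
  change fderiv ℂ (LinearMap.toContinuousLinearMap φ) x v = φ v
  rw [ContinuousLinearMap.fderiv]
  rfl

theorem dirDeriv_comm {S : Set E} (v w : E) (F : Germs S (Set.univ : Set E)) :
    dirDeriv S v (dirDeriv S w F) = dirDeriv S w (dirDeriv S v F) := by
  obtain ⟨f, hf, rfl⟩ := exists_germ F
  refine germ_congr ?_
  have hev : ∀ᶠ x in 𝓝ˢ S, AnalyticAt ℂ f x := eventually_nhdsSet_iff_forall.mpr fun x hx =>
    (hf x hx).eventually_analyticAt
  filter_upwards [hev] with x hx
  have hd : DifferentiableAt ℂ (fderiv ℂ f) x := hx.fderiv.differentiableAt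
  have key : ∀ a b : E, fderiv ℂ (fun y => fderiv ℂ f y a) x b = fderiv ℂ (fderiv ℂ f) x b a := by
    intro a b
    rw [fderiv_clm_apply hd (differentiableAt_const a)]
    simp
  rw [key, key]
  exact (hx.contDiffAt (n := ⊤)).isSymmSndFDerivAt (by simp) v w

theorem dirDeriv_pullback [FiniteDimensional ℂ E'] {S : Set E} {S' : Set E'} (φ : E' →ₗ[ℂ] E)
    (hS : Set.MapsTo φ S' S) (v : E') (F : Germs S (Set.univ : Set E)) :
    dirDeriv S' v (pullback φ hS (Set.mapsTo_univ φ Set.univ) F) =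
      pullback φ hS (Set.mapsTo_univ φ Set.univ) (dirDeriv S (φ v) F) := by
  obtain ⟨f, hf, rfl⟩ := exists_germ F
  refine germ_congr ?_
  have hφ : Filter.Tendsto φ (𝓝ˢ S') (𝓝ˢ S) :=
    (LinearMap.toContinuousLinearMap φ).continuous.tendsto_nhdsSet hS
  filter_upwards [hφ.eventually (eventually_differentiableAt hf)] with x hx
  have := (hx.hasFDerivAt.comp x (LinearMap.toContinuousLinearMap φ).hasFDerivAt).fderiv
  change fderiv ℂ (fun y => f (φ y)) x v = fderiv ℂ f (φ x) (φ v)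
  change fderiv ℂ (fun y => f (φ y)) x = _ at this
  rw [this]
  rfl

theorem isUnit_linGerm [FiniteDimensional ℂ E] {S D : Set E} (ℓ : E →ₗ[ℂ] ℂ)
    (h : ∀ x ∈ S, ℓ x ≠ 0) : IsUnit (linGerm S D ℓ) := by
  have hℓ := analyticOnNhd_linear ℓ S
  refine IsUnit.of_mul_eq_one (germ D (fun x => (ℓ x)⁻¹) fun x hx => (hℓ x hx).inv (h x hx)) ?_
  refine germ_congr ?_
  rw [eventually_nhdsSet_iff_forall]
  intro x hx
  filter_upwards [(hℓ x hx).continuousAt.eventually_ne (h x hx)] with y hy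
  exact mul_inv_cancel₀ hy

end GermCalculus

/-! ### Vanishing off finitely many hyperplanes -/

section Density

variable {N : ℕ}

/-- Along the line `x + ε u` each `(α, ·)` is affine in `ε` and not identically zero, so small
nonzero `ε` avoids its zero. -/
theorem eventually_regular {A : Finset (V N)} {x u : V N}
    (h : ∀ α ∈ A, α ⬝ᵥ x = 0 → α ⬝ᵥ u ≠ 0) :
    ∀ᶠ ε in 𝓝[≠] (0 : ℂ), ∀ α ∈ A, α ⬝ᵥ (x + ε • u) ≠ 0 := by
  rw [Filter.eventually_all_finset]
  intro α hα
  have key : ∀ ε : ℂ, α ⬝ᵥ (x + ε • u) = α ⬝ᵥ x + ε * (α ⬝ᵥ u) := fun ε => by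
    rw [dotProduct_add, dotProduct_smul, smul_eq_mul]
  by_cases h0 : α ⬝ᵥ x = 0
  · filter_upwards [self_mem_nhdsWithin] with ε hε
    rw [key, h0, zero_add]
    exact mul_ne_zero hε (h α hα h0)
  · have hc : ContinuousAt (fun ε : ℂ => α ⬝ᵥ x + ε * (α ⬝ᵥ u)) 0 := by fun_prop
    have := hc.eventually_ne (y := 0) (by simpa using h0)
    filter_upwards [nhdsWithin_le_nhds this] with ε hε
    rwa [key]

/-- A function which is continuous at `x` and vanishes at the points near `x` off the hyperplanes
orthogonal to the vectors in `A` vanishes at `x`, provided that these hyperplanes have a common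
nonincident vector. -/
theorem eq_zero_of_regular (A : Finset (V N)) {u : V N} (hu : ∀ α ∈ A, α ⬝ᵥ u ≠ 0)
    {g : V N → ℂ} {x : V N} (hg : ContinuousAt g x)
    (h : ∀ᶠ y in 𝓝 x, (∀ α ∈ A, α ⬝ᵥ y ≠ 0) → g y = 0) : g x = 0 := by
  have hline : Filter.Tendsto (fun ε : ℂ => x + ε • u) (𝓝[≠] 0) (𝓝 x) := by
    have : Continuous fun ε : ℂ => x + ε • u := by fun_prop
    simpa using (this.tendsto 0).mono_left nhdsWithin_le_nhds
  have hreg := eventually_regular (x := x) fun α hα _ => hu α hα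
  have h0 : ∀ᶠ ε in 𝓝[≠] (0 : ℂ), g (x + ε • u) = 0 := by
    filter_upwards [hline.eventually h, hreg] with ε h1 h2 using h1 h2
  have h1 : Filter.Tendsto (fun ε : ℂ => g (x + ε • u)) (𝓝[≠] 0) (𝓝 (g x)) :=
    Filter.Tendsto.comp hg hline
  exact tendsto_nhds_unique h1 (tendsto_const_nhds.congr' (h0.mono fun _ h => h.symm))

theorem germ_eq_zero_of_regular (A : Finset (V N)) {u : V N} (hu : ∀ α ∈ A, α ⬝ᵥ u ≠ 0)
    {S : Set (V N)} {g : V N → ℂ} (hg : AnalyticOnNhd ℂ g S)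
    (h : ∀ᶠ y in 𝓝ˢ S, (∀ α ∈ A, α ⬝ᵥ y ≠ 0) → g y = 0) : germ Set.univ g hg = 0 := by
  refine germ_congr (g := fun _ => 0) (hg := analyticOnNhd_const) ?_
  rw [eventually_nhdsSet_iff_forall] at h ⊢
  intro x hx
  filter_upwards [(h x hx).eventually_nhds, (hg x hx).eventually_analyticAt] with y h1 h2
  exact eq_zero_of_regular A hu h2.continuousAt h1

theorem linGerm_mul_cancel {S : Set (V N)} {α : V N} (hα : α ⬝ᵥ α ≠ 0)
    {F G : Germs S (Set.univ : Set (V N))}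
    (h : linGerm S Set.univ (dotForm α) * F = linGerm S Set.univ (dotForm α) * G) : F = G := by
  rw [← sub_eq_zero, ← mul_sub] at h
  rw [← sub_eq_zero]
  generalize F - G = H at h ⊢
  obtain ⟨f, hf, rfl⟩ := exists_germ H
  have h' := germ_eq_iff (g := fun _ => 0) (hg := analyticOnNhd_const).mp h
  refine germ_eq_zero_of_regular {α} (u := α) (by simpa using hα) hf ?_
  filter_upwards [h'] with y hy hreg
  exact (mul_eq_zero.mp (hy trivial)).resolve_left (hreg α (Finset.mem_singleton_self α))

end Density

/-! ### The difference quotient of a reflection -/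

section DividedReflection

variable {N : ℕ}

theorem fderiv_comp_linearEquiv {f : V N → ℂ} {x : V N} (φ : V N ≃ₗ[ℂ] V N)
    (hf : DifferentiableAt ℂ f (φ x)) (v : V N) :
    fderiv ℂ (fun y => f (φ y)) x v = fderiv ℂ f (φ x) (φ v) := by
  have := (hf.hasFDerivAt.comp x
    (LinearMap.toContinuousLinearMap (φ : V N →ₗ[ℂ] V N)).hasFDerivAt).fderiv
  change fderiv ℂ (fun y => f (φ y)) x = _ at this
  rw [this]
  rfl

open Classical in
/-- The quotient `(f - f ∘ s_α) / (α, x)`, extended over the mirror. -/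
def divRefl (α : V N) (f : V N → ℂ) (x : V N) : ℂ :=
  if α ⬝ᵥ x = 0 then 2 / (α ⬝ᵥ α) * fderiv ℂ f x α else (f x - f (reflection α x)) / (α ⬝ᵥ x)

theorem reflection_of_dot_eq_zero {α x : V N} (h : α ⬝ᵥ x = 0) : reflection α x = x := by
  rw [reflection_apply, h]; simp

theorem reflection_self {α : V N} (hα : α ⬝ᵥ α ≠ 0) : reflection α α = -α := by
  rw [reflection_apply, mul_div_assoc, div_self hα, mul_one, two_smul]
  abel

theorem dot_mul_divRefl (α : V N) (f : V N → ℂ) (x : V N) :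
    (α ⬝ᵥ x) * divRefl α f x = f x - f (reflection α x) := by
  unfold divRefl
  split_ifs with h
  · rw [reflection_of_dot_eq_zero h, h]; ring
  · field_simp

theorem analyticAt_dot (α x : V N) : AnalyticAt ℂ (fun y => α ⬝ᵥ y) x :=
  analyticOnNhd_linear (dotForm α) Set.univ x trivial

/-- On the mirror, `y ↦ y - (α, y) · 2α/(α, α)` is the reflection, so the divided difference with `l
= (α, ·)` and `v = 2α/(α, α)` supplies an analytic function `g` that equals the quotient off the
mirror. It remains to see that the prescribed values on the mirror are those of `g`. -/
theorem analyticAt_divRefl {α : V N} (hα : α ⬝ᵥ α ≠ 0) {f : V N → ℂ} {x : V N}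
    (hf : AnalyticAt ℂ f x) (hf' : AnalyticAt ℂ f (reflection α x)) :
    AnalyticAt ℂ (divRefl α f) x := by
  have hs : ∀ y, AnalyticAt ℂ (reflection α) y := fun y =>
    analyticOnNhd_linear ((reflection α : V N ≃ₗ[ℂ] V N) : V N →ₗ[ℂ] V N) Set.univ y trivial
  by_cases hx : α ⬝ᵥ x = 0
  · obtain ⟨g, hg, he⟩ := hf.exists_divided_difference
      (LinearMap.toContinuousLinearMap (dotForm α)) ((2 / (α ⬝ᵥ α)) • α)
    refine hg.congr ?_
    have hdot : ∀ y : V N, LinearMap.toContinuousLinearMap (dotForm α) (y - x) = α ⬝ᵥ y := by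
      intro y
      change α ⬝ᵥ (y - x) = _
      rw [dotProduct_sub, hx, sub_zero]
    have hrefl : ∀ y : V N, y - (α ⬝ᵥ y) • (2 / (α ⬝ᵥ α)) • α = reflection α y := by
      intro y
      rw [reflection_apply, smul_smul]
      congr 2
      ring
    simp only [hdot, hrefl] at he
    filter_upwards [he.eventually_nhds, hf.eventually_analyticAt, hg.eventually_analyticAt]
      with y h1 h2 h3
    by_cases hy : α ⬝ᵥ y = 0
    · have hsy := reflection_of_dot_eq_zero hy
      -- Differentiating this identity along `α` at a point of the mirror gives `2 ∂_α f = (α, α)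
      -- g`, because the reflection fixes the point and negates `α`.
      have e1 : (fun z => f z - f (reflection α z)) =ᶠ[𝓝 y] fun z => (α ⬝ᵥ z) * g z := h1
      have e2 := congrArg (fun L : V N →L[ℂ] ℂ => L α) e1.fderiv_eq
      have d1 : DifferentiableAt ℂ f y := h2.differentiableAt
      have d1' : DifferentiableAt ℂ f (reflection α y) := by rwa [hsy]
      have d2 : DifferentiableAt ℂ (fun z => f (reflection α z)) y :=
        d1'.comp y (hs y).differentiableAt
      have e3 : fderiv ℂ (fun z => f z - f (reflection α z)) y α = 2 * fderiv ℂ f y α := by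
        rw [fderiv_fun_sub d1 d2, _root_.sub_apply, fderiv_comp_linearEquiv _ d1',
          reflection_self hα, hsy, map_neg]
        ring
      have e4 : fderiv ℂ (fun z => (α ⬝ᵥ z) * g z) y α = (α ⬝ᵥ α) * g y := by
        rw [fderiv_fun_mul (analyticAt_dot α y).differentiableAt h3.differentiableAt]
        have : fderiv ℂ (fun z => α ⬝ᵥ z) y α = α ⬝ᵥ α := by
          change fderiv ℂ (LinearMap.toContinuousLinearMap (dotForm α)) y α = _
          rw [ContinuousLinearMap.fderiv]
          rfl
        simp only [_root_.add_apply, _root_.smul_apply, smul_eq_mul, this, hy]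
        ring
      simp only [e3, e4] at e2
      rw [divRefl, if_pos hy, div_mul_eq_mul_div, e2, mul_div_cancel_left₀ _ hα]
    · have h4 := h1.self_of_nhds
      rw [divRefl, if_neg hy, h4, mul_div_cancel_left₀ _ hy]
  · have h1 : AnalyticAt ℂ (fun y => (f y - f (reflection α y)) / (α ⬝ᵥ y)) x :=
      (hf.sub (hf'.comp (hs x))).div (analyticAt_dot α x) hx
    refine h1.congr ?_
    filter_upwards [(analyticAt_dot α x).continuousAt.eventually_ne hx] with y hy
    rw [divRefl, if_neg hy]

end DividedReflection

end

section

variable {N : ℕ}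

/-! ### Integral vectors of norm one and two -/

section IntegralVectors

/-- An integral vector in `ℂ^N`. -/
def intVec (a : Fin N → ℤ) : V N := fun i => (a i : ℂ)

theorem intVec_injective : Function.Injective (intVec : (Fin N → ℤ) → V N) := fun _ _ h =>
  funext fun i => Int.cast_injective (α := ℂ) (congrFun h i)

theorem intVec_dot (a b : Fin N → ℤ) : intVec a ⬝ᵥ intVec b = ((a ⬝ᵥ b : ℤ) : ℂ) := by
  simp [intVec, dotProduct]

theorem intVec_sub (a b : Fin N → ℤ) : intVec (a - b) = intVec a - intVec b := by
  ext i; simp [intVec]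

theorem intVec_smul (k : ℤ) (a : Fin N → ℤ) : intVec (k • a) = (k : ℂ) • intVec a := by
  ext i; simp [intVec]

theorem intVec_single (i : Fin N) (k : ℤ) : intVec (Pi.single i k) = (k : ℂ) • e i := by
  ext j
  by_cases h : j = i
  · subst h; simp [intVec, e]
  · simp [intVec, e, h]

theorem e_eq_intVec (i : Fin N) : (e i : V N) = intVec (Pi.single i 1) := by
  simp [intVec_single]

theorem exists_eq_single {s : Finset (Fin N)} {a : Fin N → ℤ} (h : ∑ k ∈ s, a k * a k = 1) :
    ∃ i ∈ s, (a i = 1 ∨ a i = -1) ∧ ∀ k ∈ s, k ≠ i → a k = 0 := by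
  obtain ⟨i, hi, hne⟩ := Finset.exists_ne_zero_of_sum_ne_zero (by rw [h]; exact one_ne_zero)
  have h1 := Finset.add_sum_erase s (fun k => a k * a k) hi
  simp only [h] at h1
  have h2 : 0 ≤ ∑ k ∈ s.erase i, a k * a k := Finset.sum_nonneg fun k _ => mul_self_nonneg _
  have h3 : 0 < a i * a i := lt_of_le_of_ne (mul_self_nonneg _) (Ne.symm hne)
  have h4 : ∑ k ∈ s.erase i, a k * a k = 0 := by omega
  refine ⟨i, hi, mul_self_eq_one_iff.mp (by omega), fun k hk hki => ?_⟩
  exact mul_self_eq_zero.mp ((Finset.sum_eq_zero_iff_of_nonneg fun k _ => mul_self_nonneg (a k)).mp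
    h4 k (Finset.mem_erase.mpr ⟨hki, hk⟩))

theorem exists_eq_single_of_dot {a : Fin N → ℤ} (h : a ⬝ᵥ a = 1) :
    ∃ i, a = Pi.single i 1 ∨ a = Pi.single i (-1) := by
  obtain ⟨i, -, h1, h2⟩ := exists_eq_single (s := Finset.univ) h
  have key : ∀ k : ℤ, a i = k → a = Pi.single i k := by
    intro k hk
    funext j
    by_cases hj : j = i
    · subst hj; simp [hk]
    · simp [hj, h2 j (Finset.mem_univ _) hj]
  exact ⟨i, h1.imp (key _) (key _)⟩

theorem exists_eq_pair {a : Fin N → ℤ} (h : a ⬝ᵥ a = 2) :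
    ∃ i j, i ≠ j ∧ (a i = 1 ∨ a i = -1) ∧ (a j = 1 ∨ a j = -1) ∧
      a = Pi.single i (a i) + Pi.single j (a j) := by
  have h : ∑ k, a k * a k = 2 := h
  obtain ⟨i, hi, hne⟩ := Finset.exists_ne_zero_of_sum_ne_zero (by rw [h]; exact two_ne_zero)
  have h1 := Finset.add_sum_erase Finset.univ (fun k => a k * a k) hi
  simp only [h] at h1
  have h2 : 0 ≤ ∑ k ∈ Finset.univ.erase i, a k * a k :=
    Finset.sum_nonneg fun k _ => mul_self_nonneg _
  have h3 : 0 < a i * a i := lt_of_le_of_ne (mul_self_nonneg _) (Ne.symm hne)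
  have h5 : a i * a i ≠ 2 := by
    intro h6
    have : a i ≤ 1 := by nlinarith
    have : -1 ≤ a i := by nlinarith
    interval_cases a i <;> omega
  obtain ⟨j, hj, hj1, hj2⟩ := exists_eq_single
    (s := Finset.univ.erase i) (a := a) (by omega)
  have hij : j ≠ i := (Finset.mem_erase.mp hj).1
  refine ⟨i, j, hij.symm, mul_self_eq_one_iff.mp (by omega), hj1, ?_⟩
  funext k
  by_cases hki : k = i
  · subst hki; simp [hij.symm]
  · by_cases hkj : k = j
    · subst hkj; simp [hki]
    · simp [hki, hkj, hj2 k (Finset.mem_erase.mpr ⟨hki, Finset.mem_univ _⟩) hkj]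

end IntegralVectors

/-! ### The classical roots as integral vectors of given norm -/

section Membership

theorem e_sub_mem_rootsA {i j : Fin N} (h : i ≠ j) : e i - e j ∈ rootsA N := by
  classical
  exact Finset.mem_image.mpr ⟨(i, j), by simpa using h, rfl⟩

theorem rootsA_subset_rootsD : rootsA N ⊆ rootsD N := fun _ h => by
  simp only [rootsD, Finset.mem_union]
  exact Or.inl (Or.inl h)

theorem rootsD_subset_rootsB : rootsD N ⊆ rootsB N := fun _ h => by
  simp only [rootsB, Finset.mem_union]
  exact Or.inl (Or.inl h)

theorem e_add_mem_rootsD {i j : Fin N} (h : i ≠ j) : e i + e j ∈ rootsD N := by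
  classical
  simp only [rootsD, Finset.mem_union, Finset.mem_image, Finset.mem_filter]
  exact Or.inl (Or.inr ⟨(i, j), ⟨Finset.mem_univ _, h⟩, rfl⟩)

theorem neg_e_add_mem_rootsD {i j : Fin N} (h : i ≠ j) : -(e i + e j) ∈ rootsD N := by
  classical
  simp only [rootsD, Finset.mem_union, Finset.mem_image, Finset.mem_filter]
  exact Or.inr ⟨(i, j), ⟨Finset.mem_univ _, h⟩, rfl⟩

theorem e_mem_rootsB (i : Fin N) : e i ∈ rootsB N := by
  classical
  simp only [rootsB, Finset.mem_union, Finset.mem_image]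
  exact Or.inl (Or.inr ⟨i, Finset.mem_univ _, rfl⟩)

theorem neg_e_mem_rootsB (i : Fin N) : -e i ∈ rootsB N := by
  classical
  simp only [rootsB, Finset.mem_union, Finset.mem_image]
  exact Or.inr ⟨i, Finset.mem_univ _, rfl⟩

theorem intVec_pair (i j : Fin N) (k l : ℤ) :
    intVec (Pi.single i k + Pi.single j l) = (k : ℂ) • e i + (l : ℂ) • e j := by
  rw [← intVec_single, ← intVec_single]
  ext m
  simp [intVec]

theorem pair_dot {i j : Fin N} (h : i ≠ j) {k l : ℤ} (hk : k = 1 ∨ k = -1) (hl : l = 1 ∨ l = -1) :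
    (Pi.single i k + Pi.single j l : Fin N → ℤ) ⬝ᵥ (Pi.single i k + Pi.single j l) = 2 := by
  rw [add_dotProduct, single_dotProduct, single_dotProduct]
  rcases hk with rfl | rfl <;> rcases hl with rfl | rfl <;> simp [h, h.symm]

/-- Describing roots by integrality and norm makes stability under reflections and under differences
a matter of arithmetic, without case distinctions on signs and indices. -/
theorem mem_rootsD_iff {α : V N} :
    α ∈ rootsD N ↔ ∃ a : Fin N → ℤ, α = intVec a ∧ a ⬝ᵥ a = 2 := by
  classical
  constructor
  · intro h
    simp only [rootsD, rootsA, Finset.mem_union, Finset.mem_image, Finset.mem_filter,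
      Finset.mem_univ, true_and] at h
    rcases h with (⟨⟨i, j⟩, h, rfl⟩ | ⟨⟨i, j⟩, h, rfl⟩) | ⟨⟨i, j⟩, h, rfl⟩
    · exact ⟨_, by rw [intVec_pair i j 1 (-1)]; simp [sub_eq_add_neg],
        pair_dot h (by simp) (by simp)⟩
    · exact ⟨_, by rw [intVec_pair i j 1 1]; simp, pair_dot h (by simp) (by simp)⟩
    · exact ⟨_, by rw [intVec_pair i j (-1) (-1)]; simp [add_comm],
        pair_dot h (by simp) (by simp)⟩
  · rintro ⟨a, rfl, ha⟩
    obtain ⟨i, j, hij, h1, h2, h3⟩ := exists_eq_pair ha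
    rw [h3, intVec_pair]
    rcases h1 with h1 | h1 <;> rcases h2 with h2 | h2 <;> rw [h1, h2]
    · simpa using e_add_mem_rootsD hij
    · simpa [sub_eq_add_neg] using rootsA_subset_rootsD (e_sub_mem_rootsA hij)
    · simpa [sub_eq_add_neg, add_comm] using rootsA_subset_rootsD (e_sub_mem_rootsA hij.symm)
    · simpa [add_comm] using neg_e_add_mem_rootsD hij

theorem mem_rootsB_iff {α : V N} :
    α ∈ rootsB N ↔ ∃ a : Fin N → ℤ, α = intVec a ∧ (a ⬝ᵥ a = 1 ∨ a ⬝ᵥ a = 2) := by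
  classical
  constructor
  · intro h
    simp only [rootsB, Finset.mem_union, Finset.mem_image, Finset.mem_univ, true_and] at h
    rcases h with (h | ⟨i, rfl⟩) | ⟨i, rfl⟩
    · obtain ⟨a, h1, h2⟩ := mem_rootsD_iff.mp h
      exact ⟨a, h1, Or.inr h2⟩
    · exact ⟨_, e_eq_intVec i, Or.inl (by simp)⟩
    · exact ⟨Pi.single i (-1), by rw [intVec_single]; simp, Or.inl (by simp)⟩
  · rintro ⟨a, rfl, ha | ha⟩
    · obtain ⟨i, rfl | rfl⟩ := exists_eq_single_of_dot ha
      · simpa [intVec_single] using e_mem_rootsB i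
      · simpa [intVec_single] using neg_e_mem_rootsB i
    · exact rootsD_subset_rootsB (mem_rootsD_iff.mpr ⟨a, rfl, ha⟩)

theorem mem_rootsA_iff {α : V N} :
    α ∈ rootsA N ↔ ∃ a : Fin N → ℤ, α = intVec a ∧ a ⬝ᵥ a = 2 ∧ ∑ i, a i = 0 := by
  classical
  constructor
  · intro h
    simp only [rootsA, Finset.mem_image, Finset.mem_filter, Finset.mem_univ, true_and] at h
    obtain ⟨⟨i, j⟩, h, rfl⟩ := h
    exact ⟨_, by rw [intVec_pair i j 1 (-1)]; simp [sub_eq_add_neg], pair_dot h (by simp) (by simp),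
      by simp [Finset.sum_add_distrib]⟩
  · rintro ⟨a, rfl, ha, hs⟩
    obtain ⟨i, j, hij, h1, h2, h3⟩ := exists_eq_pair ha
    have hs' : a i + a j = 0 := by
      rw [h3] at hs
      simpa [Finset.sum_add_distrib] using hs
    rw [h3, intVec_pair]
    rcases h1 with h1 | h1
    · have h2' : a j = -1 := by omega
      rw [h1, h2']
      simpa [sub_eq_add_neg] using e_sub_mem_rootsA hij
    · have h2' : a j = 1 := by omega
      rw [h1, h2']
      simpa [sub_eq_add_neg, add_comm] using e_sub_mem_rootsA hij.symm

end Membership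

end

section

variable {N : ℕ}

/-! ### Orthogonality of the reflection group -/

section Reflections

theorem reflection_dot_reflection (α x y : V N) :
    reflection α x ⬝ᵥ reflection α y = x ⬝ᵥ y := by
  rw [reflection_apply, reflection_apply]
  by_cases h : α ⬝ᵥ α = 0
  · simp [h]
  · simp only [sub_dotProduct, dotProduct_sub, smul_dotProduct, dotProduct_smul, smul_eq_mul]
    rw [dotProduct_comm x α]
    field_simp
    ring

theorem reflection_reflection (α x : V N) : reflection α (reflection α x) = x :=
  reflectionMap_involutive α x

theorem reflection_inv (α : V N) : (reflection α)⁻¹ = reflection α := by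
  rw [inv_eq_iff_mul_eq_one]
  ext1 x
  exact reflection_reflection α x

theorem reflection_neg (α : V N) : reflection (-α) = reflection α := by
  ext1 x
  simp only [reflection_apply, neg_dotProduct, dotProduct_neg, neg_neg, smul_neg, mul_neg, neg_div,
    neg_smul]

theorem apply_eq_of_reflection {β : Type*} {A : Finset (V N)} (F : V N → β)
    (h : ∀ α ∈ A, ∀ x, F (reflection α x) = F x) {w : V N ≃ₗ[ℂ] V N} (hw : w ∈ reflGroup A) :
    ∀ x, F (w x) = F x := by
  induction hw using Subgroup.closure_induction with
  | mem w hw =>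
    obtain ⟨α, hα, rfl⟩ := hw
    exact h α hα
  | one => exact fun x => rfl
  | mul u w _ _ hu hw => exact fun x => (hu (w x)).trans (hw x)
  | inv w _ hw =>
    intro x
    rw [← hw (w⁻¹ x)]
    exact congrArg F (w.apply_symm_apply x)

theorem weyl_dot {A : Finset (V N)} {w : V N ≃ₗ[ℂ] V N} (hw : w ∈ reflGroup A) :
    ∀ x y, w x ⬝ᵥ w y = x ⬝ᵥ y := by
  induction hw using Subgroup.closure_induction with
  | mem w hw =>
    obtain ⟨α, hα, rfl⟩ := hw
    exact reflection_dot_reflection α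
  | one => exact fun x y => rfl
  | mul u w _ _ hu hw => exact fun x y => (hu (w x) (w y)).trans (hw x y)
  | inv w _ hw =>
    intro x y
    rw [← hw (w⁻¹ x) (w⁻¹ y)]
    exact congrArg₂ _ (w.apply_symm_apply x) (w.apply_symm_apply y)

theorem weyl_inv_apply_apply (w : V N ≃ₗ[ℂ] V N) (x : V N) : w⁻¹ (w x) = x :=
  w.symm_apply_apply x

theorem weyl_apply_inv_apply (w : V N ≃ₗ[ℂ] V N) (x : V N) : w (w⁻¹ x) = x :=
  w.apply_symm_apply x

theorem weyl_dot_left {A : Finset (V N)} {w : V N ≃ₗ[ℂ] V N} (hw : w ∈ reflGroup A) (x y : V N) :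
    w x ⬝ᵥ y = x ⬝ᵥ w⁻¹ y := by
  rw [← weyl_dot hw x (w⁻¹ y), weyl_apply_inv_apply]

theorem weyl_dot_right {A : Finset (V N)} {w : V N ≃ₗ[ℂ] V N} (hw : w ∈ reflGroup A) (x y : V N) :
    x ⬝ᵥ w y = w⁻¹ x ⬝ᵥ y := by
  rw [dotProduct_comm, weyl_dot_left hw, dotProduct_comm]

theorem conj_reflection {A : Finset (V N)} {w : V N ≃ₗ[ℂ] V N} (hw : w ∈ reflGroup A)
    (α x : V N) : reflection (w α) x = w (reflection α (w⁻¹ x)) := by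
  rw [reflection_apply, reflection_apply, map_sub, map_smul, weyl_apply_inv_apply, weyl_dot hw,
    weyl_dot_left hw]

end Reflections

/-! ### Root system properties and freeness on regular vectors -/

section Roots

variable {R : Finset (V N)}

theorem IsClassical.exists_intVec (hR : IsClassical R) {α : V N} (hα : α ∈ R) :
    ∃ a : Fin N → ℤ, α = intVec a ∧ (a ⬝ᵥ a = 1 ∨ a ⬝ᵥ a = 2) := by
  rcases hR with rfl | rfl | rfl
  · obtain ⟨a, h1, h2, -⟩ := mem_rootsA_iff.mp hα
    exact ⟨a, h1, Or.inr h2⟩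
  · exact mem_rootsB_iff.mp hα
  · obtain ⟨a, h1, h2⟩ := mem_rootsD_iff.mp hα
    exact ⟨a, h1, Or.inr h2⟩

theorem IsClassical.dot_self (hR : IsClassical R) {α : V N} (hα : α ∈ R) :
    α ⬝ᵥ α = 1 ∨ α ⬝ᵥ α = 2 := by
  obtain ⟨a, rfl, h⟩ := hR.exists_intVec hα
  rw [intVec_dot]
  exact_mod_cast h

theorem IsClassical.dot_self_ne_zero (hR : IsClassical R) {α : V N} (hα : α ∈ R) :
    α ⬝ᵥ α ≠ 0 := by
  rcases hR.dot_self hα with h | h <;> rw [h] <;> norm_num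

/-- For norm 1 or 2 the coefficient `2 (a, b) / (a, a)` is an integer, so integrality is preserved
along with the norm. -/
theorem reflection_intVec {a : Fin N → ℤ} (ha : a ⬝ᵥ a = 1 ∨ a ⬝ᵥ a = 2) (b : Fin N → ℤ) :
    ∃ k : ℤ, reflection (intVec a) (intVec b) = intVec (b - k • a) ∧
      (b - k • a) ⬝ᵥ (b - k • a) = b ⬝ᵥ b := by
  have key : ∀ k : ℤ, (b - k • a) ⬝ᵥ (b - k • a) =
      b ⬝ᵥ b - 2 * k * (a ⬝ᵥ b) + k * k * (a ⬝ᵥ a) := by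
    intro k
    simp only [sub_dotProduct, dotProduct_sub, smul_dotProduct, dotProduct_smul, smul_eq_mul]
    rw [dotProduct_comm b a]
    ring
  rcases ha with ha | ha
  · refine ⟨2 * (a ⬝ᵥ b), ?_, by rw [key, ha]; ring⟩
    rw [reflection_apply, intVec_dot, intVec_dot, ha, intVec_sub, intVec_smul]
    simp
  · refine ⟨a ⬝ᵥ b, ?_, by rw [key, ha]; ring⟩
    rw [reflection_apply, intVec_dot, intVec_dot, ha, intVec_sub, intVec_smul]
    simp

theorem IsClassical.reflection_mem (hR : IsClassical R) {α β : V N} (hα : α ∈ R) (hβ : β ∈ R) :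
    reflection α β ∈ R := by
  obtain ⟨a, rfl, ha⟩ := hR.exists_intVec hα
  rcases hR with rfl | rfl | rfl
  · obtain ⟨a', h1, -, h2⟩ := mem_rootsA_iff.mp hα
    obtain rfl := intVec_injective h1
    obtain ⟨b, rfl, hb1, hb2⟩ := mem_rootsA_iff.mp hβ
    obtain ⟨k, h3, h4⟩ := reflection_intVec ha b
    exact mem_rootsA_iff.mpr ⟨_, h3, h4.trans hb1, by
      simp [Finset.sum_sub_distrib, ← Finset.mul_sum, h2, hb2]⟩
  · obtain ⟨b, rfl, hb⟩ := mem_rootsB_iff.mp hβ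
    obtain ⟨k, h3, h4⟩ := reflection_intVec ha b
    exact mem_rootsB_iff.mpr ⟨_, h3, by rwa [h4]⟩
  · obtain ⟨b, rfl, hb⟩ := mem_rootsD_iff.mp hβ
    obtain ⟨k, h3, h4⟩ := reflection_intVec ha b
    exact mem_rootsD_iff.mpr ⟨_, h3, by rwa [h4]⟩

theorem IsClassical.neg_mem (hR : IsClassical R) {α : V N} (hα : α ∈ R) : -α ∈ R := by
  rw [← reflection_self (hR.dot_self_ne_zero hα)]
  exact hR.reflection_mem hα hα

theorem IsClassical.weyl_mem_iff (hR : IsClassical R) {w : V N ≃ₗ[ℂ] V N} (hw : w ∈ reflGroup R)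
    (α : V N) : w α ∈ R ↔ α ∈ R := by
  refine Eq.to_iff (apply_eq_of_reflection (fun x => x ∈ R) (fun β hβ x => propext ?_) hw α)
  refine ⟨fun h => ?_, hR.reflection_mem hβ⟩
  rw [← reflection_reflection β x]
  exact hR.reflection_mem hβ h

/-- For integral vectors, `(α, β) ≥ 1` bounds the norm of `α - β` by `(α, α) + (β, β) - 2`, while `α
≠ β` makes it positive; only admissible norms remain. -/
theorem IsClassical.sub_mem (hR : IsClassical R) {α β : V N} (hα : α ∈ R) (hβ : β ∈ R)
    (hne : α ≠ β) (hpos : 0 < (α ⬝ᵥ β).re) : α - β ∈ R := by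
  have key : ∀ a b : Fin N → ℤ, intVec a ≠ intVec b → 0 < (intVec a ⬝ᵥ intVec b).re →
      0 < a ⬝ᵥ b ∧ 0 < (a - b) ⬝ᵥ (a - b) ∧
      (a - b) ⬝ᵥ (a - b) = a ⬝ᵥ a - 2 * (a ⬝ᵥ b) + b ⬝ᵥ b := by
    intro a b hab h
    refine ⟨?_, ?_, ?_⟩
    · rw [intVec_dot, Complex.intCast_re] at h
      exact_mod_cast h
    · refine lt_of_le_of_ne (Finset.sum_nonneg fun i _ => mul_self_nonneg _) (Ne.symm fun h0 => ?_)
      rw [dotProduct_self_eq_zero, sub_eq_zero] at h0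
      exact hab (by rw [h0])
    · simp only [sub_dotProduct, dotProduct_sub]
      rw [dotProduct_comm b a]
      ring
  rcases hR with rfl | rfl | rfl
  · obtain ⟨a, rfl, ha, ha'⟩ := mem_rootsA_iff.mp hα
    obtain ⟨b, rfl, hb, hb'⟩ := mem_rootsA_iff.mp hβ
    obtain ⟨h1, h2, h3⟩ := key a b hne hpos
    rw [← intVec_sub]
    exact mem_rootsA_iff.mpr ⟨_, rfl, by omega, by simp [ha', hb']⟩
  · obtain ⟨a, rfl, ha⟩ := mem_rootsB_iff.mp hα
    obtain ⟨b, rfl, hb⟩ := mem_rootsB_iff.mp hβ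
    obtain ⟨h1, h2, h3⟩ := key a b hne hpos
    rw [← intVec_sub]
    exact mem_rootsB_iff.mpr ⟨_, rfl, by omega⟩
  · obtain ⟨a, rfl, ha⟩ := mem_rootsD_iff.mp hα
    obtain ⟨b, rfl, hb⟩ := mem_rootsD_iff.mp hβ
    obtain ⟨h1, h2, h3⟩ := key a b hne hpos
    rw [← intVec_sub]
    exact mem_rootsD_iff.mpr ⟨_, rfl, by omega⟩

/-- The Weyl group acts by signed permutations of the coordinates. -/
theorem IsClassical.weyl_e (hR : IsClassical R) {w : V N ≃ₗ[ℂ] V N} (hw : w ∈ reflGroup R)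
    (i : Fin N) : ∃ j, w (e i) = e j ∨ w (e i) = -e j := by
  have key : ∀ α ∈ R, ∀ x : V N, (∃ j, x = e j ∨ x = -e j) →
      ∃ j, reflection α x = e j ∨ reflection α x = -e j := by
    intro α hα x hx
    obtain ⟨a, rfl, ha⟩ := hR.exists_intVec hα
    have hx' : ∃ b : Fin N → ℤ, x = intVec b ∧ b ⬝ᵥ b = 1 := by
      obtain ⟨j, rfl | rfl⟩ := hx
      · exact ⟨_, e_eq_intVec j, by simp⟩
      · exact ⟨Pi.single j (-1), by rw [intVec_single]; simp, by simp⟩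
    obtain ⟨b, rfl, hb⟩ := hx'
    obtain ⟨k, h1, h2⟩ := reflection_intVec ha b
    obtain ⟨j, h3⟩ := exists_eq_single_of_dot (h2.trans hb)
    refine ⟨j, ?_⟩
    rw [h1]
    rcases h3 with h3 | h3 <;> rw [h3, intVec_single] <;> simp
  have := apply_eq_of_reflection (fun x : V N => ∃ j, x = e j ∨ x = -e j)
    (fun α hα x => propext ⟨fun h => by
      have := key α hα _ h
      rwa [reflection_reflection] at this, key α hα x⟩) hw (e i)
  exact this.mpr ⟨i, Or.inl rfl⟩

theorem ext_on_basis {w w' : V N ≃ₗ[ℂ] V N} (h : ∀ i, w (e i) = w' (e i)) : w = w' := by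
  apply LinearEquiv.toLinearMap_injective
  apply LinearMap.pi_ext'
  intro i
  ext
  exact congrFun (h i) _

/-- An element is determined by the images of the basis vectors, and these lie in the finite set of
vectors `±e_j`. -/
theorem IsClassical.finite_weyl (hR : IsClassical R) : Finite (reflGroup R) := by
  have hfin : Finite {x : V N | ∃ j, x = e j ∨ x = -e j} := by
    refine Set.Finite.subset ((Set.finite_range (fun j : Fin N => (e j : V N))).union
      (Set.finite_range (fun j : Fin N => (-e j : V N)))) ?_
    rintro x ⟨j, rfl | rfl⟩
    · exact Or.inl ⟨j, rfl⟩
    · exact Or.inr ⟨j, rfl⟩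
  refine Finite.of_injective (β := Fin N → {x : V N | ∃ j, x = e j ∨ x = -e j})
    (fun w i => ⟨(w : V N ≃ₗ[ℂ] V N) (e i), hR.weyl_e w.2 i⟩) ?_
  intro w w' h
  exact Subtype.ext (ext_on_basis fun i => congrArg Subtype.val (congrFun h i))

/-- This invariant separates the group of `D_N` from that of `B_N`: it rules out an odd number of
sign changes. -/
theorem prod_reflection_of_mem_rootsD {α : V N} (hα : α ∈ rootsD N) (x : V N) :
    ∏ k, reflection α x k = ∏ k, x k := by
  obtain ⟨a, rfl, ha⟩ := mem_rootsD_iff.mp hα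
  obtain ⟨i, j, hij, h1, h2, h3⟩ := exists_eq_pair ha
  have hs : ∀ s t : ℂ, s * s = 1 → t * t = 1 → intVec a = s • e i + t • e j →
      ∏ k, reflection (intVec a) x k = ∏ k, x k := by
    intro s t hs ht hst
    have hdot : intVec a ⬝ᵥ x = s * x i + t * x j := by
      rw [hst, add_dotProduct, smul_dotProduct, smul_dotProduct]
      simp [e, single_dotProduct]
    have haa : intVec a ⬝ᵥ intVec a = 2 := by rw [intVec_dot, ha]; norm_num
    have hval : ∀ k, reflection (intVec a) x k =
        x k - (s * x i + t * x j) * (s * (e i : V N) k + t * (e j : V N) k) := by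
      intro k
      rw [reflection_apply, hdot, haa, mul_div_cancel_left₀ _ two_ne_zero, hst]
      simp [mul_add]
    have hj : j ∈ Finset.univ.erase i := Finset.mem_erase.mpr ⟨hij.symm, Finset.mem_univ _⟩
    rw [← Finset.mul_prod_erase _ _ (Finset.mem_univ i), ← Finset.mul_prod_erase _ _ hj,
      ← Finset.mul_prod_erase _ x (Finset.mem_univ i), ← Finset.mul_prod_erase _ x hj]
    have hrest : ∏ k ∈ (Finset.univ.erase i).erase j, reflection (intVec a) x k =
        ∏ k ∈ (Finset.univ.erase i).erase j, x k := by
      refine Finset.prod_congr rfl fun k hk => ?_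
      have hkj := (Finset.mem_erase.mp hk).1
      have hki := (Finset.mem_erase.mp (Finset.mem_erase.mp hk).2).1
      rw [hval]
      simp [e, hki, hkj]
    rw [hrest, ← mul_assoc, ← mul_assoc]
    congr 1
    rw [hval, hval]
    simp only [e, Pi.single_eq_same, Pi.single_eq_of_ne hij, Pi.single_eq_of_ne hij.symm, mul_zero,
      mul_one, add_zero, zero_add]
    have hi' : x i - (s * x i + t * x j) * s = -(s * t) * x j := by
      linear_combination (-x i) * hs
    have hj' : x j - (s * x i + t * x j) * t = -(s * t) * x i := by
      linear_combination (-x j) * ht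
    rw [hi', hj']
    linear_combination (x i * x j * t * t) * hs + (x i * x j) * ht
  have hsq : ∀ k : ℤ, k = 1 ∨ k = -1 → (k : ℂ) * k = 1 := by
    rintro k (rfl | rfl) <;> norm_num
  exact hs _ _ (hsq _ h1) (hsq _ h2) (by conv_lhs => rw [h3, intVec_pair])

/-- A Weyl group element which fixes a vector that lies on no mirror is trivial. -/
theorem IsClassical.eq_one_of_fixes_regular (hR : IsClassical R) {w : V N ≃ₗ[ℂ] V N}
    (hw : w ∈ reflGroup R) {z : V N} (hz : ∀ α ∈ R, α ⬝ᵥ z ≠ 0) (hwz : w z = z) : w = 1 := by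
  have hedot : ∀ i, (e i : V N) ⬝ᵥ z = z i := fun i => by simp [e]
  have hcoord : ∀ i (x : V N), w (e i) = x → z i = x ⬝ᵥ z := by
    rintro i x rfl
    rw [← hedot, ← weyl_dot hw, hwz]
  -- An element fixing `z` sends `e_i` to some `±e_j` with `z_i = ±z_j`. Regularity excludes most of
  -- these possibilities, and what survives depends on the type.
  have hA : ∀ i j, i ≠ j → z i ≠ z j := by
    intro i j hij h
    have hmem : e i - e j ∈ R := by
      rcases hR with rfl | rfl | rfl
      · exact e_sub_mem_rootsA hij
      · exact rootsD_subset_rootsB (rootsA_subset_rootsD (e_sub_mem_rootsA hij))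
      · exact rootsA_subset_rootsD (e_sub_mem_rootsA hij)
    exact hz _ hmem (by rw [sub_dotProduct, hedot, hedot, h, sub_self])
  apply ext_on_basis
  have hcases : ∀ i, w (e i) = e i ∨ ∃ j, w (e i) = -e j := by
    intro i
    obtain ⟨j, hj | hj⟩ := hR.weyl_e hw i
    · by_cases hij : i = j
      · subst hij; exact Or.inl hj
      · exact absurd (by rw [hcoord i _ hj, hedot]) (hA i j hij)
    · exact Or.inr ⟨j, hj⟩
  have hD : rootsD N ⊆ R → ∀ i, w (e i) = e i ∨ w (e i) = -e i ∧ z i = 0 := by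
    intro hDR i
    refine (hcases i).imp_right ?_
    rintro ⟨j, hj⟩
    have h1 := hcoord i _ hj
    rw [neg_dotProduct, hedot] at h1
    by_cases hij : i = j
    · subst hij
      exact ⟨hj, by linear_combination (1 / 2 : ℂ) * h1⟩
    · refine absurd ?_ (hz _ (hDR (e_add_mem_rootsD hij)))
      rw [add_dotProduct, hedot, hedot, h1, neg_add_cancel]
  intro i
  change w (e i) = e i
  rcases hR with rfl | rfl | rfl
  · refine (hcases i).resolve_right ?_
    rintro ⟨j, hj⟩
    -- In type `A` the sum of the coordinates is invariant, so no basis vector can go to `-e_j`.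
    have := apply_eq_of_reflection (A := rootsA N) (fun x : V N => ∑ k, x k) (fun α hα x => by
      obtain ⟨a, rfl, -, h0⟩ := mem_rootsA_iff.mp hα
      have h0' : ∑ k, (a k : ℂ) = 0 := by exact_mod_cast h0
      simp [reflection_apply, Finset.sum_sub_distrib, ← Finset.mul_sum, intVec, h0']) hw (e i)
    rw [hj] at this
    simp [e] at this
    norm_num at this
  · refine (hD rootsD_subset_rootsB i).resolve_right ?_
    rintro ⟨-, h0⟩
    exact hz _ (e_mem_rootsB i) (by rw [hedot, h0])
  · by_contra hne
    obtain ⟨hneg, h0⟩ := (hD subset_rfl i).resolve_left hne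
    -- In type `D` at most one coordinate of a regular `z` vanishes, so `w` could only be the single
    -- sign change at `i`. That changes the sign of the product of the coordinates of `(1, …, 1)`.
    have hothers : ∀ k, k ≠ i → w (e k) = e k := by
      intro k hk
      refine (hD subset_rfl k).resolve_right ?_
      rintro ⟨-, h0'⟩
      exact hA k i hk (by rw [h0, h0'])
    have hprod := apply_eq_of_reflection (A := rootsD N) (fun x : V N => ∏ k, x k)
      (fun α hα x => prod_reflection_of_mem_rootsD hα x) hw (∑ k, e k)
    have hsum : w (∑ k, e k) = ∑ k, e k - (2 : ℂ) • e i := by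
      rw [map_sum, ← Finset.add_sum_erase _ _ (Finset.mem_univ i),
        ← Finset.add_sum_erase _ (fun k => (e k : V N)) (Finset.mem_univ i), hneg,
        Finset.sum_congr rfl fun k hk => hothers k (Finset.mem_erase.mp hk).1, two_smul]
      abel
    have hone : (∑ k, e k : V N) = fun _ => 1 := by
      ext k
      simp [e, Finset.sum_apply, Pi.single_apply]
    rw [hsum, hone] at hprod
    have hval : ∀ k, ((fun _ => 1) - (2 : ℂ) • e i : V N) k = if k = i then -1 else 1 := by
      intro k
      by_cases hk : k = i
      · subst hk; simp [e]; norm_num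
      · simp [e, hk]
    simp only [hval, Finset.prod_ite_eq', Finset.mem_univ, if_true, Finset.prod_const_one] at hprod
    norm_num at hprod

end Roots

end

section

variable {N : ℕ} {R Γ₀ : Finset (V N)} {t : Fin N → ℝ}

/-- The vector `t`, viewed in `ℂ^N`. -/
def heightVec (t : Fin N → ℝ) : V N := fun i => (t i : ℂ)

/-! ### Heights and positive roots -/

section Heights

theorem height_add (t : Fin N → ℝ) (x y : V N) : height t (x + y) = height t x + height t y := by
  simp [height, mul_add, Finset.sum_add_distrib]

theorem height_neg (t : Fin N → ℝ) (x : V N) : height t (-x) = -height t x := by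
  simp [height]

theorem IsClassical.conj_eq (hR : IsClassical R) {α : V N} (hα : α ∈ R) (i : Fin N) :
    (starRingEnd ℂ) (α i) = α i := by
  obtain ⟨a, rfl, -⟩ := hR.exists_intVec hα
  simp [intVec]

theorem IsClassical.dot_heightVec (hR : IsClassical R) {α : V N} (hα : α ∈ R) (t : Fin N → ℝ) :
    α ⬝ᵥ heightVec t = (height t α : ℂ) := by
  rw [height, Complex.ofReal_sum]
  refine Finset.sum_congr rfl fun i _ => ?_
  rw [Complex.ofReal_mul, Complex.conj_eq_iff_re.mp (hR.conj_eq hα i), mul_comm]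
  rfl

theorem subset_of_isSimpleRoot (hΓ₀ : ∀ β ∈ Γ₀, IsSimpleRoot R t β) : Γ₀ ⊆ R :=
  fun β hβ => mem_of_mem_posRoots (hΓ₀ β hβ).1

theorem reflGroup_mono {A B : Finset (V N)} (h : A ⊆ B) : reflGroup A ≤ reflGroup B :=
  Subgroup.closure_mono (Set.image_mono h)

theorem mem_posRoots {α : V N} : α ∈ posRoots R t ↔ α ∈ R ∧ 0 < height t α := by
  classical
  exact Finset.mem_filter

theorem IsClassical.pos_or_neg (hR : IsClassical R) (ht : ∀ α ∈ R, height t α ≠ 0) {α : V N}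
    (hα : α ∈ R) : α ∈ posRoots R t ∨ -α ∈ posRoots R t := by
  rcases lt_or_gt_of_ne (ht α hα) with h | h
  · exact Or.inr (mem_posRoots.mpr ⟨hR.neg_mem hα, by rw [height_neg]; linarith⟩)
  · exact Or.inl (mem_posRoots.mpr ⟨hα, h⟩)

end Heights

/-! ### Simple roots and the roots orthogonal to the flat -/

section SimpleRoots

/-- Otherwise `β - γ` or its negative would be a positive root, and would exhibit one of the two
simple roots as a sum of positive roots. -/
theorem simple_dot_nonpos (hR : IsClassical R) (ht : ∀ α ∈ R, height t α ≠ 0) {β γ : V N}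
    (hβ : IsSimpleRoot R t β) (hγ : IsSimpleRoot R t γ) (hne : β ≠ γ) : (β ⬝ᵥ γ).re ≤ 0 := by
  by_contra h
  have hmem := hR.sub_mem (mem_of_mem_posRoots hβ.1) (mem_of_mem_posRoots hγ.1) hne (not_le.mp h)
  rcases hR.pos_or_neg ht hmem with h1 | h1
  · exact hβ.2 γ hγ.1 _ h1 (by abel)
  · exact hγ.2 β hβ.1 _ h1 (by abel)

/-- A counterexample of minimal height is not simple, and both summands of a decomposition have
smaller height. -/
theorem posRoot_mem_closure_simple {α : V N} (hα : α ∈ posRoots R t) :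
    α ∈ AddSubmonoid.closure {β | IsSimpleRoot R t β} := by
  classical
  by_contra hne
  have hA : ((posRoots R t).filter fun α =>
      α ∉ AddSubmonoid.closure {β | IsSimpleRoot R t β}).Nonempty :=
    ⟨α, Finset.mem_filter.mpr ⟨hα, hne⟩⟩
  obtain ⟨β, hβ, hmin⟩ := Finset.exists_min_image _ (height t) hA
  obtain ⟨hβ1, hβ2⟩ := Finset.mem_filter.mp hβ
  have hns : ¬ IsSimpleRoot R t β := fun h => hβ2 (AddSubmonoid.subset_closure h)
  simp only [IsSimpleRoot, hβ1, true_and, not_forall] at hns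
  obtain ⟨γ, hγ, δ, hδ, h⟩ := hns
  rw [not_not] at h
  have hγ0 := (mem_posRoots.mp hγ).2
  have hδ0 := (mem_posRoots.mp hδ).2
  have hlt : ∀ x ∈ posRoots R t, height t x < height t β →
      x ∈ AddSubmonoid.closure {β | IsSimpleRoot R t β} := by
    intro x hx hxβ
    by_contra hx'
    exact absurd (hmin x (Finset.mem_filter.mpr ⟨hx, hx'⟩)) (not_le.mpr hxβ)
  rw [h, height_add] at hlt
  exact hβ2 (h ▸ add_mem (hlt γ hγ (by linarith)) (hlt δ hδ (by linarith)))

theorem mem_span_of_orthogonal {x : V N} (hx : ∀ y ∈ flat Γ₀, x ⬝ᵥ y = 0) :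
    ∃ z : Γ₀ → ℂ, x = ∑ β, z β • (β : V N) := by
  have h := mem_span_of_iInf_ker_le_ker (L := fun β : Γ₀ => dotForm (β : V N)) (K := dotForm x) (by
    intro y hy
    rw [Submodule.mem_iInf] at hy
    exact hx y fun β hβ => hy ⟨β, hβ⟩)
  obtain ⟨z, hz⟩ := (Submodule.mem_span_range_iff_exists_fun ℂ).mp h
  refine ⟨z, ?_⟩
  ext i
  have := LinearMap.congr_fun hz (e i)
  rw [LinearMap.sum_apply] at this
  have hi : ∀ y : V N, dotForm y (e i) = y i := fun y => by simp [dotForm, e]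
  simp only [LinearMap.smul_apply, hi] at this
  rw [← this]
  simp

/-- A positive root orthogonal to `π` is a nonnegative combination of the elements of `Γ₀`. -/
theorem posRoot_mem_closure_of_orthogonal (hR : IsClassical R) (ht : ∀ α ∈ R, height t α ≠ 0)
    (hΓ₀ : ∀ β ∈ Γ₀, IsSimpleRoot R t β) {α : V N} (hα : α ∈ posRoots R t)
    (hπ : ∀ y ∈ flat Γ₀, α ⬝ᵥ y = 0) : α ∈ AddSubmonoid.closure (Γ₀ : Set (V N)) := by
  classical
  have hα' := posRoot_mem_closure_simple hα
  -- Split off the contribution `α₂` of the simple roots outside `Γ₀`; the aim is `α₂ = 0`. Since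
  -- `α₂` is orthogonal to `π`, it lies in the span of `Γ₀`.
  have hunion : {β | IsSimpleRoot R t β} = (Γ₀ : Set (V N)) ∪
      {β | IsSimpleRoot R t β ∧ β ∉ Γ₀} := by
    ext β
    simp only [Set.mem_ofPred_eq, Set.mem_union, Finset.mem_coe]
    by_cases h : β ∈ Γ₀
    · simp [h, hΓ₀ β h]
    · simp [h]
  rw [hunion, AddSubmonoid.closure_union, AddSubmonoid.mem_sup] at hα'
  obtain ⟨α₁, h1, α₂, h2, rfl⟩ := hα'
  have hα₁ : ∀ y ∈ flat Γ₀, α₁ ⬝ᵥ y = 0 := by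
    intro y hy
    clear hα hπ
    induction h1 using AddSubmonoid.closure_induction with
    | mem x hx => exact hy x hx
    | zero => exact zero_dotProduct y
    | add u v _ _ hu hv => rw [add_dotProduct, hu, hv, add_zero]
  obtain ⟨z, hz⟩ := mem_span_of_orthogonal (x := α₂) (fun y hy => by
    have := hπ y hy
    rwa [add_dotProduct, hα₁ y hy, zero_add] at this)
  have hreal : ∀ β : Γ₀, ∀ i, ((β : V N) i).im = 0 := fun β i =>
    Complex.conj_eq_iff_im.mp (hR.conj_eq (mem_of_mem_posRoots (hΓ₀ β β.2).1) i)
  -- These three properties hold for simple roots outside `Γ₀` and are stable under addition.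
  have hα₂ : (∀ i, (α₂ i).im = 0) ∧ (∀ β ∈ Γ₀, (β ⬝ᵥ α₂).re ≤ 0) ∧
      (α₂ = 0 ∨ 0 < height t α₂) := by
    clear hz hα hπ
    induction h2 using AddSubmonoid.closure_induction with
    | mem x hx =>
      refine ⟨fun i => Complex.conj_eq_iff_im.mp (hR.conj_eq (mem_of_mem_posRoots hx.1.1) i),
        fun β hβ => simple_dot_nonpos hR ht (hΓ₀ β hβ) hx.1 ?_,
        Or.inr (mem_posRoots.mp hx.1.1).2⟩
      rintro rfl
      exact hx.2 hβ
    | zero => simp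
    | add u v _ _ hu hv =>
      refine ⟨fun i => by simp [hu.1 i, hv.1 i], fun β hβ => ?_, ?_⟩
      · rw [dotProduct_add, Complex.add_re]
        linarith [hu.2.1 β hβ, hv.2.1 β hβ]
      · rcases hu.2.2 with rfl | h1 <;> rcases hv.2.2 with rfl | h2
        · simp
        · right; simpa using h2
        · right; simpa using h1
        · right; rw [height_add]; linarith
  obtain ⟨him, hdot, hht⟩ := hα₂
  -- Because `α₂` and the roots are real, the real parts of the coefficients still represent `α₂`.
  -- Separating positive and negative coefficients yields `a = α₂ + b`, with nonnegative
  -- combinations `a` and `b` of disjoint subsets of `Γ₀`; linear independence of the simple roots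
  -- is not needed.
  set x : Γ₀ → ℝ := fun β => (z β).re with hx
  set a : V N := ∑ β : Γ₀, ((max (x β) 0 : ℝ) : ℂ) • (β : V N) with ha
  set b : V N := ∑ β : Γ₀, ((max (-x β) 0 : ℝ) : ℂ) • (β : V N) with hb
  have hab : a = α₂ + b := by
    ext i
    have h3 : α₂ i = ((α₂ i).re : ℂ) := by
      apply Complex.ext <;> simp [him i]
    have h4 : (α₂ i).re = ∑ β : Γ₀, x β * ((β : V N) i).re := by
      conv_lhs => rw [hz]
      rw [Finset.sum_apply, Complex.re_sum]
      refine Finset.sum_congr rfl fun β _ => ?_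
      simp [hreal β i, hx]
    have h5 : ∀ β : Γ₀, (β : V N) i = (((β : V N) i).re : ℂ) := fun β => by
      apply Complex.ext <;> simp [hreal β i]
    rw [Pi.add_apply, h3, h4, ha, hb, Finset.sum_apply, Finset.sum_apply, Complex.ofReal_sum,
      ← Finset.sum_add_distrib]
    refine Finset.sum_congr rfl fun β _ => ?_
    have h6 : max (x β) 0 = x β + max (-x β) 0 := by
      rcases le_total (x β) 0 with h | h
      · rw [max_eq_right h, max_eq_left (by linarith)]; ring
      · rw [max_eq_left h, max_eq_right (by linarith)]; ring
    simp only [Pi.smul_apply, smul_eq_mul]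
    rw [h6, Complex.ofReal_add, Complex.ofReal_mul, ← h5 β]
    ring
  -- Both `(a, α₂)` and `(a, b)` are nonpositive, since distinct simple roots make no acute angle.
  -- As `a` is real, it vanishes.
  have haa : (a ⬝ᵥ a).re ≤ 0 := by
    have h7 : (a ⬝ᵥ (α₂ + b)).re ≤ 0 := by
      rw [ha, sum_dotProduct, Complex.re_sum]
      refine Finset.sum_nonpos fun β _ => ?_
      rw [smul_dotProduct, smul_eq_mul, Complex.re_ofReal_mul]
      rcases le_or_gt (x β) 0 with h | h
      · rw [max_eq_right h, zero_mul]
      · refine mul_nonpos_of_nonneg_of_nonpos (le_max_right _ _) ?_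
        rw [dotProduct_add, Complex.add_re]
        refine add_nonpos (hdot β β.2) ?_
        rw [hb, dotProduct_sum, Complex.re_sum]
        refine Finset.sum_nonpos fun γ _ => ?_
        rw [dotProduct_smul, smul_eq_mul, Complex.re_ofReal_mul]
        by_cases hγ : γ = β
        · subst hγ
          rw [max_eq_right (by linarith), zero_mul]
        · exact mul_nonpos_of_nonneg_of_nonpos (le_max_right _ _)
            (simple_dot_nonpos hR ht (hΓ₀ β β.2) (hΓ₀ γ γ.2) fun h => hγ (Subtype.ext h.symm))
    rwa [← hab] at h7
  have haim : ∀ i, (a i).im = 0 := by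
    intro i
    rw [ha, Finset.sum_apply, Complex.im_sum]
    refine Finset.sum_eq_zero fun β _ => ?_
    simp [hreal β i]
  have ha0 : a = 0 := by
    have h8 : (a ⬝ᵥ a).re = ∑ i, (a i).re * (a i).re := by
      rw [dotProduct, Complex.re_sum]
      refine Finset.sum_congr rfl fun i _ => ?_
      rw [Complex.mul_re, haim i]
      ring
    rw [h8] at haa
    have h9 := (Finset.sum_eq_zero_iff_of_nonneg fun i _ => mul_self_nonneg (a i).re).mp
      (le_antisymm haa (Finset.sum_nonneg fun i _ => mul_self_nonneg _))
    ext i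
    exact Complex.ext (mul_self_eq_zero.mp (h9 i (Finset.mem_univ i))) (haim i)
  -- With `a = 0` the heights of `α₂` and `b` add up to zero, which excludes a positive height of
  -- `α₂`.
  have hbht : 0 ≤ height t b := by
    have h10 : height t b = ∑ β : Γ₀, max (-x β) 0 * height t β := by
      simp only [height, hb, Finset.sum_apply, Complex.re_sum, Finset.mul_sum]
      rw [Finset.sum_comm]
      refine Finset.sum_congr rfl fun β _ => Finset.sum_congr rfl fun i _ => ?_
      rw [Pi.smul_apply, smul_eq_mul, Complex.re_ofReal_mul]
      ring
    rw [h10]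
    exact Finset.sum_nonneg fun β _ => mul_nonneg (le_max_right _ _)
      (mem_posRoots.mp (hΓ₀ β β.2).1).2.le
  have hzero : α₂ = 0 := by
    refine hht.resolve_right fun h11 => ?_
    have := congrArg (height t) hab
    rw [ha0, height_add] at this
    have h0 : height t 0 = 0 := by simp [height]
    linarith
  rw [hzero, add_zero]
  exact h1

end SimpleRoots

/-! ### The stabilizer of a generic point of the flat -/

section Stabilizer

/-- The stabilizer of a generic point of `π` is the parabolic subgroup generated by the reflections
of `Γ₀`. -/
theorem mem_parabolic_of_fixes (hR : IsClassical R) (ht : ∀ α ∈ R, height t α ≠ 0)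
    (hΓ₀ : ∀ β ∈ Γ₀, IsSimpleRoot R t β) {x₀ : flat Γ₀} (hx₀ : IsGeneric R Γ₀ x₀)
    {w : V N ≃ₗ[ℂ] V N} (hw : w ∈ reflGroup R) (hwx : w (x₀ : V N) = x₀) : w ∈ reflGroup Γ₀ := by
  have hsub : Γ₀ ⊆ R := subset_of_isSimpleRoot hΓ₀
  have hle := reflGroup_mono hsub
  set T := heightVec t with hT
  have hfinW := hR.finite_weyl
  have hfin₀ : Finite (reflGroup Γ₀) := Finite.of_injective
    (fun u : reflGroup Γ₀ => (⟨u, hle u.2⟩ : reflGroup R)) fun u v h =>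
      Subtype.ext (congrArg (fun x : reflGroup R => (x : V N ≃ₗ[ℂ] V N)) h)
  -- Correcting `w` on the left by a suitable `w₀ ∈ W₀` moves `w T` into the dominant chamber of
  -- `W₀`. The goal becomes `g = w₀ w = 1`.
  obtain ⟨w₀, hmax⟩ := Finite.exists_max fun u : reflGroup Γ₀ =>
    (T ⬝ᵥ (u : V N ≃ₗ[ℂ] V N) (w T)).re
  set g : V N ≃ₗ[ℂ] V N := w₀ * w with hg
  have hgW : g ∈ reflGroup R := mul_mem (hle w₀.2) hw
  have hgx : g (x₀ : V N) = x₀ := by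
    change w₀.1 (w x₀) = x₀
    rw [hwx, parabolic_fixes w₀.2 x₀.2]
  have hgT : ∀ α ∈ R, α ⬝ᵥ g T = (height t (g⁻¹ α) : ℂ) ∧ g⁻¹ α ∈ R := by
    intro α hα
    have hmem : g⁻¹ α ∈ R := (hR.weyl_mem_iff (inv_mem hgW) α).mpr hα
    exact ⟨by rw [weyl_dot_right hgW, hT, hR.dot_heightVec hmem], hmem⟩
  have hsimple : ∀ β ∈ Γ₀, 0 < (β ⬝ᵥ g T).re := by
    intro β hβ
    have hβR := hsub hβ
    obtain ⟨h1, h2⟩ := hgT β hβR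
    -- Comparing with `s_β w₀` shows that `(β, gT)` times the height of `β` is nonnegative. The
    -- first factor is the height of the root `g⁻¹ β`, so it is not zero.
    have h3 := hmax ⟨reflection β * w₀, mul_mem (Subgroup.subset_closure ⟨β, hβ, rfl⟩) w₀.2⟩
    change (T ⬝ᵥ reflection β (g T)).re ≤ (T ⬝ᵥ g T).re at h3
    rw [reflection_apply, dotProduct_sub, dotProduct_smul, dotProduct_comm T β, h1,
      hR.dot_heightVec hβR, Complex.sub_re] at h3
    have h4 := (mem_posRoots.mp (hΓ₀ β hβ).1).2
    have h5 := ht _ h2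
    rw [h1, Complex.ofReal_re]
    rcases hR.dot_self hβR with h6 | h6
    · rw [h6] at h3
      have h7 : ((2 * (height t (g⁻¹ β) : ℂ) / 1) • (height t β : ℂ)).re =
          2 * height t (g⁻¹ β) * height t β := by
        rw [← Complex.ofReal_re (2 * height t (g⁻¹ β) * height t β)]
        congr 1
        push_cast
        rw [smul_eq_mul]
        ring
      rw [h7] at h3
      refine lt_of_le_of_ne ?_ (Ne.symm h5)
      by_contra h8
      nlinarith
    · rw [h6] at h3
      have h7 : ((2 * (height t (g⁻¹ β) : ℂ) / 2) • (height t β : ℂ)).re =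
          height t (g⁻¹ β) * height t β := by
        rw [← Complex.ofReal_re (height t (g⁻¹ β) * height t β)]
        congr 1
        push_cast
        rw [smul_eq_mul]
        ring
      rw [h7] at h3
      refine lt_of_le_of_ne ?_ (Ne.symm h5)
      by_contra h8
      nlinarith
  have hpos : ∀ α ∈ posRoots R t, α ⬝ᵥ (x₀ : V N) = 0 → 0 < (α ⬝ᵥ g T).re := by
    intro α hα hαx
    have hcl := posRoot_mem_closure_of_orthogonal hR ht hΓ₀ hα
      (hx₀ α (mem_of_mem_posRoots hα) hαx)
    have : α = 0 ∨ 0 < (α ⬝ᵥ g T).re := by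
      clear hα hαx
      induction hcl using AddSubmonoid.closure_induction with
      | mem x hx => exact Or.inr (hsimple x hx)
      | zero => exact Or.inl rfl
      | add u v _ _ hu hv =>
        rcases hu with rfl | hu <;> rcases hv with rfl | hv
        · simp
        · right; simpa using hv
        · right; simpa using hu
        · right; rw [add_dotProduct, Complex.add_re]; linarith
    refine this.resolve_left ?_
    rintro rfl
    exact hR.dot_self_ne_zero (mem_of_mem_posRoots hα) (dotProduct_zero 0)
  -- Since `(α, gT)` is the height of `g⁻¹ α`, the element `g⁻¹` permutes the positive roots that
  -- vanish at `x₀`; hence the positivity propagates to all powers of `g`.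
  have hiter : ∀ k : ℕ, ∀ α ∈ posRoots R t, α ⬝ᵥ (x₀ : V N) = 0 → 0 < (α ⬝ᵥ (g ^ k) T).re := by
    intro k
    induction k with
    | zero =>
      intro α hα _
      change 0 < (α ⬝ᵥ T).re
      rw [hT, hR.dot_heightVec (mem_of_mem_posRoots hα), Complex.ofReal_re]
      exact (mem_posRoots.mp hα).2
    | succ k ih =>
      intro α hα hαx
      have hαR := mem_of_mem_posRoots hα
      obtain ⟨h1, h2⟩ := hgT α hαR
      have h3 := hpos α hα hαx
      rw [h1, Complex.ofReal_re] at h3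
      rw [pow_succ', LinearEquiv.mul_apply, weyl_dot_right hgW]
      refine ih _ (mem_posRoots.mpr ⟨h2, h3⟩) ?_
      rw [← weyl_dot_right hgW, hgx, hαx]
  have hgfin : IsOfFinOrder (⟨g, hgW⟩ : reflGroup R) := isOfFinOrder_of_finite _
  set n := orderOf (⟨g, hgW⟩ : reflGroup R) with hn
  have hnpos : 0 < n := hgfin.orderOf_pos
  have hgn : g ^ n = 1 := congrArg Subtype.val (pow_orderOf_eq_one (⟨g, hgW⟩ : reflGroup R))
  -- The sum over the cyclic group generated by `g` is fixed by `g` and still positive on the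
  -- positive roots vanishing at `x₀`. A small generic perturbation `x₀ + ε Y` is then a regular
  -- vector fixed by `g`, and freeness gives `g = 1`.
  set Y : V N := ∑ k ∈ Finset.range n, (g ^ k) T with hY
  have hgY : g Y = Y := by
    have h1 : g Y = ∑ k ∈ Finset.range n, (g ^ (k + 1)) T := by
      rw [hY, map_sum]
      refine Finset.sum_congr rfl fun k _ => ?_
      rw [pow_succ']
      rfl
    have h2 := Finset.sum_range_succ' (fun k => (g ^ k) T) n
    rw [Finset.sum_range_succ, hgn, pow_zero] at h2
    rw [h1]
    exact (add_right_cancel h2).symm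
  have hYpos : ∀ α ∈ posRoots R t, α ⬝ᵥ (x₀ : V N) = 0 → α ⬝ᵥ Y ≠ 0 := by
    intro α hα hαx h0
    have h1 : 0 < (α ⬝ᵥ Y).re := by
      rw [hY, dotProduct_sum, Complex.re_sum]
      exact Finset.sum_pos (fun k _ => hiter k α hα hαx) ⟨0, Finset.mem_range.mpr hnpos⟩
    rw [h0] at h1
    exact lt_irrefl _ h1
  have hYne : ∀ α ∈ R, α ⬝ᵥ (x₀ : V N) = 0 → α ⬝ᵥ Y ≠ 0 := by
    intro α hα hαx
    rcases hR.pos_or_neg ht hα with h | h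
    · exact hYpos α h hαx
    · have := hYpos _ h (by rw [neg_dotProduct, hαx, neg_zero])
      rwa [neg_dotProduct, neg_ne_zero] at this
  obtain ⟨ε, hε⟩ := (eventually_regular hYne).exists
  have hg1 : g = 1 := hR.eq_one_of_fixes_regular hgW hε (by rw [map_add, map_smul, hgx, hgY])
  have : w = (w₀ : V N ≃ₗ[ℂ] V N)⁻¹ := eq_inv_of_mul_eq_one_right hg1
  rw [this]
  exact inv_mem w₀.2

end Stabilizer

end

/-! ### Weyl group action and difference quotients on ambient germs -/

section

variable {N : ℕ} {R : Finset (V N)} {S : Set (V N)}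

/-- The set `S` is stable under the group generated by the reflections of `R`. -/
def WeylStable (R : Finset (V N)) (S : Set (V N)) : Prop :=
  ∀ w ∈ reflGroup R, Set.MapsTo w S S

/-- Germs near `S` of analytic functions on the ambient space. -/
abbrev Amb (S : Set (V N)) : Type := Germs S (Set.univ : Set (V N))

/-- The action of `W` on ambient germs, `(w f)(x) = f (w⁻¹ x)`. -/
def act (hS : WeylStable R S) (w : reflGroup R) : Amb S →ₐ[ℂ] Amb S :=
  pullback (((w⁻¹ : reflGroup R) : V N ≃ₗ[ℂ] V N) : V N →ₗ[ℂ] V N) (hS _ (w⁻¹).2)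
    (Set.mapsTo_univ _ _)

/-- The germ of the linear function `x ↦ (η, x)`. -/
def ell (S : Set (V N)) (η : V N) : Amb S := linGerm S Set.univ (dotForm η)

theorem dotForm_add (a b : V N) : dotForm (a + b) = dotForm a + dotForm b :=
  LinearMap.ext fun x => add_dotProduct a b x

theorem dotForm_smul (k : ℂ) (a : V N) : dotForm (k • a) = k • dotForm a :=
  LinearMap.ext fun x => smul_dotProduct k a x

theorem ell_add (a b : V N) : ell S (a + b) = ell S a + ell S b := by
  rw [ell, dotForm_add]; rfl

theorem ell_smul (k : ℂ) (a : V N) : ell S (k • a) = k • ell S a := by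
  rw [ell, dotForm_smul]; rfl

theorem ell_neg (a : V N) : ell S (-a) = -ell S a := by
  rw [← neg_one_smul ℂ, ell_smul, neg_one_smul]

theorem ell_sub (a b : V N) : ell S (a - b) = ell S a - ell S b := by
  rw [sub_eq_add_neg, ell_add, ell_neg, sub_eq_add_neg]

theorem act_mul (hS : WeylStable R S) (u w : reflGroup R) (F : Amb S) :
    act hS (u * w) F = act hS u (act hS w F) := by
  obtain ⟨f, hf, rfl⟩ := exists_germ F
  refine germ_congr (Filter.Eventually.of_forall fun x => ?_)
  change f (((u * w)⁻¹ : V N ≃ₗ[ℂ] V N) x) = f ((w⁻¹ : V N ≃ₗ[ℂ] V N) ((u⁻¹ : V N ≃ₗ[ℂ] V N) x))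
  rw [mul_inv_rev]
  rfl

theorem act_one (hS : WeylStable R S) (F : Amb S) : act hS 1 F = F := by
  obtain ⟨f, hf, rfl⟩ := exists_germ F
  exact germ_congr (Filter.Eventually.of_forall fun x => by simp)

theorem act_ell (hS : WeylStable R S) (w : reflGroup R) (η : V N) :
    act hS w (ell S η) = ell S ((w : V N ≃ₗ[ℂ] V N) η) := by
  refine germ_congr (Filter.Eventually.of_forall fun x => ?_)
  change η ⬝ᵥ (w : V N ≃ₗ[ℂ] V N)⁻¹ x = (w : V N ≃ₗ[ℂ] V N) η ⬝ᵥ x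
  rw [weyl_dot_left w.2]

theorem act_dirDeriv (hS : WeylStable R S) (w : reflGroup R) (ξ : V N) (F : Amb S) :
    act hS w (dirDeriv S ξ F) = dirDeriv S ((w : V N ≃ₗ[ℂ] V N) ξ) (act hS w F) := by
  rw [act, dirDeriv_pullback]
  congr 2
  exact (weyl_inv_apply_apply (w : V N ≃ₗ[ℂ] V N) ξ).symm ▸ rfl

theorem dirDeriv_ell_mul (ξ η : V N) (F : Amb S) :
    dirDeriv S ξ (ell S η * F) = (η ⬝ᵥ ξ) • F + ell S η * dirDeriv S ξ F := by
  rw [dirDeriv_mul, ell, dirDeriv_linGerm, Algebra.smul_def]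
  rfl

/-- The action of `W` on the roots. -/
def rootAct (hR : IsClassical R) (w : reflGroup R) : R ≃ R where
  toFun α := ⟨(w : V N ≃ₗ[ℂ] V N) α, (hR.weyl_mem_iff w.2 α).mpr α.2⟩
  invFun α := ⟨(w : V N ≃ₗ[ℂ] V N)⁻¹ α, (hR.weyl_mem_iff (inv_mem w.2) α).mpr α.2⟩
  left_inv _ := Subtype.ext (weyl_inv_apply_apply _ _)
  right_inv _ := Subtype.ext (weyl_apply_inv_apply _ _)

@[simp] theorem coe_rootAct (hR : IsClassical R) (w : reflGroup R) (α : R) :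
    (rootAct hR w α : V N) = (w : V N ≃ₗ[ℂ] V N) α := rfl

/-- The reflection `s_α`, as an element of the Weyl group. -/
abbrev sElt (α : R) : reflGroup R := reflElt α.2

theorem coe_sElt (α : R) : ((sElt α : reflGroup R) : V N ≃ₗ[ℂ] V N) = reflection (α : V N) := rfl

theorem sElt_rootAct (hR : IsClassical R) (w : reflGroup R) (α : R) :
    sElt (rootAct hR w α) * w = w * sElt α := by
  refine Subtype.ext (LinearEquiv.ext fun x => ?_)
  change reflection ((w : V N ≃ₗ[ℂ] V N) α) ((w : V N ≃ₗ[ℂ] V N) x) = _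
  rw [conj_reflection w.2, weyl_inv_apply_apply]
  rfl

theorem analyticOnNhd_divRefl (hR : IsClassical R) (hS : WeylStable R S) {α : V N} (hα : α ∈ R)
    {f : V N → ℂ} (hf : AnalyticOnNhd ℂ f S) : AnalyticOnNhd ℂ (divRefl α f) S := fun x hx =>
  analyticAt_divRefl (hR.dot_self_ne_zero hα) (hf x hx)
    (hf _ (hS _ (Subgroup.subset_closure ⟨α, hα, rfl⟩) hx))

theorem ell_mul_germ_divRefl (hR : IsClassical R) (hS : WeylStable R S) (α : R) {f : V N → ℂ}
    (hf : AnalyticOnNhd ℂ f S) :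
    ell S α * germ Set.univ (divRefl α f) (analyticOnNhd_divRefl hR hS α.2 hf) =
      germ Set.univ f hf - act hS (sElt α) (germ Set.univ f hf) := by
  rw [eq_sub_iff_add_eq]
  refine germ_congr (Filter.Eventually.of_forall fun x => ?_)
  change ((α : V N) ⬝ᵥ x) * divRefl α f x + f ((reflection (α : V N))⁻¹ x) = f x
  rw [dot_mul_divRefl, reflection_inv]
  ring

theorem exists_quot (hR : IsClassical R) (hS : WeylStable R S) (α : R) (F : Amb S) :
    ∃ G, ell S α * G = F - act hS (sElt α) F := by
  obtain ⟨f, hf, rfl⟩ := exists_germ F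
  exact ⟨_, ell_mul_germ_divRefl hR hS α hf⟩

/-- The linear form of a root is not a zero divisor on ambient germs. Hence `quot` does not depend
on any choice, and identities for it may be checked after multiplication by `(α, x)`. -/
theorem ell_cancel (hR : IsClassical R) (α : R) {F G : Amb S}
    (h : ell S α * F = ell S α * G) : F = G :=
  linGerm_mul_cancel (hR.dot_self_ne_zero α.2) h

/-- The operator `f ↦ (f - s_α f) / (α, x)` on ambient germs. -/
def quot (hR : IsClassical R) (hS : WeylStable R S) (α : R) : Module.End ℂ (Amb S) where
  toFun F := (exists_quot hR hS α F).choose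
  map_add' F G := by
    apply ell_cancel hR α
    rw [mul_add, (exists_quot hR hS α F).choose_spec, (exists_quot hR hS α G).choose_spec,
      (exists_quot hR hS α (F + G)).choose_spec, map_add]
    ring
  map_smul' a F := by
    apply ell_cancel hR α
    rw [RingHom.id_apply, mul_smul_comm, (exists_quot hR hS α F).choose_spec,
      (exists_quot hR hS α (a • F)).choose_spec, map_smul, smul_sub]

section Quot

variable (hR : IsClassical R) (hS : WeylStable R S)

theorem ell_mul_quot (α : R) (F : Amb S) :
    ell S α * quot hR hS α F = F - act hS (sElt α) F :=
  (exists_quot hR hS α F).choose_spec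

theorem quot_unique {α : R} {F G : Amb S} (h : ell S α * G = F - act hS (sElt α) F) :
    quot hR hS α F = G :=
  ell_cancel hR α ((ell_mul_quot hR hS α F).trans h.symm)

theorem quot_germ (α : R) {f : V N → ℂ} (hf : AnalyticOnNhd ℂ f S) :
    quot hR hS α (germ Set.univ f hf) =
      germ Set.univ (divRefl α f) (analyticOnNhd_divRefl hR hS α.2 hf) :=
  quot_unique hR hS (ell_mul_germ_divRefl hR hS α hf)

theorem act_quot (w : reflGroup R) (α : R) (F : Amb S) :
    act hS w (quot hR hS α F) = quot hR hS (rootAct hR w α) (act hS w F) := by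
  symm
  apply quot_unique
  rw [coe_rootAct, ← act_ell hS, ← map_mul, ell_mul_quot, map_sub, ← act_mul, ← act_mul,
    sElt_rootAct]

theorem ell_reflection (α η : V N) :
    ell S (reflection α η) = ell S η - (2 * (α ⬝ᵥ η) / (α ⬝ᵥ α)) • ell S α := by
  rw [reflection_apply, ell_sub, ell_smul]

/-- A twisted Leibniz rule: the failure of `q_α` to commute with a linear function is a multiple of
`s_α`, with no quotient left. -/
theorem quot_ell_mul (α : R) (η : V N) (F : Amb S) :
    quot hR hS α (ell S η * F) = ell S η * quot hR hS α F +
      (2 * ((α : V N) ⬝ᵥ η) / ((α : V N) ⬝ᵥ α)) • act hS (sElt α) F := by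
  apply quot_unique
  rw [map_mul, act_ell, coe_sElt, ell_reflection, mul_add, mul_left_comm, ell_mul_quot, sub_mul,
    mul_smul_comm, smul_mul_assoc]
  ring

theorem quot_one (α : R) : quot hR hS α 1 = 0 := by
  apply quot_unique
  simp

/-- The root `-α`. -/
def negRoot (α : R) : R := rootAct hR (sElt α) α

theorem coe_negRoot (α : R) : (negRoot hR α : V N) = -α :=
  reflection_self (hR.dot_self_ne_zero α.2)

theorem sElt_negRoot (α : R) : sElt (negRoot hR α) = sElt α := by
  apply Subtype.ext
  change reflection (negRoot hR α : V N) = reflection (α : V N)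
  rw [coe_negRoot, reflection_neg]

theorem quot_negRoot (α : R) (F : Amb S) :
    quot hR hS (negRoot hR α) F = -quot hR hS α F := by
  apply quot_unique
  rw [coe_negRoot, ell_neg, neg_mul_neg, ell_mul_quot, sElt_negRoot]

theorem dirDeriv_reflection (α ξ : V N) (F : Amb S) :
    dirDeriv S (reflection α ξ) F =
      dirDeriv S ξ F - (2 * (α ⬝ᵥ ξ) / (α ⬝ᵥ α)) • dirDeriv S α F := by
  have h : reflection α ξ = ξ + (-(2 * (α ⬝ᵥ ξ) / (α ⬝ᵥ α))) • α := by
    rw [reflection_apply, neg_smul, sub_eq_add_neg]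
  rw [h, dirDeriv_add, dirDeriv_smul, LinearMap.add_apply, LinearMap.smul_apply, neg_smul,
    sub_eq_add_neg]

theorem dirDeriv_act_sElt (α : R) (ξ : V N) (F : Amb S) :
    dirDeriv S ξ (act hS (sElt α) F) =
      act hS (sElt α) (dirDeriv S ξ F) -
        (2 * ((α : V N) ⬝ᵥ ξ) / ((α : V N) ⬝ᵥ α)) • act hS (sElt α) (dirDeriv S α F) := by
  rw [← map_smul, ← map_sub, ← dirDeriv_reflection, act_dirDeriv, coe_sElt,
    reflection_reflection]

/-- This is the derivative of the defining identity of `q_α`. With `ξ = α` it later determines the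
restrictions of `q_α` and `∂_α q_α` to the flat. -/
theorem ell_mul_dirDeriv_quot (α : R) (ξ : V N) (F : Amb S) :
    ell S α * dirDeriv S ξ (quot hR hS α F) =
      dirDeriv S ξ F - act hS (sElt α) (dirDeriv S ξ F) +
        (2 * ((α : V N) ⬝ᵥ ξ) / ((α : V N) ⬝ᵥ α)) • act hS (sElt α) (dirDeriv S α F) -
        ((α : V N) ⬝ᵥ ξ) • quot hR hS α F := by
  have h := congrArg (dirDeriv S ξ) (ell_mul_quot hR hS α F)
  rw [dirDeriv_ell_mul, map_sub, dirDeriv_act_sElt] at h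
  rw [eq_sub_iff_add_eq, add_comm, h]
  ring

/-- The commutator of `∂_ξ` and `q_α` depends on `ξ` only through the factor `(α, ξ)`. This disposes
of the mixed terms in the commutativity of Dunkl operators. -/
theorem dirDeriv_quot_symm (α : R) (ξ η : V N) (F : Amb S) :
    ((α : V N) ⬝ᵥ η) • (dirDeriv S ξ (quot hR hS α F) - quot hR hS α (dirDeriv S ξ F)) =
      ((α : V N) ⬝ᵥ ξ) • (dirDeriv S η (quot hR hS α F) - quot hR hS α (dirDeriv S η F)) := by
  apply ell_cancel hR α
  rw [mul_smul_comm, mul_smul_comm, mul_sub, mul_sub, ell_mul_quot, ell_mul_quot,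
    ell_mul_dirDeriv_quot, ell_mul_dirDeriv_quot]
  module

end Quot

/-! ### Polynomial interpolation on orbits -/

section Interpolation

theorem analyticOnNhd_eval (p : MvPolynomial (Fin N) ℂ) (S : Set (V N)) :
    AnalyticOnNhd ℂ (fun x : V N => MvPolynomial.eval x p) S := by
  induction p using MvPolynomial.induction_on with
  | C a => simpa using analyticOnNhd_const
  | add p q hp hq =>
    simp only [map_add]
    exact hp.add hq
  | mul_X p i hp =>
    simp only [map_mul, MvPolynomial.eval_X]
    exact hp.mul (analyticOnNhd_linear (LinearMap.proj i) S)

/-- The germ of a polynomial. -/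
def polyGerm (S : Set (V N)) (p : MvPolynomial (Fin N) ℂ) : Amb S :=
  germ Set.univ (fun x => MvPolynomial.eval x p) (analyticOnNhd_eval p S)

/-- Polynomials are generated from `1` by multiplication with linear forms and addition. -/
theorem apply_polyGerm_eq_zero (T : Module.End ℂ (Amb S)) (h1 : T 1 = 0)
    (hT : ∀ η F, T (ell S η * F) = ell S η * T F) (p : MvPolynomial (Fin N) ℂ) :
    T (polyGerm S p) = 0 := by
  induction p using MvPolynomial.induction_on with
  | C a =>
    have : polyGerm S (MvPolynomial.C a) = a • 1 :=
      germ_congr (Filter.Eventually.of_forall fun x => by simp)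
    rw [this, map_smul, h1, smul_zero]
  | add p q hp hq =>
    have : polyGerm S (p + q) = polyGerm S p + polyGerm S q :=
      germ_congr (Filter.Eventually.of_forall fun x => by simp)
    rw [this, map_add, hp, hq, add_zero]
  | mul_X p i hp =>
    have : polyGerm S (p * MvPolynomial.X i) = ell S (e i) * polyGerm S p := by
      refine germ_congr (Filter.Eventually.of_forall fun x => ?_)
      change _ = (e i ⬝ᵥ x) * MvPolynomial.eval x p
      simp [e, mul_comm]
    rw [this, hT, hp, mul_zero]

theorem exists_interpolation (A : Finset (V N)) (f : V N → ℂ) :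
    ∃ p : MvPolynomial (Fin N) ℂ, ∀ x ∈ A, MvPolynomial.eval x p = f x := by
  classical
  have hsep : ∀ x y : V N, ∃ q : MvPolynomial (Fin N) ℂ, x ≠ y →
      MvPolynomial.eval x q = 1 ∧ MvPolynomial.eval y q = 0 := by
    intro x y
    by_cases h : x = y
    · exact ⟨0, fun h' => absurd h h'⟩
    · obtain ⟨i, hi⟩ := Function.ne_iff.mp h
      refine ⟨MvPolynomial.C (x i - y i)⁻¹ * (MvPolynomial.X i - MvPolynomial.C (y i)), fun _ => ?_⟩
      simp [inv_mul_cancel₀ (sub_ne_zero.mpr hi)]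
  choose q hq using hsep
  refine ⟨∑ x ∈ A, MvPolynomial.C (f x) * ∏ y ∈ A.erase x, q x y, fun z hz => ?_⟩
  simp only [map_sum, map_mul, MvPolynomial.eval_C, map_prod]
  rw [Finset.sum_eq_single z]
  · rw [Finset.prod_eq_one, mul_one]
    intro y hy
    exact (hq z y (Finset.mem_erase.mp hy).1.symm).1
  · intro x _ hxz
    rw [Finset.prod_eq_zero (i := z) (Finset.mem_erase.mpr ⟨hxz.symm, hz⟩) (hq x z hxz).2, mul_zero]
  · exact fun h => absurd hz h

/-- Along a regular orbit the difference quotients involve no derivatives, only values at points of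
that orbit. This allows an analytic function to be replaced by an interpolating polynomial. -/
theorem divRefl_congr_of_regular {x : V N} (hx : ∀ α ∈ R, α ⬝ᵥ x ≠ 0) {f g : V N → ℂ}
    (hfg : ∀ w ∈ reflGroup R, f (w x) = g (w x)) {α : V N} (hα : α ∈ R) (hR : IsClassical R) :
    ∀ w ∈ reflGroup R, divRefl α f (w x) = divRefl α g (w x) := by
  intro w hw
  have hne : α ⬝ᵥ w x ≠ 0 := by
    rw [weyl_dot_right hw]
    exact hx _ ((hR.weyl_mem_iff (inv_mem hw) α).mpr hα)
  rw [divRefl, divRefl, if_neg hne, if_neg hne, hfg w hw]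
  congr 2
  exact hfg (reflection α * w) (mul_mem (Subgroup.subset_closure ⟨α, hα, rfl⟩) hw)

end Interpolation

theorem weylStable_univ (R : Finset (V N)) : WeylStable R (Set.univ : Set (V N)) :=
  fun _ _ => Set.mapsTo_univ _ _

/-- The vanishing of quadratic expressions in the operators `quot` which commute with
multiplications. -/
theorem sum_quot_quot_eq_zero (hR : IsClassical R) {t : Fin N → ℝ}
    (ht : ∀ α ∈ R, height t α ≠ 0) (κ : R → R → ℂ)
    (hκ : ∀ α β, κ α (rootAct hR (sElt α) β) = -κ β α) (hS : WeylStable R S) (F : Amb S) :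
    ∑ α, ∑ β, κ α β • quot hR hS α (quot hR hS β F) = 0 := by
  classical
  have hpoly : ∀ p : MvPolynomial (Fin N) ℂ, ∑ α, ∑ β, κ α β •
      quot hR (weylStable_univ R) α (quot hR (weylStable_univ R) β (polyGerm Set.univ p)) = 0 := by
    intro p
    have hU := weylStable_univ R
    let T : Module.End ℂ (Amb (Set.univ : Set (V N))) :=
      ∑ α, ∑ β, κ α β • (quot hR hU α * quot hR hU β)
    have hT : ∀ F, T F = ∑ α, ∑ β, κ α β • quot hR hU α (quot hR hU β F) := by
      intro F
      simp [T, LinearMap.sum_apply]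
    rw [← hT]
    refine apply_polyGerm_eq_zero T ?_ ?_ p
    · rw [hT]
      simp [quot_one]
    · intro η F
      set a : R → ℂ := fun α => 2 * ((α : V N) ⬝ᵥ η) / ((α : V N) ⬝ᵥ α) with ha
      have h1 : ∀ α β, κ α β • quot hR hU α (quot hR hU β (ell Set.univ η * F)) =
          ell Set.univ η * (κ α β • quot hR hU α (quot hR hU β F)) +
          (κ α β * a α) • quot hR hU (rootAct hR (sElt α) β) (act hU (sElt α) F) +
          (κ α β * a β) • quot hR hU α (act hU (sElt β) F) := by
        intro α β
        rw [quot_ell_mul, map_add, quot_ell_mul, map_smul, act_quot, mul_smul_comm]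
        simp only [ha, smul_add, smul_smul]
      -- Reindexing by `β ↦ s_α β` and using the hypothesis on `κ` turns the first family of twisted
      -- Leibniz terms into minus the second, so the quadratic expression commutes with linear
      -- functions.
      have h2 : ∀ α, ∑ β, (κ α β * a α) • quot hR hU (rootAct hR (sElt α) β) (act hU (sElt α) F) =
          -∑ β, (κ β α * a α) • quot hR hU β (act hU (sElt α) F) := by
        intro α
        rw [← Finset.sum_neg_distrib, ← Equiv.sum_comp (rootAct hR (sElt α))
          (fun β => -((κ β α * a α) • quot hR hU β (act hU (sElt α) F)))]
        refine Finset.sum_congr rfl fun β _ => ?_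
        have h3 := hκ α (rootAct hR (sElt α) β)
        have h4 : rootAct hR (sElt α) (rootAct hR (sElt α) β) = β :=
          Subtype.ext (reflection_reflection (α : V N) β)
        rw [h4] at h3
        rw [h3]
        module
      rw [hT, hT]
      simp only [h1, Finset.sum_add_distrib, h2, Finset.mul_sum]
      rw [add_assoc, add_eq_left, Finset.sum_neg_distrib,
        Finset.sum_comm (f := fun α β => (κ α β * a β) • quot hR hU α (act hU (sElt β) F)),
        neg_add_cancel]
  obtain ⟨f, hf, rfl⟩ := exists_germ F
  set E : (V N → ℂ) → V N → ℂ := fun g x => ∑ α : R, ∑ β : R,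
    κ α β * divRefl α (divRefl β g) x with hE
  have hEan : ∀ {S : Set (V N)} (_ : WeylStable R S) {g : V N → ℂ} (_ : AnalyticOnNhd ℂ g S),
      AnalyticOnNhd ℂ (E g) S := by
    intro S hS g hg x hx
    refine Finset.analyticAt_fun_sum _ fun α _ => Finset.analyticAt_fun_sum _ fun β _ => ?_
    exact analyticAt_const.mul
      (analyticOnNhd_divRefl hR hS α.2 (analyticOnNhd_divRefl hR hS β.2 hg) x hx)
  have hEgerm : ∀ {S : Set (V N)} (hS : WeylStable R S) {g : V N → ℂ} (hg : AnalyticOnNhd ℂ g S),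
      ∑ α, ∑ β, κ α β • quot hR hS α (quot hR hS β (germ Set.univ g hg)) =
        germ Set.univ (E g) (hEan hS hg) := by
    intro S hS g hg
    simp only [quot_germ]
    change ∑ α : R, ∑ β : R, κ α β • mkGerm S Set.univ _ = mkGerm S Set.univ _
    simp only [← map_smul, ← map_sum]
    congr 1
    apply Subtype.ext
    funext x
    simp [hE, Finset.sum_apply]
  rw [hEgerm]
  -- At a regular point the expression sees only the finitely many values of `f` on the orbit, so
  -- the polynomial case applies to an interpolating polynomial. Density of the regular points
  -- finishes the argument.
  have hzero : ∀ x : V N, (∀ α ∈ R, α ⬝ᵥ x ≠ 0) → E f x = 0 := by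
    intro x hx
    have := hR.finite_weyl
    have hfin : (Set.range fun w : reflGroup R => (w : V N ≃ₗ[ℂ] V N) x).Finite :=
      Set.finite_range _
    obtain ⟨p, hp⟩ := exists_interpolation hfin.toFinset f
    have hp' : ∀ w ∈ reflGroup R, f (w x) = MvPolynomial.eval (w x) p := fun w hw =>
      (hp _ (hfin.mem_toFinset.mpr ⟨⟨w, hw⟩, rfl⟩)).symm
    have hEp : E f x = E (fun z => MvPolynomial.eval z p) x := by
      refine Finset.sum_congr rfl fun α _ => Finset.sum_congr rfl fun β _ => ?_
      have h1 := divRefl_congr_of_regular (g := fun z => MvPolynomial.eval z p) hx hp' β.2 hR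
      have h2 := divRefl_congr_of_regular hx h1 α.2 hR
      congr 1
      exact h2 1 (one_mem _)
    rw [hEp]
    have h3 := hpoly p
    rw [polyGerm, hEgerm] at h3
    have h4 := germ_eq_iff (g := fun _ => 0) (hg := analyticOnNhd_const).mp h3
    rw [nhdsSet_univ] at h4
    exact h4 x trivial
  refine germ_eq_zero_of_regular R (u := heightVec t) (fun α hα => ?_) _
    (Filter.Eventually.of_forall hzero)
  rw [hR.dot_heightVec hα]
  exact_mod_cast ht α hα

end

section

/-! ### Commuting power sums from exchange relations -/

section PowerSums

variable {A : Type*} [Ring A]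

theorem commutator_pow_right {x y T : A} (hc : x * y - y * x = T * (y - x)) (hT : T * x = y * T)
    (n : ℕ) : x * y ^ n - y ^ n * x = T * (y ^ n - x ^ n) := by
  induction n with
  | zero => simp
  | succ n ih =>
    have h1 : x * y ^ (n + 1) - y ^ (n + 1) * x =
        (x * y - y * x) * y ^ n + y * (x * y ^ n - y ^ n * x) := by
      rw [pow_succ']; noncomm_ring
    rw [h1, hc, ih, ← mul_assoc y T, ← hT, pow_succ', pow_succ']
    noncomm_ring

/-- Each factor `x` is moved through `y ^ n` in turn; the resulting `T` is carried to the far left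
by `x T = T y`, which converts the factors `x` in front of it into `y`. -/
theorem commutator_pow_pow {x y T : A} (hc : x * y - y * x = T * (y - x)) (hT : T * x = y * T)
    (hT' : T * y = x * T) (m n : ℕ) : x ^ (m + 1) * y ^ n - y ^ n * x ^ (m + 1) =
      T * ∑ p ∈ Finset.HasAntidiagonal.antidiagonal m,
        (y ^ (p.1 + n) * x ^ p.2 - y ^ p.1 * x ^ (p.2 + n)) := by
  induction m with
  | zero =>
    simp only [Finset.Nat.antidiagonal_zero, Finset.sum_singleton, zero_add, pow_one,
      pow_zero, mul_one, one_mul]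
    exact commutator_pow_right hc hT n
  | succ m ih =>
    have h1 : x ^ (m + 1 + 1) * y ^ n - y ^ n * x ^ (m + 1 + 1) =
        x * (x ^ (m + 1) * y ^ n - y ^ n * x ^ (m + 1)) +
          (x * y ^ n - y ^ n * x) * x ^ (m + 1) := by
      rw [pow_succ' x (m + 1)]; noncomm_ring
    rw [h1, ih, commutator_pow_right hc hT, ← mul_assoc, ← hT', mul_assoc, mul_assoc, ← mul_add,
      Finset.Nat.sum_antidiagonal_succ, Finset.mul_sum, add_comm]
    congr 2
    · simp only [zero_add, pow_zero, one_mul]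
      rw [sub_mul, ← pow_add, add_comm n]
    · refine Finset.sum_congr rfl fun p _ => ?_
      simp only
      rw [mul_sub, ← mul_assoc, ← mul_assoc, ← pow_succ', ← pow_succ', add_right_comm]

/-- By the explicit formula, the difference of the two sides is `T` times a sum of terms which,
after swapping the antidiagonal indices, are differences of the same kind with total exponent one
lower. Induction on the total exponent applies. -/
theorem commutator_pow_symm {x y T : A} (hc : x * y - y * x = T * (y - x)) (hT : T * x = y * T)
    (hT' : T * y = x * T) (M : ℕ) : ∀ m n : ℕ, m + n = M →
      x ^ m * y ^ n - y ^ n * x ^ m = x ^ n * y ^ m - y ^ m * x ^ n := by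
  induction M using Nat.strong_induction_on with
  | _ M ih =>
    intro m n hmn
    rcases m with _ | m
    · simp
    have hc' : y * x - x * y = T * (x - y) := by
      rw [← neg_sub, hc]; noncomm_ring
    have h1 := commutator_pow_pow hc hT hT' m n
    have h2 := commutator_pow_pow hc' hT' hT m n
    rw [← sub_eq_zero, sub_eq_add_neg, neg_sub, h1, h2, ← mul_add, Finset.sum_sub_distrib,
      Finset.sum_sub_distrib]
    have s1 := Finset.Nat.sum_antidiagonal_swap (n := m)
      (f := fun p : ℕ × ℕ => x ^ p.1 * y ^ (p.2 + n))
    have s2 := Finset.Nat.sum_antidiagonal_swap (n := m)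
      (f := fun p : ℕ × ℕ => y ^ p.1 * x ^ (p.2 + n))
    simp only [Prod.fst_swap, Prod.snd_swap] at s1 s2
    rw [← s1, ← s2, ← Finset.sum_sub_distrib, ← Finset.sum_sub_distrib, ← Finset.sum_add_distrib,
      Finset.sum_eq_zero, mul_zero]
    intro p hp
    have hp' := Finset.HasAntidiagonal.mem_antidiagonal.mp hp
    have := ih (p.1 + n + p.2) (by omega) (p.1 + n) p.2 rfl
    refine Eq.trans ?_ (sub_eq_zero.mpr this)
    abel

theorem commute_power_sums {ι : Type*} [Fintype ι] [Algebra ℂ A] {h : ι → A} {T : ι → ι → A}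
    (hc : ∀ i j, i ≠ j → h i * h j - h j * h i = T i j * (h j - h i))
    (hT : ∀ i j, i ≠ j → T i j * h i = h j * T i j)
    (hT' : ∀ i j, i ≠ j → T i j * h j = h i * T i j) (m n : ℕ) :
    Commute (∑ i, h i ^ m) (∑ i, h i ^ n) := by
  -- Exchanging the exponents makes the commutator antisymmetric under exchange of `i` and `j`, so
  -- the double sum equals its own negative.
  have hsymm : ∀ i j, h i ^ m * h j ^ n - h j ^ n * h i ^ m =
      -(h j ^ m * h i ^ n - h i ^ n * h j ^ m) := by
    intro i j
    by_cases hij : i = j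
    · subst hij
      rw [← pow_add, ← pow_add, add_comm, sub_self, neg_zero]
    · rw [commutator_pow_symm (hc i j hij) (hT i j hij) (hT' i j hij) (m + n) m n rfl, neg_sub]
  have hX : (∑ i, h i ^ m) * (∑ i, h i ^ n) - (∑ i, h i ^ n) * ∑ i, h i ^ m =
      ∑ i, ∑ j, (h i ^ m * h j ^ n - h j ^ n * h i ^ m) := by
    simp only [Finset.sum_sub_distrib]
    rw [Finset.sum_mul_sum, Finset.sum_mul_sum,
      Finset.sum_comm (f := fun i j => h j ^ n * h i ^ m)]
  have hneg : ∑ i, ∑ j, (h i ^ m * h j ^ n - h j ^ n * h i ^ m) =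
      -∑ i, ∑ j, (h i ^ m * h j ^ n - h j ^ n * h i ^ m) := by
    conv_lhs => rw [Finset.sum_comm]
    rw [← Finset.sum_neg_distrib]
    refine Finset.sum_congr rfl fun i _ => ?_
    rw [← Finset.sum_neg_distrib]
    exact Finset.sum_congr rfl fun j _ => hsymm j i
  rw [eq_neg_iff_add_eq_zero, ← two_smul ℂ] at hneg
  exact sub_eq_zero.mp (hX.trans ((smul_eq_zero.mp hneg).resolve_left two_ne_zero))

end PowerSums

variable {N : ℕ} {R : Finset (V N)} {S : Set (V N)}

/-! ### Dunkl operators on ambient germs -/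

section DunklOperators

variable (hR : IsClassical R) (hS : WeylStable R S) (c : V N → ℂ)

/-- The Dunkl operators on ambient germs, as a linear function of the direction. -/
def nab : V N →ₗ[ℂ] Module.End ℂ (Amb S) :=
  dirDerivₗ S - (1 / 2 : ℂ) • ∑ α : R, (dotForm (α : V N)).smulRight (c α • quot hR hS α)

theorem nab_apply (ξ : V N) (F : Amb S) : nab hR hS c ξ F = dirDeriv S ξ F -
    ∑ α : R, (1 / 2 * c α * ((α : V N) ⬝ᵥ ξ)) • quot hR hS α F := by
  simp only [nab, LinearMap.sub_apply, LinearMap.smul_apply, LinearMap.sum_apply,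
    LinearMap.smulRight_apply, dirDerivₗ_apply, Finset.smul_sum]
  congr 1
  refine Finset.sum_congr rfl fun α _ => ?_
  rw [smul_smul, smul_smul]
  congr 1
  change 1 / 2 * ((α : V N) ⬝ᵥ ξ) * c α = _
  ring

variable {c}

theorem act_nab (hc : ∀ w ∈ reflGroup R, ∀ α ∈ R, c (w α) = c α) (w : reflGroup R) (ξ : V N)
    (F : Amb S) : act hS w (nab hR hS c ξ F) =
      nab hR hS c ((w : V N ≃ₗ[ℂ] V N) ξ) (act hS w F) := by
  rw [nab_apply, nab_apply, map_sub, act_dirDeriv, map_sum,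
    ← Equiv.sum_comp (rootAct hR w) (fun α : R =>
      (1 / 2 * c α * ((α : V N) ⬝ᵥ (w : V N ≃ₗ[ℂ] V N) ξ)) • quot hR hS α (act hS w F))]
  congr 1
  refine Finset.sum_congr rfl fun α _ => ?_
  rw [map_smul, act_quot, coe_rootAct, weyl_dot w.2, hc _ w.2 _ α.2]

theorem nab_ell_mul (ξ η : V N) (F : Amb S) : nab hR hS c ξ (ell S η * F) =
    ell S η * nab hR hS c ξ F + (ξ ⬝ᵥ η) • F -
      ∑ α : R, (c α / ((α : V N) ⬝ᵥ α) * ((α : V N) ⬝ᵥ ξ) * ((α : V N) ⬝ᵥ η)) •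
        act hS (sElt α) F := by
  rw [nab_apply, nab_apply, dirDeriv_ell_mul, mul_sub, Finset.mul_sum, dotProduct_comm η ξ]
  simp only [quot_ell_mul, smul_add, Finset.sum_add_distrib, mul_smul_comm, smul_smul]
  have : ∀ α : R, 1 / 2 * c α * ((α : V N) ⬝ᵥ ξ) * (2 * ((α : V N) ⬝ᵥ η) / ((α : V N) ⬝ᵥ α)) =
      c α / ((α : V N) ⬝ᵥ α) * ((α : V N) ⬝ᵥ ξ) * ((α : V N) ⬝ᵥ η) := fun α => by ring
  simp only [this]
  abel

theorem nab_nab (ξ η : V N) (F : Amb S) : nab hR hS c ξ (nab hR hS c η F) =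
    dirDeriv S ξ (dirDeriv S η F) -
      ∑ α : R, (1 / 2 * c α) • (((α : V N) ⬝ᵥ η) • dirDeriv S ξ (quot hR hS α F) +
        ((α : V N) ⬝ᵥ ξ) • quot hR hS α (dirDeriv S η F)) +
      ∑ α : R, ∑ β : R, (1 / 4 * c α * c β * (((α : V N) ⬝ᵥ ξ) * ((β : V N) ⬝ᵥ η))) •
        quot hR hS α (quot hR hS β F) := by
  simp only [nab_apply, map_sub, map_sum, map_smul, smul_sub, Finset.sum_sub_distrib,
    Finset.smul_sum, smul_smul, smul_add, Finset.sum_add_distrib]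
  have : ∀ α β : R, 1 / 2 * c α * ((α : V N) ⬝ᵥ η) * (1 / 2 * c β * ((β : V N) ⬝ᵥ ξ)) =
      1 / 4 * c β * c α * (((β : V N) ⬝ᵥ ξ) * ((α : V N) ⬝ᵥ η)) := fun α β => by ring
  simp only [this]
  rw [Finset.sum_comm (f := fun α β : R => (1 / 4 * c α * c β *
    (((α : V N) ⬝ᵥ ξ) * ((β : V N) ⬝ᵥ η))) • quot hR hS α (quot hR hS β F))]
  abel

/-- The terms with one difference quotient are symmetric in `ξ` and `η` by `dirDeriv_quot_symm`. The
antisymmetrised coefficients of the quadratic terms satisfy the hypothesis of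
`sum_quot_quot_eq_zero`: the correction produced by `s_α β` is proportional to `α` and drops out. -/
theorem nab_comm {t : Fin N → ℝ} (ht : ∀ α ∈ R, height t α ≠ 0)
    (hc : ∀ w ∈ reflGroup R, ∀ α ∈ R, c (w α) = c α) (ξ η : V N) (F : Amb S) :
    nab hR hS c ξ (nab hR hS c η F) = nab hR hS c η (nab hR hS c ξ F) := by
  have hzero := sum_quot_quot_eq_zero hR ht (fun α β => 1 / 4 * c α * c β *
    (((α : V N) ⬝ᵥ ξ) * ((β : V N) ⬝ᵥ η) - ((α : V N) ⬝ᵥ η) * ((β : V N) ⬝ᵥ ξ))) (by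
      intro α β
      have h1 : ∀ ζ : V N, (rootAct hR (sElt α) β : V N) ⬝ᵥ ζ = (β : V N) ⬝ᵥ ζ -
          2 * ((α : V N) ⬝ᵥ β) / ((α : V N) ⬝ᵥ α) * ((α : V N) ⬝ᵥ ζ) := by
        intro ζ
        rw [coe_rootAct, coe_sElt, reflection_apply, sub_dotProduct, smul_dotProduct, smul_eq_mul]
      simp only [h1]
      rw [coe_rootAct, hc _ (sElt α).2 _ β.2]
      ring) hS F
  rw [nab_nab, nab_nab, dirDeriv_comm ξ η]
  have h2 : ∀ α : R, (((α : V N) ⬝ᵥ η) • dirDeriv S ξ (quot hR hS α F) +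
        ((α : V N) ⬝ᵥ ξ) • quot hR hS α (dirDeriv S η F)) =
      (((α : V N) ⬝ᵥ ξ) • dirDeriv S η (quot hR hS α F) +
        ((α : V N) ⬝ᵥ η) • quot hR hS α (dirDeriv S ξ F)) := by
    intro α
    have := dirDeriv_quot_symm hR hS α ξ η F
    rw [smul_sub, smul_sub] at this
    linear_combination (exp := 1) this
  have h3 : ∑ α : R, ∑ β : R, (1 / 4 * c α * c β * (((α : V N) ⬝ᵥ ξ) * ((β : V N) ⬝ᵥ η))) •
        quot hR hS α (quot hR hS β F) =
      ∑ α : R, ∑ β : R, (1 / 4 * c α * c β * (((α : V N) ⬝ᵥ η) * ((β : V N) ⬝ᵥ ξ))) •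
        quot hR hS α (quot hR hS β F) := by
    rw [← sub_eq_zero, ← Finset.sum_sub_distrib, ← hzero]
    refine Finset.sum_congr rfl fun α _ => ?_
    rw [← Finset.sum_sub_distrib]
    refine Finset.sum_congr rfl fun β _ => ?_
    rw [← sub_smul]
    congr 1
    ring
  rw [h3]
  congr 2
  exact Finset.sum_congr rfl fun α _ => by rw [h2 α]

theorem dot_e (a : V N) (i : Fin N) : a ⬝ᵥ e i = a i := by
  simp [e]

theorem sum_dot_e_mul (a b : V N) : ∑ i, (a ⬝ᵥ e i) * (b ⬝ᵥ e i) = a ⬝ᵥ b := by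
  simp only [dot_e]
  rfl

theorem sum_dot_e_smul (a : V N) : ∑ i, (a ⬝ᵥ e i) • (e i : V N) = a := by
  ext j
  simp [e, Finset.sum_apply, Pi.single_apply]

/-- The Dunkl Laplacian. -/
theorem sum_nab_sq {t : Fin N → ℝ} (ht : ∀ α ∈ R, height t α ≠ 0)
    (hc : ∀ w ∈ reflGroup R, ∀ α ∈ R, c (w α) = c α) (F : Amb S) :
    ∑ i, nab hR hS c (e i) (nab hR hS c (e i) F) =
      ∑ i, dirDeriv S (e i) (dirDeriv S (e i) F) - ∑ α : R, (1 / 2 * c α) •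
        (dirDeriv S α (quot hR hS α F) + quot hR hS α (dirDeriv S α F)) := by
  -- The coefficients `c_α c_β (α, β)` qualify because `(α, s_α β) = -(α, β)`.
  have hzero := sum_quot_quot_eq_zero hR ht (fun α β => 1 / 4 * c α * c β * ((α : V N) ⬝ᵥ β)) (by
    intro α β
    have h1 := reflection_dot_reflection (α : V N) α β
    rw [reflection_self (hR.dot_self_ne_zero α.2), neg_dotProduct, neg_eq_iff_eq_neg] at h1
    have h2 : c (reflection (α : V N) β) = c β := hc _ (sElt α).2 _ β.2
    rw [coe_rootAct, coe_sElt, h1, h2, dotProduct_comm]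
    ring) hS F
  simp only [nab_nab, Finset.sum_add_distrib, Finset.sum_sub_distrib]
  have h1 : ∑ i, ∑ α : R, ∑ β : R, (1 / 4 * c α * c β *
      (((α : V N) ⬝ᵥ e i) * ((β : V N) ⬝ᵥ e i))) • quot hR hS α (quot hR hS β F) = 0 := by
    rw [Finset.sum_comm, ← hzero]
    refine Finset.sum_congr rfl fun α _ => ?_
    rw [Finset.sum_comm]
    refine Finset.sum_congr rfl fun β _ => ?_
    rw [← Finset.sum_smul, ← Finset.mul_sum, sum_dot_e_mul]
  have h2 : ∀ (α : R) (G : Amb S), ∑ i, ((α : V N) ⬝ᵥ e i) • dirDeriv S (e i) G =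
      dirDeriv S α G := by
    intro α G
    have := congrArg (fun v => dirDerivₗ S v G) (sum_dot_e_smul (α : V N))
    simpa [map_sum, LinearMap.sum_apply] using this
  rw [h1, add_zero, Finset.sum_comm (s := Finset.univ) (t := (Finset.univ : Finset R))]
  congr 1
  refine Finset.sum_congr rfl fun α _ => ?_
  rw [← Finset.smul_sum, Finset.sum_add_distrib, h2]
  rw [← h2 α F, map_sum]
  simp only [map_smul]

end DunklOperators

end

section

variable {N : ℕ} {R : Finset (V N)} {S : Set (V N)}

/-! ### The harmonic operators and their exchange relations -/

section HarmonicOperators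

/-- A root with two nonzero coordinates is `±e_i ± e_j`, and its reflection exchanges `e_i` and
`e_j` up to sign. This is where the classical types enter the commutation relations. -/
theorem IsClassical.coord_mul_coord (hR : IsClassical R) {α : V N} (hα : α ∈ R) {i j : Fin N}
    (hij : i ≠ j) : α i * α j = 0 ∨
      (α i * α j) ^ 2 = 1 ∧ reflection α (e i) = -(α i * α j) • e j := by
  obtain ⟨a, rfl, ha⟩ := hR.exists_intVec hα
  by_cases h0 : a i = 0 ∨ a j = 0
  · left
    rcases h0 with h | h <;> simp [intVec, h]
  right
  obtain ⟨hi, hj⟩ := not_or.mp h0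
  have hform : (a i = 1 ∨ a i = -1) ∧ (a j = 1 ∨ a j = -1) ∧
      a = Pi.single i (a i) + Pi.single j (a j) := by
    rcases ha with ha | ha
    · exfalso
      obtain ⟨k, rfl | rfl⟩ := exists_eq_single_of_dot ha <;>
      · by_cases hik : i = k
        · exact hj (Pi.single_eq_of_ne (fun h => hij (hik.trans h.symm)) _)
        · exact hi (Pi.single_eq_of_ne hik _)
    · obtain ⟨k, l, hkl, h1, h2, h3⟩ := exists_eq_pair ha
      have hmem : ∀ m, a m ≠ 0 → m = k ∨ m = l := by
        intro m hm
        by_contra h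
        obtain ⟨hk, hl⟩ := not_or.mp h
        apply hm
        rw [h3]
        simp [hk, hl]
      rcases hmem i hi with rfl | rfl <;> rcases hmem j hj with rfl | rfl
      · exact absurd rfl hij
      · exact ⟨h1, h2, h3⟩
      · exact ⟨h2, h1, h3.trans (add_comm _ _)⟩
      · exact absurd rfl hij
  obtain ⟨h1, h2, h3⟩ := hform
  have haa : a ⬝ᵥ a = 2 := by rw [h3]; exact pair_dot hij h1 h2
  have hsq : ∀ k : ℤ, k = 1 ∨ k = -1 → (k : ℂ) * k = 1 := by
    rintro k (rfl | rfl) <;> norm_num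
  have hi2 := hsq _ h1
  have hj2 := hsq _ h2
  change ((a i : ℂ) * a j) ^ 2 = 1 ∧ _ = -((a i : ℂ) * a j) • e j
  refine ⟨by linear_combination (a j : ℂ) ^ 2 * hi2 + hj2, ?_⟩
  rw [reflection_apply, dot_e, intVec_dot, haa]
  have h4 : intVec a = (a i : ℂ) • e i + (a j : ℂ) • e j := by
    conv_lhs => rw [h3, intVec_pair]
  have h5 : intVec a i = (a i : ℂ) := rfl
  rw [h4] at *
  rw [h5]
  push_cast
  rw [mul_div_cancel_left₀ _ two_ne_zero, smul_add, smul_smul, smul_smul, hi2, one_smul, neg_smul]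
  abel

variable (hR : IsClassical R) (hS : WeylStable R S) (c : V N → ℂ)

/-- Multiplication by linear functions, as a linear function of their coefficients. -/
def ellOp (S : Set (V N)) : V N →ₗ[ℂ] Module.End ℂ (Amb S) where
  toFun η := LinearMap.mulLeft ℂ (ell S η)
  map_add' a b := by
    ext F
    simp [ell_add, add_mul]
  map_smul' k a := by
    ext F
    simp [ell_smul]

theorem ellOp_apply (η : V N) (F : Amb S) : ellOp S η F = ell S η * F := rfl

/-- The operators `∇_ξ + ω (ξ, x)`. -/
def shiftedNab (ω : ℂ) : V N →ₗ[ℂ] Module.End ℂ (Amb S) := nab hR hS c + ω • ellOp S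

theorem shiftedNab_apply (ω : ℂ) (ξ : V N) (F : Amb S) :
    shiftedNab hR hS c ω ξ F = nab hR hS c ξ F + ω • (ell S ξ * F) := rfl

/-- The action of the Weyl group as linear operators. -/
def actOp (w : reflGroup R) : Module.End ℂ (Amb S) := (act hS w).toLinearMap

theorem actOp_apply (w : reflGroup R) (F : Amb S) : actOp hS w F = act hS w F := rfl

/-- The commutator of the Dunkl operator `∇_ξ` and the multiplication by `(η, x)`. -/
def commOp (ξ η : V N) : Module.End ℂ (Amb S) :=
  (ξ ⬝ᵥ η) • 1 + ∑ α : R, (-(c α / ((α : V N) ⬝ᵥ α) * (((α : V N) ⬝ᵥ ξ) * ((α : V N) ⬝ᵥ η)))) •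
    actOp hS (sElt α)

theorem commOp_apply (ξ η : V N) (F : Amb S) : commOp hS c ξ η F = (ξ ⬝ᵥ η) • F -
    ∑ α : R, (c α / ((α : V N) ⬝ᵥ α) * (((α : V N) ⬝ᵥ ξ) * ((α : V N) ⬝ᵥ η))) •
      act hS (sElt α) F := by
  simp [commOp, LinearMap.sum_apply, actOp_apply, sub_eq_add_neg]

theorem nab_mul_ellOp (ξ η : V N) :
    nab hR hS c ξ * ellOp S η = ellOp S η * nab hR hS c ξ + commOp hS c ξ η := by
  refine LinearMap.ext fun F => ?_
  rw [LinearMap.add_apply, Module.End.mul_apply, Module.End.mul_apply, ellOp_apply, ellOp_apply,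
    nab_ell_mul, commOp_apply, add_sub_assoc]
  simp only [mul_assoc]

theorem commOp_comm (ξ η : V N) : commOp hS c ξ η = commOp hS c η ξ := by
  simp only [commOp, dotProduct_comm ξ η, mul_comm (_ ⬝ᵥ ξ)]

theorem ellOp_comm (ξ η : V N) : ellOp S ξ * ellOp S η = ellOp S η * ellOp S ξ :=
  LinearMap.ext fun F => mul_left_comm (ell S ξ) (ell S η) F

variable {c} (hc : ∀ w ∈ reflGroup R, ∀ α ∈ R, c (w α) = c α)
include hc

/-- Dunkl operators commute among themselves, and so do the multiplications; only the mixed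
commutators remain, and they are symmetric in `ξ` and `η`. -/
theorem shiftedNab_mul {t : Fin N → ℝ} (ht : ∀ α ∈ R, height t α ≠ 0) (ω ω' : ℂ) (ξ η : V N) :
    shiftedNab hR hS c ω ξ * shiftedNab hR hS c ω' η =
      shiftedNab hR hS c ω' η * shiftedNab hR hS c ω ξ + (ω' - ω) • commOp hS c ξ η := by
  have h1 : nab hR hS c ξ * nab hR hS c η = nab hR hS c η * nab hR hS c ξ :=
    LinearMap.ext fun F => nab_comm hR hS ht hc ξ η F
  have h2 := nab_mul_ellOp hR hS c ξ η
  have h3 := nab_mul_ellOp hR hS c η ξ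
  rw [commOp_comm hS c η ξ] at h3
  simp only [shiftedNab, LinearMap.add_apply, LinearMap.smul_apply, add_mul, mul_add,
    smul_mul_assoc, mul_smul_comm, h1, h2, h3, ellOp_comm ξ η, smul_add, smul_smul]
  module

theorem actOp_mul_shiftedNab (ω : ℂ) (w : reflGroup R) (ξ : V N) :
    actOp hS w * shiftedNab hR hS c ω ξ =
      shiftedNab hR hS c ω ((w : V N ≃ₗ[ℂ] V N) ξ) * actOp hS w := by
  refine LinearMap.ext fun F => ?_
  rw [Module.End.mul_apply, Module.End.mul_apply, actOp_apply, actOp_apply, shiftedNab_apply,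
    shiftedNab_apply, map_add, map_smul, map_mul, act_ell, act_nab hR hS hc]

omit hc in
/-- The operators `(∇_ξ + ω (ξ, x)) (∇_ξ - ω (ξ, x))`. -/
def hOp (hR : IsClassical R) (hS : WeylStable R S) (c : V N → ℂ) (ω : ℂ) (ξ : V N) :
    Module.End ℂ (Amb S) :=
  shiftedNab hR hS c ω ξ * shiftedNab hR hS c (-ω) ξ

omit hc in
theorem hOp_smul (ω k : ℂ) (ξ : V N) : hOp hR hS c ω (k • ξ) = k ^ 2 • hOp hR hS c ω ξ := by
  rw [hOp, hOp, map_smul, map_smul, smul_mul_smul_comm, sq]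

theorem actOp_mul_hOp (ω : ℂ) (w : reflGroup R) (ξ : V N) :
    actOp hS w * hOp hR hS c ω ξ = hOp hR hS c ω ((w : V N ≃ₗ[ℂ] V N) ξ) * actOp hS w := by
  rw [hOp, hOp, ← mul_assoc, actOp_mul_shiftedNab hR hS hc, mul_assoc,
    actOp_mul_shiftedNab hR hS hc, mul_assoc]

omit hc in
/-- The operators which intertwine `h_i` and `h_j`. -/
def swapOp (hS : WeylStable R S) (c : V N → ℂ) (ω : ℂ) (i j : Fin N) : Module.End ℂ (Amb S) :=
  (2 * ω) • ∑ α : R, (c α / ((α : V N) ⬝ᵥ α) * ((α : V N) i * (α : V N) j) ^ 2) •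
    actOp hS (sElt α)

omit hc in
theorem swapOp_comm (ω : ℂ) (i j : Fin N) : swapOp hS c ω i j = swapOp hS c ω j i := by
  simp only [swapOp, mul_comm ((_ : V N) i)]

/-- Only reflections exchanging `e_i` and `e_j` up to sign contribute, and the sign is lost because
`hOp` is quadratic in the direction. -/
theorem swapOp_mul_hOp (ω : ℂ) {i j : Fin N} (hij : i ≠ j) :
    swapOp hS c ω i j * hOp hR hS c ω (e i) = hOp hR hS c ω (e j) * swapOp hS c ω i j := by
  rw [swapOp, smul_mul_assoc, mul_smul_comm, Finset.sum_mul, Finset.mul_sum]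
  congr 1
  refine Finset.sum_congr rfl fun α _ => ?_
  rw [smul_mul_assoc, mul_smul_comm, actOp_mul_hOp hR hS hc, coe_sElt]
  rcases hR.coord_mul_coord α.2 hij with h | ⟨h1, h2⟩
  · simp [h]
  · rw [h2, hOp_smul, neg_sq, h1, one_smul]

/-- Moving `s_α` to the left past `∇_i⁺` turns the latter into `-α_i α_j ∇_j⁺`. Together with the
coefficient `-α_i α_j` of `s_α` in the commutator this gives the square in `swapOp`. -/
theorem shiftedNab_mul_commOp_mul (ω : ℂ) {i j : Fin N} (hij : i ≠ j) :
    (2 * ω) • (shiftedNab hR hS c ω (e i) * commOp hS c (e i) (e j) *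
      shiftedNab hR hS c (-ω) (e j)) = swapOp hS c ω i j * hOp hR hS c ω (e j) := by
  have h0 : (e i : V N) ⬝ᵥ e j = 0 := by
    rw [dot_e]
    simp [e, hij.symm]
  rw [commOp, h0, zero_smul, zero_add, swapOp, smul_mul_assoc, Finset.mul_sum,
    Finset.sum_mul, Finset.sum_mul]
  congr 1
  refine Finset.sum_congr rfl fun α _ => ?_
  simp only [dot_e]
  rcases hR.coord_mul_coord α.2 hij with h | ⟨h1, h2⟩
  · simp [h]
  · have h3 : actOp hS (sElt α) * shiftedNab hR hS c ω (-((α : V N) i * (α : V N) j) • e j) =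
        shiftedNab hR hS c ω (e i) * actOp hS (sElt α) := by
      rw [actOp_mul_shiftedNab hR hS hc, coe_sElt, ← h2, reflection_reflection]
    rw [mul_smul_comm, ← h3, map_smul, mul_smul_comm, smul_mul_assoc, smul_mul_assoc, smul_smul,
      hOp, smul_mul_assoc, mul_assoc]
    congr 1
    ring

theorem hOp_commutator {t : Fin N → ℝ} (ht : ∀ α ∈ R, height t α ≠ 0) (ω : ℂ) {i j : Fin N}
    (hij : i ≠ j) : hOp hR hS c ω (e i) * hOp hR hS c ω (e j) -
      hOp hR hS c ω (e j) * hOp hR hS c ω (e i) =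
      swapOp hS c ω i j * (hOp hR hS c ω (e j) - hOp hR hS c ω (e i)) := by
  have key := fun a b (ξ η : V N) => shiftedNab_mul hR hS hc ht a b ξ η
  have hpp := key ω ω (e i) (e j)
  have hmm := key (-ω) (-ω) (e i) (e j)
  have hmp := key (-ω) ω (e i) (e j)
  have hmp' := key (-ω) ω (e j) (e i)
  have s1 := shiftedNab_mul_commOp_mul hR hS hc ω hij
  have s2 := shiftedNab_mul_commOp_mul hR hS hc ω hij.symm
  have e2 : ω - -ω = 2 * ω := by ring
  rw [sub_self, zero_smul, add_zero] at hpp hmm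
  rw [e2] at hmp hmp'
  rw [mul_sub, ← s1, swapOp_comm, ← s2]
  unfold hOp
  generalize shiftedNab hR hS c ω (e i) = pi at *
  generalize shiftedNab hR hS c ω (e j) = pj at *
  generalize shiftedNab hR hS c (-ω) (e i) = mi at *
  generalize shiftedNab hR hS c (-ω) (e j) = mj at *
  generalize commOp hS c (e i) (e j) = sij at *
  generalize commOp hS c (e j) (e i) = sji at *
  -- Operators with the same shift commute, so only moving a minus operator past a plus operator
  -- leaves a correction.
  have h1 : pi * mi * (pj * mj) = pi * pj * (mi * mj) + (2 * ω) • (pi * sij * mj) := by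
    rw [mul_assoc, ← mul_assoc mi, hmp, add_mul, mul_add, smul_mul_assoc, mul_smul_comm]
    simp only [mul_assoc]
  have h2 : pj * mj * (pi * mi) = pj * pi * (mj * mi) + (2 * ω) • (pj * sji * mi) := by
    rw [mul_assoc, ← mul_assoc mj, hmp', add_mul, mul_add, smul_mul_assoc, mul_smul_comm]
    simp only [mul_assoc]
  rw [h1, h2, hpp, hmm]
  abel

/-- The power sums of the operators `h_i` commute. -/
theorem commute_sum_hOp_pow {t : Fin N → ℝ} (ht : ∀ α ∈ R, height t α ≠ 0) (ω : ℂ) (m n : ℕ) :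
    Commute (∑ i, hOp hR hS c ω (e i) ^ m) (∑ i, hOp hR hS c ω (e i) ^ n) :=
  commute_power_sums (T := swapOp hS c ω)
    (fun _ _ hij => hOp_commutator hR hS hc ht ω hij)
    (fun _ _ hij => swapOp_mul_hOp hR hS hc ω hij)
    (fun i j hij => by
      rw [swapOp_comm]
      exact swapOp_mul_hOp hR hS hc ω hij.symm) m n

/-- The Weyl group permutes the `e_i` up to sign and `hOp` ignores the sign, so conjugation merely
permutes the summands. -/
theorem actOp_mul_sum_hOp_pow (ω : ℂ) (m : ℕ) (w : reflGroup R) :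
    actOp hS w * ∑ i, hOp hR hS c ω (e i) ^ m = (∑ i, hOp hR hS c ω (e i) ^ m) * actOp hS w := by
  have hpow : ∀ ξ, actOp hS w * hOp hR hS c ω ξ ^ m =
      hOp hR hS c ω ((w : V N ≃ₗ[ℂ] V N) ξ) ^ m * actOp hS w := by
    intro ξ
    induction m with
    | zero => simp
    | succ m ih =>
      rw [pow_succ, ← mul_assoc, ih, mul_assoc, actOp_mul_hOp hR hS hc, ← mul_assoc, ← pow_succ]
  choose σ hσ using hR.weyl_e w.2
  have hσ' : ∀ i, hOp hR hS c ω ((w : V N ≃ₗ[ℂ] V N) (e i)) = hOp hR hS c ω (e (σ i)) := by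
    intro i
    rcases hσ i with h | h
    · rw [h]
    · rw [h, ← neg_one_smul ℂ, hOp_smul, neg_one_sq, one_smul]
  have hinj : Function.Injective σ := by
    intro i j hij
    by_contra hne
    have h1 : (w : V N ≃ₗ[ℂ] V N) (e i) ⬝ᵥ (w : V N ≃ₗ[ℂ] V N) (e j) = 0 := by
      rw [weyl_dot w.2, dot_e]
      simp [e, Ne.symm hne]
    rcases hσ i with h2 | h2 <;> rcases hσ j with h3 | h3 <;> rw [h2, h3, hij] at h1 <;>
      simp [e] at h1
  rw [Finset.mul_sum, Finset.sum_mul]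
  simp only [hpow, hσ']
  exact Function.Bijective.sum_comp (Finite.injective_iff_bijective.mp hinj)
    (fun i => hOp hR hS c ω (e i) ^ m * actOp hS w)

omit hc in
-- Each summand differs from `h_i` by `ω [∇_i, x_i]`. In the sum over `i` the factors `α_i²` add up
-- to `(α, α)` and cancel the denominators.
theorem sum_sq_sub_sq (ω : ℂ) :
    ∑ i, (nab hR hS c (e i) ^ 2 - ω ^ 2 • ellOp S (e i) ^ 2) =
      ∑ i, hOp hR hS c ω (e i) ^ 1 +
        ω • ((N : ℂ) • 1 - ∑ α : R, c α • actOp hS (sElt α)) := by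
  have h1 : ∀ i, nab hR hS c (e i) ^ 2 - ω ^ 2 • ellOp S (e i) ^ 2 =
      hOp hR hS c ω (e i) ^ 1 + ω • commOp hS c (e i) (e i) := by
    intro i
    have h2 := nab_mul_ellOp hR hS c (e i) (e i)
    simp only [hOp, shiftedNab, LinearMap.add_apply, LinearMap.smul_apply, add_mul, mul_add,
      smul_mul_assoc, mul_smul_comm, h2, smul_add, smul_smul, pow_one, sq]
    module
  simp only [h1, Finset.sum_add_distrib]
  congr 1
  rw [← Finset.smul_sum]
  congr 1
  simp only [commOp, Finset.sum_add_distrib]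
  rw [sub_eq_add_neg]
  congr 1
  · simp [e, ← Nat.cast_smul_eq_nsmul ℂ]
  · rw [Finset.sum_comm, ← Finset.sum_neg_distrib]
    refine Finset.sum_congr rfl fun α _ => ?_
    rw [← Finset.sum_smul, Finset.sum_neg_distrib, ← Finset.mul_sum, sum_dot_e_mul, neg_smul,
      div_mul_cancel₀ _ (hR.dot_self_ne_zero α.2)]

theorem commute_sum_sq_sub_sq {t : Fin N → ℝ} (ht : ∀ α ∈ R, height t α ≠ 0) (ω : ℂ) (m : ℕ) :
    Commute (∑ i, (nab hR hS c (e i) ^ 2 - ω ^ 2 • ellOp S (e i) ^ 2))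
      (∑ i, hOp hR hS c ω (e i) ^ m) := by
  rw [sum_sq_sub_sq hR hS]
  refine Commute.add_left (commute_sum_hOp_pow hR hS hc ht ω 1 m) (Commute.smul_left ?_ ω)
  refine Commute.sub_left (Commute.smul_left (Commute.one_left _) _) ?_
  exact Commute.sum_left _ _ _ fun α _ =>
    Commute.smul_left (actOp_mul_sum_hOp_pow hR hS hc ω m (sElt α)) _

end HarmonicOperators

end

section

variable {N : ℕ} {R Γ₀ : Finset (V N)}

theorem weylStable_orbit (R : Finset (V N)) (x₀ : V N) : WeylStable R (orbit R x₀) := by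
  rintro w hw x ⟨u, hu, rfl⟩
  exact ⟨w * u, mul_mem hw hu, rfl⟩

/-! ### Passing between all roots and positive roots -/

section PositiveSums

variable (hR : IsClassical R)

theorem negRoot_negRoot (α : R) : negRoot hR (negRoot hR α) = α :=
  Subtype.ext (by rw [coe_negRoot, coe_negRoot, neg_neg])

/-- Exactly one of `α` and `-α` is positive. Sums over all roots are preferred throughout because
the Weyl group can reindex them. -/
theorem sum_posRoots {t : Fin N → ℝ} (ht : ∀ α ∈ R, height t α ≠ 0) {M : Type*} [AddCommGroup M]
    [Module ℂ M] (ψ : R → M) (hψ : ∀ α, ψ (negRoot hR α) = ψ α) :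
    ∑ α : posRoots R t, ψ ⟨α, mem_of_mem_posRoots α.2⟩ = (1 / 2 : ℂ) • ∑ α : R, ψ α := by
  classical
  let f : V N → M := fun v => if h : v ∈ R then ψ ⟨v, h⟩ else 0
  have hf : ∀ α : R, f α = ψ α := fun α => by simp [f]
  let χ : R → M := fun α => if 0 < height t (α : V N) then ψ α else 0
  have h1 : ∑ α : posRoots R t, ψ ⟨α, mem_of_mem_posRoots α.2⟩ = ∑ α : R, χ α := by
    calc _ = ∑ α : posRoots R t, f α := Finset.sum_congr rfl fun α _ => (hf ⟨α, _⟩).symm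
      _ = ∑ α ∈ R, if 0 < height t α then f α else 0 := by
        rw [Finset.sum_coe_sort (posRoots R t) f, posRoots, Finset.sum_filter]
      _ = _ := by
        rw [← Finset.sum_coe_sort R]
        exact Finset.sum_congr rfl fun α _ => by rw [hf]
  have hinv : Function.Involutive (negRoot hR) := negRoot_negRoot hR
  have h2 : ∑ α : R, ψ α = ∑ α : R, (χ α + χ (negRoot hR α)) := by
    refine Finset.sum_congr rfl fun α _ => ?_
    simp only [χ]
    rw [hψ, coe_negRoot, height_neg]
    rcases lt_or_gt_of_ne (ht α α.2) with h | h
    · rw [if_neg (by linarith), if_pos (by linarith), zero_add]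
    · rw [if_pos h, if_neg (by linarith), add_zero]
  have h3 : ∑ α : R, χ (negRoot hR α) = ∑ α : R, χ α := Equiv.sum_comp hinv.toPerm χ
  rw [h1, h2, Finset.sum_add_distrib, h3]
  module

theorem apply_negRoot {c : V N → ℂ} (hc : ∀ w ∈ reflGroup R, ∀ α ∈ R, c (w α) = c α) (α : R) :
    c (negRoot hR α) = c α := hc _ (sElt α).2 _ α.2

variable {S : Set (V N)} (hS : WeylStable R S)
include hR hS

theorem analyticOnNhd_dunkl (t : Fin N → ℝ) (c : V N → ℂ) (ξ : V N) {f : V N → ℂ}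
    (hf : AnalyticOnNhd ℂ f S) : AnalyticOnNhd ℂ (dunkl (posRoots R t) c ξ f) S := by
  intro x hx
  have h1 : AnalyticAt ℂ (fun x => fderiv ℂ f x ξ - ∑ α ∈ posRoots R t,
      c α * (α ⬝ᵥ ξ) * divRefl α f x) x :=
    (analyticOnNhd_dirDeriv hf ξ x hx).sub (Finset.analyticAt_fun_sum _ fun α hα =>
      analyticAt_const.mul (analyticOnNhd_divRefl hR hS (mem_of_mem_posRoots hα) hf x hx))
  exact h1

theorem nab_germ {t : Fin N → ℝ} (ht : ∀ α ∈ R, height t α ≠ 0) {c : V N → ℂ}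
    (hc : ∀ w ∈ reflGroup R, ∀ α ∈ R, c (w α) = c α) (ξ : V N) {f : V N → ℂ}
    (hf : AnalyticOnNhd ℂ f S) : nab hR hS c ξ (germ Set.univ f hf) =
      germ Set.univ (dunkl (posRoots R t) c ξ f) (analyticOnNhd_dunkl hR hS t c ξ hf) := by
  have h1 := sum_posRoots hR ht
    (fun α : R => (c α * ((α : V N) ⬝ᵥ ξ)) • quot hR hS α (germ Set.univ f hf)) (by
      intro α
      simp only [apply_negRoot hR hc α, quot_negRoot]
      rw [coe_negRoot, neg_dotProduct, mul_neg, neg_smul_neg])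
  have h2 : ∑ α : R, (1 / 2 * c α * ((α : V N) ⬝ᵥ ξ)) • quot hR hS α (germ Set.univ f hf) =
      (1 / 2 : ℂ) • ∑ α : R, (c α * ((α : V N) ⬝ᵥ ξ)) • quot hR hS α (germ Set.univ f hf) := by
    rw [Finset.smul_sum]
    exact Finset.sum_congr rfl fun α _ => by rw [smul_smul, mul_assoc]
  rw [nab_apply, h2, ← h1]
  simp only [quot_germ, dirDeriv_germ]
  change mkGerm S Set.univ _ - ∑ α : posRoots R t, _ • mkGerm S Set.univ _ = mkGerm S Set.univ _
  simp only [← map_smul, ← map_sum, ← map_sub]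
  congr 1
  apply Subtype.ext
  funext x
  change _ = fderiv ℂ f x ξ - ∑ α ∈ posRoots R t, c α * (α ⬝ᵥ ξ) * divRefl α f x
  rw [← Finset.sum_coe_sort (posRoots R t) fun α => c α * (α ⬝ᵥ ξ) * divRefl α f x]
  simp [Finset.sum_apply]

end PositiveSums

/-! ### Restriction to the stratum and to the flat -/

section Restriction

variable (R Γ₀) (x₀ : flat Γ₀)

/-- Restriction of ambient germs near the orbit of `x₀` to the stratum. -/
def toOrbit : Amb (orbit R (x₀ : V N)) →ₐ[ℂ] OrbitGerms R Γ₀ x₀ :=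
  pullback LinearMap.id (Set.mapsTo_id _) (Set.mapsTo_univ _ _)

/-- Restriction of ambient germs near the orbit of `x₀` to the flat of `x₀`. -/
def toFlat : Amb (orbit R (x₀ : V N)) →ₐ[ℂ] FlatGerms Γ₀ x₀ :=
  pullback (flat Γ₀).subtype (mapsTo_subtype_orbit R Γ₀ x₀) (Set.mapsTo_univ _ _)

theorem toOrbit_germ {f : V N → ℂ} (hf : AnalyticOnNhd ℂ f (orbit R (x₀ : V N))) :
    toOrbit R Γ₀ x₀ (germ Set.univ f hf) = germ (stratum R Γ₀) f hf := rfl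

theorem toOrbit_surjective : Function.Surjective (toOrbit R Γ₀ x₀) := by
  intro F
  obtain ⟨f, hf, rfl⟩ := exists_germ F
  exact ⟨germ Set.univ f hf, rfl⟩

theorem restrictScalar_toOrbit (F : Amb (orbit R (x₀ : V N))) :
    restrictScalar R Γ₀ x₀ (toOrbit R Γ₀ x₀ F) = toFlat R Γ₀ x₀ F := by
  obtain ⟨f, hf, rfl⟩ := exists_germ F
  rfl

theorem weylAct_toOrbit (w : reflGroup R) (F : Amb (orbit R (x₀ : V N))) :
    weylAct R Γ₀ x₀ w (toOrbit R Γ₀ x₀ F) =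
      toOrbit R Γ₀ x₀ (act (weylStable_orbit R (x₀ : V N)) w F) := by
  obtain ⟨f, hf, rfl⟩ := exists_germ F
  rfl

theorem toFlat_ell (η : V N) : toFlat R Γ₀ x₀ (ell _ η) = dotGerm x₀ η := rfl

theorem toFlat_dirDeriv (v : flat Γ₀) (F : Amb (orbit R (x₀ : V N))) :
    toFlat R Γ₀ x₀ (dirDeriv _ (v : V N) F) = dirDeriv {x₀} v (toFlat R Γ₀ x₀ F) :=
  (dirDeriv_pullback (flat Γ₀).subtype _ v F).symm

theorem toFlat_act {w : reflGroup R} (hw : (w : V N ≃ₗ[ℂ] V N) ∈ reflGroup Γ₀)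
    (F : Amb (orbit R (x₀ : V N))) :
    toFlat R Γ₀ x₀ (act (weylStable_orbit R (x₀ : V N)) w F) = toFlat R Γ₀ x₀ F := by
  rw [← restrictScalar_toOrbit, ← weylAct_toOrbit, restrictScalar_weylAct hw,
    restrictScalar_toOrbit]

variable {R Γ₀ x₀}

/-- The roots `g⁻¹ β` with `β ∈ Γ₀` vanish at `x₀`, hence on all of `π` by genericity. So `g` maps
`π` into itself, and dimensions agree. -/
theorem IsGeneric.map_flat_eq (hR : IsClassical R) (hΓ : Γ₀ ⊆ R) (hx₀ : IsGeneric R Γ₀ x₀)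
    {g : V N ≃ₗ[ℂ] V N} (hg : g ∈ reflGroup R) (h : g (x₀ : V N) ∈ flat Γ₀) :
    (flat Γ₀).map (g : V N →ₗ[ℂ] V N) = flat Γ₀ := by
  refine Submodule.eq_of_le_of_finrank_eq ?_ (LinearEquiv.finrank_map_eq g _)
  rintro _ ⟨y, hy, rfl⟩ β hβ
  change β ⬝ᵥ g y = 0
  rw [weyl_dot_right hg]
  refine hx₀ _ ((hR.weyl_mem_iff (inv_mem hg) β).mpr (hΓ hβ)) ?_ y hy
  rw [← weyl_dot_right hg]
  exact h β hβ

theorem toOrbit_eq_zero_iff (hR : IsClassical R) (hΓ : Γ₀ ⊆ R) (hx₀ : IsGeneric R Γ₀ x₀)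
    (F : Amb (orbit R (x₀ : V N))) : toOrbit R Γ₀ x₀ F = 0 ↔
      ∀ w, toFlat R Γ₀ x₀ (act (weylStable_orbit R (x₀ : V N)) w F) = 0 := by
  constructor
  · intro h w
    rw [← restrictScalar_toOrbit, ← weylAct_toOrbit, h, map_zero, map_zero]
  intro h
  obtain ⟨f, hf, rfl⟩ := exists_germ F
  refine germ_eq_iff (g := fun _ => 0) (hg := analyticOnNhd_const).mpr ?_
  rw [eventually_nhdsSet_iff_forall]
  rintro _ ⟨u, hu, rfl⟩
  have hfin := hR.finite_weyl
  -- The stratum is a finite union of translates of `π`. A translate through `u x₀` equals `u(π)`,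
  -- where the hypothesis for `u⁻¹` applies; any other one is closed and avoids a neighbourhood of
  -- `u x₀`.
  have key : ∀ w : reflGroup R, ∀ᶠ x in 𝓝 (u (x₀ : V N)),
      x ∈ (flat Γ₀).map ((w : V N ≃ₗ[ℂ] V N) : V N →ₗ[ℂ] V N) → f x = 0 := by
    intro w
    by_cases hw : u (x₀ : V N) ∈ (flat Γ₀).map ((w : V N ≃ₗ[ℂ] V N) : V N →ₗ[ℂ] V N)
    · obtain ⟨y, hy, hyu⟩ := hw
      have hg : ((w : V N ≃ₗ[ℂ] V N)⁻¹ * u) (x₀ : V N) ∈ flat Γ₀ := by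
        have : ((w : V N ≃ₗ[ℂ] V N)⁻¹ * u) (x₀ : V N) = y := by
          rw [LinearEquiv.mul_apply, ← hyu]
          exact weyl_inv_apply_apply _ _
        rwa [this]
      have hmap := hx₀.map_flat_eq hR hΓ (mul_mem (inv_mem w.2) hu) hg
      have h1 := h ⟨u⁻¹, inv_mem hu⟩
      have h2 : ∀ᶠ z : flat Γ₀ in 𝓝 x₀, f (u z) = 0 := by
        have := germ_eq_iff (g := fun _ => 0) (hg := analyticOnNhd_const).mp h1
        rw [nhdsSet_singleton] at this
        exact this.mono fun z hz => hz trivial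
      have h3 : ∀ᶠ z in 𝓝[(flat Γ₀ : Set (V N))] (x₀ : V N), f (u z) = 0 :=
        (eventually_nhds_subtype_iff (flat Γ₀ : Set (V N)) x₀ fun z => f (u z) = 0).mp h2
      rw [eventually_nhdsWithin_iff] at h3
      have h4 : Filter.Tendsto (u⁻¹ : V N ≃ₗ[ℂ] V N) (𝓝 (u (x₀ : V N))) (𝓝 (x₀ : V N)) := by
        have := (LinearMap.toContinuousLinearMap
          ((u⁻¹ : V N ≃ₗ[ℂ] V N) : V N →ₗ[ℂ] V N)).continuous.tendsto (u (x₀ : V N))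
        change Filter.Tendsto (u⁻¹ : V N ≃ₗ[ℂ] V N) _ (𝓝 (u⁻¹ (u (x₀ : V N)))) at this
        rwa [weyl_inv_apply_apply] at this
      filter_upwards [h4.eventually h3] with x hx hxw
      obtain ⟨y, hy, rfl⟩ := hxw
      have hy' : y ∈ (flat Γ₀).map
          (((w : V N ≃ₗ[ℂ] V N)⁻¹ * u : V N ≃ₗ[ℂ] V N) : V N →ₗ[ℂ] V N) := by
        rw [hmap]
        exact hy
      obtain ⟨z, hz, rfl⟩ := hy'
      have hz' : (w : V N ≃ₗ[ℂ] V N) (((w : V N ≃ₗ[ℂ] V N)⁻¹ * u) z) = u z :=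
        weyl_apply_inv_apply _ _
      change (u⁻¹ : V N ≃ₗ[ℂ] V N) ((w : V N ≃ₗ[ℂ] V N) (((w : V N ≃ₗ[ℂ] V N)⁻¹ * u) z)) ∈ _ →
        f (u (u⁻¹ ((w : V N ≃ₗ[ℂ] V N) (((w : V N ≃ₗ[ℂ] V N)⁻¹ * u) z)))) = 0 at hx
      change f ((w : V N ≃ₗ[ℂ] V N) (((w : V N ≃ₗ[ℂ] V N)⁻¹ * u) z)) = 0
      rw [hz', weyl_inv_apply_apply] at hx
      rw [hz']
      exact hx hz
    · have hcl : IsClosed ((flat Γ₀).map ((w : V N ≃ₗ[ℂ] V N) : V N →ₗ[ℂ] V N) : Set (V N)) :=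
        Submodule.closed_of_finiteDimensional _
      filter_upwards [hcl.isOpen_compl.mem_nhds hw] with x hx hxw
      exact absurd hxw hx
  filter_upwards [Filter.eventually_all.mpr key] with x hx hxD
  obtain ⟨w, hw, y, hy, rfl⟩ := hxD
  exact hx ⟨w, hw⟩ ⟨y, hy, rfl⟩

end Restriction

end

section

variable {N : ℕ} {R Γ₀ : Finset (V N)} {x₀ : flat Γ₀}

/-- The vector `α` is orthogonal to the flat of `Γ₀`. -/
def IsOrth (Γ₀ : Finset (V N)) (α : V N) : Prop := ∀ y ∈ flat Γ₀, α ⬝ᵥ y = 0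

theorem isOrth_of_mem {β : V N} (hβ : β ∈ Γ₀) : IsOrth Γ₀ β := fun _ hy => hy β hβ

theorem dotGerm_eq_zero {α : V N} (h : IsOrth Γ₀ α) : dotGerm x₀ α = 0 :=
  germ_congr (g := fun _ => 0) (hg := analyticOnNhd_const)
    (Filter.Eventually.of_forall fun y => h y y.2)

theorem isUnit_dotGerm (hx₀ : IsGeneric R Γ₀ x₀) {α : V N} (hα : α ∈ R) (h : ¬IsOrth Γ₀ α) :
    IsUnit (dotGerm x₀ α) := by
  refine isUnit_linGerm _ ?_
  rintro x rfl h0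
  exact h (hx₀ α hα h0)

/-! ### Restriction of difference quotients and Dunkl operators to the flat -/

section Restrict

theorem toFlat_act_sElt {α : R} (h : IsOrth Γ₀ α) (F : Amb (orbit R (x₀ : V N))) :
    toFlat R Γ₀ x₀ (act (weylStable_orbit R (x₀ : V N)) (sElt α) F) = toFlat R Γ₀ x₀ F := by
  obtain ⟨f, hf, rfl⟩ := exists_germ F
  refine germ_congr (Filter.Eventually.of_forall fun y => ?_)
  change f ((reflection (α : V N))⁻¹ (y : V N)) = f y
  rw [reflection_inv, reflection_of_dot_eq_zero (h y y.2)]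

variable (hR : IsClassical R)

theorem toFlat_quot_of_isOrth {α : R} (h : IsOrth Γ₀ α) (F : Amb (orbit R (x₀ : V N))) :
    toFlat R Γ₀ x₀ (quot hR (weylStable_orbit R (x₀ : V N)) α F) =
      (2 / ((α : V N) ⬝ᵥ α)) • toFlat R Γ₀ x₀ (dirDeriv _ (α : V N) F) := by
  have h0 := hR.dot_self_ne_zero α.2
  have h1 := congrArg (toFlat R Γ₀ x₀)
    (ell_mul_dirDeriv_quot hR (weylStable_orbit R (x₀ : V N)) α α F)
  rw [map_mul, toFlat_ell, dotGerm_eq_zero h, zero_mul, map_sub, map_add, map_sub, map_smul,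
    map_smul, toFlat_act_sElt h, sub_self, zero_add, eq_comm, sub_eq_zero] at h1
  rw [← inv_smul_smul₀ h0 (toFlat R Γ₀ x₀ (quot hR _ α F)), ← h1, smul_smul]
  congr 1
  field_simp

/-- The quotient `q_α F` is invariant under `s_α`, so its normal derivative vanishes on the mirror,
which contains `π`. The computation obtains this by differentiating `ell_mul_dirDeriv_quot` once
more along `α`. -/
theorem toFlat_dirDeriv_quot_of_isOrth {α : R} (h : IsOrth Γ₀ α)
    (F : Amb (orbit R (x₀ : V N))) :
    toFlat R Γ₀ x₀ (dirDeriv _ (α : V N) (quot hR (weylStable_orbit R (x₀ : V N)) α F)) = 0 := by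
  have h0 := hR.dot_self_ne_zero α.2
  have h1 := congrArg (fun G => toFlat R Γ₀ x₀ (dirDeriv _ (α : V N) G))
    (ell_mul_dirDeriv_quot hR (weylStable_orbit R (x₀ : V N)) α α F)
  simp only [dirDeriv_ell_mul, map_sub, map_add, map_smul, map_mul, dirDeriv_act_sElt,
    toFlat_ell, dotGerm_eq_zero h, zero_mul, toFlat_act_sElt h, mul_div_cancel_right₀ _ h0] at h1
  have h2 : (2 * ((α : V N) ⬝ᵥ α)) • toFlat R Γ₀ x₀
      (dirDeriv _ (α : V N) (quot hR (weylStable_orbit R (x₀ : V N)) α F)) = 0 := by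
    rw [two_mul, add_smul]
    nth_rw 1 [← add_zero (((α : V N) ⬝ᵥ α) • _), h1]
    module
  exact (smul_eq_zero.mp h2).resolve_left (mul_ne_zero two_ne_zero h0)

theorem toFlat_quot (hx₀ : IsGeneric R Γ₀ x₀) {α : R} (h : ¬IsOrth Γ₀ α)
    (F : Amb (orbit R (x₀ : V N))) :
    toFlat R Γ₀ x₀ (quot hR (weylStable_orbit R (x₀ : V N)) α F) =
      Ring.inverse (dotGerm x₀ α) * (toFlat R Γ₀ x₀ F -
        toFlat R Γ₀ x₀ (act (weylStable_orbit R (x₀ : V N)) (sElt α) F)) := by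
  rw [← map_sub, ← ell_mul_quot hR, map_mul, toFlat_ell,
    Ring.inverse_mul_cancel_left _ _ (isUnit_dotGerm hx₀ α.2 h)]

theorem toFlat_dirDeriv_quot (hx₀ : IsGeneric R Γ₀ x₀) {α : R} (h : ¬IsOrth Γ₀ α)
    (F : Amb (orbit R (x₀ : V N))) :
    toFlat R Γ₀ x₀ (dirDeriv _ (α : V N) (quot hR (weylStable_orbit R (x₀ : V N)) α F)) +
      toFlat R Γ₀ x₀ (quot hR (weylStable_orbit R (x₀ : V N)) α (dirDeriv _ (α : V N) F)) =
    (2 : ℂ) • (Ring.inverse (dotGerm x₀ α) * toFlat R Γ₀ x₀ (dirDeriv _ (α : V N) F)) -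
      ((α : V N) ⬝ᵥ α) • (Ring.inverse (dotGerm x₀ α) ^ 2 * (toFlat R Γ₀ x₀ F -
        toFlat R Γ₀ x₀ (act (weylStable_orbit R (x₀ : V N)) (sElt α) F))) := by
  have hu := isUnit_dotGerm hx₀ α.2 h
  have h1 := congrArg (fun G => Ring.inverse (dotGerm x₀ α) * toFlat R Γ₀ x₀ G)
    (ell_mul_dirDeriv_quot hR (weylStable_orbit R (x₀ : V N)) α α F)
  simp only [map_mul, toFlat_ell, Ring.inverse_mul_cancel_left _ _ hu] at h1
  rw [h1, toFlat_quot hR hx₀ h, mul_div_cancel_right₀ _ (hR.dot_self_ne_zero α.2)]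
  simp only [map_sub, map_add, map_smul, toFlat_quot hR hx₀ h, mul_sub, mul_add, mul_smul_comm,
    ← mul_assoc, ← sq]
  module

open Classical in
/-- The direction along the flat of the leading term of the restricted Dunkl operator `∇_ξ`. -/
def flatDir (R Γ₀ : Finset (V N)) (c : V N → ℂ) (ξ : V N) : V N :=
  ξ - ∑ α : R, (if IsOrth Γ₀ α then c α / ((α : V N) ⬝ᵥ α) * ((α : V N) ⬝ᵥ ξ) else 0) • (α : V N)

-- Roots orthogonal to `π` contribute only derivatives, which combine with `∂_ξ` into a single
-- direction. All other terms depend only on the restrictions to `π` of `F` and its translates, so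
-- the obstruction to descent is that this direction may leave `π`.
open Classical in
theorem toFlat_nab (hx₀ : IsGeneric R Γ₀ x₀) (c : V N → ℂ) (ξ : V N)
    (F : Amb (orbit R (x₀ : V N))) :
    toFlat R Γ₀ x₀ (nab hR (weylStable_orbit R (x₀ : V N)) c ξ F) =
      toFlat R Γ₀ x₀ (dirDeriv _ (flatDir R Γ₀ c ξ) F) -
      ∑ α : R, if IsOrth Γ₀ α then 0 else (1 / 2 * c α * ((α : V N) ⬝ᵥ ξ)) •
        (Ring.inverse (dotGerm x₀ α) * (toFlat R Γ₀ x₀ F -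
          toFlat R Γ₀ x₀ (act (weylStable_orbit R (x₀ : V N)) (sElt α) F))) := by
  have h1 : dirDeriv (orbit R (x₀ : V N)) (flatDir R Γ₀ c ξ) F = dirDeriv _ ξ F - ∑ α : R,
      (if IsOrth Γ₀ α then c α / ((α : V N) ⬝ᵥ α) * ((α : V N) ⬝ᵥ ξ) else 0) •
        dirDeriv _ (α : V N) F := by
    rw [flatDir, ← dirDerivₗ_apply, map_sub, map_sum, LinearMap.sub_apply, LinearMap.sum_apply]
    simp only [map_smul, LinearMap.smul_apply, dirDerivₗ_apply]
  rw [nab_apply, h1, map_sub, map_sub, map_sum, map_sum, sub_sub, ← Finset.sum_add_distrib]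
  congr 1
  refine Finset.sum_congr rfl fun α _ => ?_
  by_cases h : IsOrth Γ₀ (α : V N)
  · rw [if_pos h, if_pos h, map_smul, map_smul, toFlat_quot_of_isOrth hR h, smul_smul, add_zero]
    congr 1
    ring
  · rw [if_neg h, if_neg h, map_smul, toFlat_quot hR hx₀ h, zero_smul, map_zero, zero_add]

end Restrict

/-! ### Ideal invariance forces the direction into the flat -/

section FlatDirection

/-- The linear polynomial `(a, x)`. -/
def linPoly (a : V N) : MvPolynomial (Fin N) ℂ := ∑ i, MvPolynomial.C (a i) * MvPolynomial.X i

theorem eval_linPoly (a x : V N) : MvPolynomial.eval x (linPoly a) = a ⬝ᵥ x := by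
  simp [linPoly, dotProduct]

/-- A multiple of `(β, x)` that vanishes on the whole stratum but only to first order, transversally
to `π`, near `x₀`; it is the test polynomial for the invariance hypothesis. -/
theorem exists_vanishing_cofactor (hR : IsClassical R) (hΓ : Γ₀ ⊆ R)
    (hx₀ : IsGeneric R Γ₀ x₀) {β : V N} (hβ : β ∈ Γ₀) :
    ∃ q : MvPolynomial (Fin N) ℂ, MvPolynomial.eval (x₀ : V N) q ≠ 0 ∧
      linPoly β * q ∈ MvPolynomial.vanishingIdeal ℂ (stratum R Γ₀) := by
  classical
  have hfin := hR.finite_weyl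
  have := Fintype.ofFinite (reflGroup R)
  have h1 : ∀ w : reflGroup R, ∃ q : MvPolynomial (Fin N) ℂ, MvPolynomial.eval (x₀ : V N) q ≠ 0 ∧
      ∀ y ∈ flat Γ₀, MvPolynomial.eval ((w : V N ≃ₗ[ℂ] V N) y) q = 0 ∨
        β ⬝ᵥ (w : V N ≃ₗ[ℂ] V N) y = 0 := by
    intro w
    -- If `w(π)` passes through `x₀` it equals `π`, where `(β, x)` already vanishes. Otherwise some
    -- linear form `(w γ, x)` vanishes on `w(π)` but not at `x₀`.
    by_cases hw : (w : V N ≃ₗ[ℂ] V N)⁻¹ (x₀ : V N) ∈ flat Γ₀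
    · refine ⟨1, by simp, fun y hy => Or.inr ?_⟩
      have hmap := hx₀.map_flat_eq hR hΓ (inv_mem w.2) hw
      rw [← hmap] at hy
      obtain ⟨z, hz, rfl⟩ := hy
      change β ⬝ᵥ (w : V N ≃ₗ[ℂ] V N) ((w : V N ≃ₗ[ℂ] V N)⁻¹ z) = 0
      rw [weyl_apply_inv_apply]
      exact hz β hβ
    · have hw' : ∃ γ ∈ Γ₀, γ ⬝ᵥ (w : V N ≃ₗ[ℂ] V N)⁻¹ (x₀ : V N) ≠ 0 := by
        by_contra! h
        exact hw h
      obtain ⟨γ, hγ, h⟩ := hw'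
      refine ⟨linPoly ((w : V N ≃ₗ[ℂ] V N) γ), ?_, fun y hy => Or.inl ?_⟩
      · rwa [eval_linPoly, weyl_dot_left w.2]
      · rw [eval_linPoly, weyl_dot w.2]
        exact hy γ hγ
  choose q hq0 hq using h1
  refine ⟨∏ w, q w, ?_, ?_⟩
  · rw [map_prod]
    exact Finset.prod_ne_zero_iff.mpr fun w _ => hq0 w
  · rw [MvPolynomial.mem_vanishingIdeal_iff]
    rintro _ ⟨w, hw, y, hy, rfl⟩
    change MvPolynomial.eval _ _ = 0
    rw [map_mul, eval_linPoly, map_prod]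
    rcases hq ⟨w, hw⟩ y hy with h | h
    · rw [Finset.prod_eq_zero (Finset.mem_univ (⟨w, hw⟩ : reflGroup R)) h, mul_zero]
    · rw [h, zero_mul]

theorem toOrbit_polyGerm {p : MvPolynomial (Fin N) ℂ}
    (hp : p ∈ MvPolynomial.vanishingIdeal ℂ (stratum R Γ₀)) :
    toOrbit R Γ₀ x₀ (polyGerm _ p) = 0 :=
  germ_eq_iff (g := fun _ => 0) (hg := analyticOnNhd_const).mpr
    (Filter.Eventually.of_forall fun x hx => (MvPolynomial.mem_vanishingIdeal_iff.mp hp) x hx)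

/-- Apply `∇_ξ` to the test polynomial `(β, x) q` and restrict to `π`: all translates vanish there,
so what remains is `(β, flatDir ξ) q`. This must be zero although `q(x₀) ≠ 0`. -/
theorem flatDir_mem (hR : IsClassical R) (hΓ : Γ₀ ⊆ R) (hx₀ : IsGeneric R Γ₀ x₀)
    {t : Fin N → ℝ} (ht : ∀ α ∈ R, height t α ≠ 0) {c : V N → ℂ}
    (hc : ∀ w ∈ reflGroup R, ∀ α ∈ R, c (w α) = c α)
    (hinv : IdealInvariant R (posRoots R t) Γ₀ c) (ξ : V N) : flatDir R Γ₀ c ξ ∈ flat Γ₀ := by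
  intro β hβ
  obtain ⟨q, hq0, hq⟩ := exists_vanishing_cofactor hR hΓ hx₀ hβ
  obtain ⟨p, hp, hpe⟩ := (hinv _ hq).2 ξ
  have h0 := (toOrbit_eq_zero_iff hR hΓ hx₀ _).mp (toOrbit_polyGerm (x₀ := x₀) hq)
  have h0' : toFlat R Γ₀ x₀ (polyGerm _ (linPoly β * q)) = 0 := by
    have := h0 1
    rwa [act_one] at this
  have h1 : nab hR (weylStable_orbit R (x₀ : V N)) c ξ (polyGerm _ (linPoly β * q)) =
      polyGerm _ p := by
    rw [polyGerm, nab_germ hR _ ht hc]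
    exact germ_congr (Filter.Eventually.of_forall fun x => (hpe x).symm)
  have h2 : toFlat R Γ₀ x₀ (polyGerm _ p) = 0 := by
    rw [← restrictScalar_toOrbit, toOrbit_polyGerm hp, map_zero]
  have h3 : polyGerm (orbit R (x₀ : V N)) (linPoly β * q) = ell _ β * polyGerm _ q :=
    germ_congr (Filter.Eventually.of_forall fun x => by
      change _ = (β ⬝ᵥ x) * MvPolynomial.eval x q
      rw [map_mul, eval_linPoly])
  have h4 := toFlat_nab hR hx₀ c ξ (polyGerm _ (linPoly β * q))
  rw [h1, h2] at h4
  simp only [h0, h0', sub_self, mul_zero, smul_zero, ite_self, Finset.sum_const_zero, sub_zero]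
    at h4
  rw [h3, dirDeriv_ell_mul, map_add, map_smul, map_mul, toFlat_ell,
    dotGerm_eq_zero (isOrth_of_mem hβ), zero_mul, add_zero, eq_comm, smul_eq_zero] at h4
  refine h4.resolve_right fun h5 => hq0 ?_
  have h6 := germ_eq_iff (g := fun _ => 0) (hg := analyticOnNhd_const).mp h5
  rw [nhdsSet_singleton] at h6
  exact h6.self_of_nhds trivial

end FlatDirection

end

section

variable {N : ℕ} {R Γ₀ : Finset (V N)} {x₀ : flat Γ₀}

/-! ### Weyl invariance of the harmonic Laplacian -/

section Invariance

variable {S : Set (V N)} (hR : IsClassical R) (hS : WeylStable R S) {c : V N → ℂ}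
  (hc : ∀ w ∈ reflGroup R, ∀ α ∈ R, c (w α) = c α)
include hR hc

theorem actOp_mul_sum_actOp (w : reflGroup R) :
    actOp hS w * ∑ α : R, c α • actOp hS (sElt α) =
      (∑ α : R, c α • actOp hS (sElt α)) * actOp hS w := by
  rw [Finset.mul_sum, Finset.sum_mul, ← Equiv.sum_comp (rootAct hR w)
    (fun α : R => c α • actOp hS (sElt α) * actOp hS w)]
  refine Finset.sum_congr rfl fun α _ => LinearMap.ext fun F => ?_
  change act hS w (c α • act hS (sElt α) F) =
    c ((w : V N ≃ₗ[ℂ] V N) α) • act hS (sElt (rootAct hR w α)) (act hS w F)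
  rw [hc _ w.2 _ α.2, map_smul, ← act_mul, ← act_mul, sElt_rootAct]

theorem actOp_mul_sum_sq_sub_sq (ω : ℂ) (w : reflGroup R) :
    Commute (actOp hS w) (∑ i, (nab hR hS c (e i) ^ 2 - ω ^ 2 • ellOp S (e i) ^ 2)) := by
  rw [sum_sq_sub_sq hR hS]
  refine Commute.add_right (actOp_mul_sum_hOp_pow hR hS hc ω 1 w) (Commute.smul_right ?_ ω)
  exact Commute.sub_right (Commute.smul_right (Commute.one_right _) _)
    (actOp_mul_sum_actOp hR hS hc w)

end Invariance

/-! ### Operators on the stratum induced by ambient operators -/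

section Descent

theorem exists_descent {M M' : Type*} [AddCommGroup M] [Module ℂ M] [AddCommGroup M'] [Module ℂ M']
    {p : M →ₗ[ℂ] M'} (hp : Function.Surjective p) (T : Module.End ℂ M)
    (hT : ∀ x, p x = 0 → p (T x) = 0) : ∃ T' : Module.End ℂ M', ∀ x, T' (p x) = p (T x) := by
  refine ⟨(LinearMap.ker p).liftQ (p ∘ₗ T) (fun x hx => hT x hx) ∘ₗ
    (p.quotKerEquivOfSurjective hp).symm, fun x => ?_⟩
  have : (p.quotKerEquivOfSurjective hp).symm (p x) = (LinearMap.ker p).mkQ x := by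
    rw [LinearEquiv.symm_apply_eq]
    rfl
  rw [LinearMap.comp_apply, LinearEquiv.coe_coe, this]
  rfl

/-- The operator `T'` on germs on the stratum is induced by the operator `T` on ambient germs. -/
def Induces (T : Module.End ℂ (Amb (orbit R (x₀ : V N)))) (T' : Module.End ℂ (OrbitGerms R Γ₀ x₀)) :
    Prop := ∀ F, T' (toOrbit R Γ₀ x₀ F) = toOrbit R Γ₀ x₀ (T F)

namespace Induces

variable {T₁ T₂ : Module.End ℂ (Amb (orbit R (x₀ : V N)))}
  {T₁' T₂' : Module.End ℂ (OrbitGerms R Γ₀ x₀)}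

theorem add (h₁ : Induces T₁ T₁') (h₂ : Induces T₂ T₂') : Induces (T₁ + T₂) (T₁' + T₂') :=
  fun F => by rw [LinearMap.add_apply, LinearMap.add_apply, map_add, h₁, h₂]

theorem sub (h₁ : Induces T₁ T₁') (h₂ : Induces T₂ T₂') : Induces (T₁ - T₂) (T₁' - T₂') :=
  fun F => by rw [LinearMap.sub_apply, LinearMap.sub_apply, map_sub, h₁, h₂]

theorem smul (h : Induces T₁ T₁') (a : ℂ) : Induces (a • T₁) (a • T₁') :=
  fun F => by rw [LinearMap.smul_apply, LinearMap.smul_apply, map_smul, h]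

theorem mul (h₁ : Induces T₁ T₁') (h₂ : Induces T₂ T₂') : Induces (T₁ * T₂) (T₁' * T₂') :=
  fun F => by rw [Module.End.mul_apply, Module.End.mul_apply, h₂, h₁]

theorem pow (h : Induces T₁ T₁') (m : ℕ) : Induces (T₁ ^ m) (T₁' ^ m) := by
  induction m with
  | zero => exact fun F => by simp
  | succ m ih =>
    rw [pow_succ, pow_succ]
    exact ih.mul h

theorem sum {ι : Type*} {s : Finset ι} {T : ι → Module.End ℂ (Amb (orbit R (x₀ : V N)))}
    {T' : ι → Module.End ℂ (OrbitGerms R Γ₀ x₀)} (h : ∀ i ∈ s, Induces (T i) (T' i)) :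
    Induces (∑ i ∈ s, T i) (∑ i ∈ s, T' i) := fun F => by
  rw [LinearMap.sum_apply, LinearMap.sum_apply, map_sum]
  exact Finset.sum_congr rfl fun i hi => h i hi F

theorem commute (h₁ : Induces T₁ T₁') (h₂ : Induces T₂ T₂') (h : Commute T₁ T₂) :
    Commute T₁' T₂' := by
  refine LinearMap.ext fun f => ?_
  obtain ⟨F, rfl⟩ := toOrbit_surjective R Γ₀ x₀ f
  rw [h₁.mul h₂, h₂.mul h₁, h.eq]

end Induces

theorem induces_actOp (w : reflGroup R) :
    Induces (actOp (weylStable_orbit R (x₀ : V N)) w) (weylAct R Γ₀ x₀ w).toLinearMap :=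
  fun F => weylAct_toOrbit R Γ₀ x₀ w F

theorem induces_ellOp (i : Fin N) :
    Induces (ellOp (orbit R (x₀ : V N)) (e i)) (coordOp R Γ₀ x₀ i) := fun F => by
  rw [ellOp_apply, map_mul]
  change linGerm _ _ (LinearMap.proj i) * toOrbit R Γ₀ x₀ F =
    toOrbit R Γ₀ x₀ (ell _ (e i)) * toOrbit R Γ₀ x₀ F
  congr 1
  refine germ_congr (Filter.Eventually.of_forall fun x => ?_)
  change x i = e i ⬝ᵥ x
  rw [dotProduct_comm, dot_e]

end Descent

/-! ### Descent of the Dunkl operators -/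

section DunklAction

variable (hR : IsClassical R) (hΓ : Γ₀ ⊆ R) (hx₀ : IsGeneric R Γ₀ x₀)
  {t : Fin N → ℝ} (ht : ∀ α ∈ R, height t α ≠ 0) {c : V N → ℂ}
  (hc : ∀ w ∈ reflGroup R, ∀ α ∈ R, c (w α) = c α)
  (hinv : IdealInvariant R (posRoots R t) Γ₀ c)
include hΓ hx₀ ht hc hinv

/-- If all translates of `F` vanish on `π`, so do the difference terms in `toFlat_nab`, and the
remaining derivative is tangent to `π`. Equivariance of `∇` reduces every translate to this case. -/
theorem exists_induces_nab (ξ : V N) : ∃ T : Module.End ℂ (OrbitGerms R Γ₀ x₀),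
    Induces (nab hR (weylStable_orbit R (x₀ : V N)) c ξ) T := by
  refine exists_descent (p := (toOrbit R Γ₀ x₀).toLinearMap) (toOrbit_surjective R Γ₀ x₀) _
    fun F hF => ?_
  change toOrbit R Γ₀ x₀ F = 0 at hF
  change toOrbit R Γ₀ x₀ _ = 0
  rw [toOrbit_eq_zero_iff hR hΓ hx₀] at hF ⊢
  intro w
  rw [act_nab hR _ hc, toFlat_nab hR hx₀]
  have h1 : ∀ α : R, toFlat R Γ₀ x₀ (act (weylStable_orbit R (x₀ : V N)) (sElt α)
      (act (weylStable_orbit R (x₀ : V N)) w F)) = 0 := fun α => by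
    rw [← act_mul]
    exact hF _
  simp only [h1, hF w, sub_self, mul_zero, smul_zero, ite_self, Finset.sum_const_zero, sub_zero]
  have h2 := toFlat_dirDeriv R Γ₀ x₀ ⟨_, flatDir_mem hR hΓ hx₀ ht hc hinv
    ((w : V N ≃ₗ[ℂ] V N) ξ)⟩ (act (weylStable_orbit R (x₀ : V N)) w F)
  rw [h2, hF w, map_zero]

end DunklAction

/-! ### Transfer of the operators to the stratum -/

section Transfer

variable (hR : IsClassical R) {c : V N → ℂ} {nabla : Fin N → Module.End ℂ (OrbitGerms R Γ₀ x₀)}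

theorem KTilde_zero : KTilde nabla 0 = ∑ i, nabla i ^ 2 := by
  simp [KTilde]

theorem restrictScalar_KTilde (ω : ℂ) (f : OrbitGerms R Γ₀ x₀) :
    restrictScalar R Γ₀ x₀ (KTilde nabla ω f) =
      restrictScalar R Γ₀ x₀ ((∑ i, nabla i ^ 2) f) -
        ω ^ 2 • (sqGerm x₀ * restrictScalar R Γ₀ x₀ f) := by
  have h : ∀ i, restrictScalar R Γ₀ x₀ ((coordOp R Γ₀ x₀ i ^ 2) f) =
      dotGerm x₀ (e i) ^ 2 * restrictScalar R Γ₀ x₀ f := by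
    intro i
    obtain ⟨F, rfl⟩ := toOrbit_surjective R Γ₀ x₀ f
    rw [(induces_ellOp i).pow 2, restrictScalar_toOrbit, restrictScalar_toOrbit, sq,
      Module.End.mul_apply, ellOp_apply, ellOp_apply, map_mul, map_mul, toFlat_ell]
    ring
  simp only [KTilde, LinearMap.sum_apply, LinearMap.sub_apply, LinearMap.smul_apply, map_sum,
    map_sub, map_smul, h, Finset.sum_sub_distrib, sqGerm, Finset.sum_mul, Finset.smul_sum]

variable (hn : ∀ i, Induces (nab hR (weylStable_orbit R (x₀ : V N)) c (e i)) (nabla i))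
include hn

theorem isDunklAction_of_induces {t : Fin N → ℝ} (ht : ∀ α ∈ R, height t α ≠ 0)
    (hc : ∀ w ∈ reflGroup R, ∀ α ∈ R, c (w α) = c α) (i : Fin N) :
    IsDunklAction (posRoots R t) c (e i) (nabla i) := fun f hf =>
  ⟨analyticOnNhd_dunkl hR (weylStable_orbit R (x₀ : V N)) t c _ hf, by
    rw [← toOrbit_germ, hn, nab_germ hR _ ht hc]
    rfl⟩

theorem induces_K (ω : ℂ) (m : ℕ) :
    Induces (∑ i, hOp hR (weylStable_orbit R (x₀ : V N)) c ω (e i) ^ m) (K nabla ω m) := by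
  refine Induces.sum fun i _ => Induces.pow (Induces.mul ?_ ?_) m
  · exact (hn i).add ((induces_ellOp i).smul ω)
  · intro F
    rw [(hn i).sub ((induces_ellOp i).smul ω), shiftedNab_apply, LinearMap.sub_apply,
      LinearMap.smul_apply, ellOp_apply, neg_smul, sub_eq_add_neg]

theorem induces_KTilde (ω : ℂ) :
    Induces (∑ i, (nab hR (weylStable_orbit R (x₀ : V N)) c (e i) ^ 2 -
      ω ^ 2 • ellOp (orbit R (x₀ : V N)) (e i) ^ 2)) (KTilde nabla ω) :=
  Induces.sum fun i _ => ((hn i).pow 2).sub (((induces_ellOp i).pow 2).smul _)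

end Transfer

end

section

variable {N : ℕ} {R Γ₀ : Finset (V N)} {x₀ : flat Γ₀}

theorem dotGerm_congr {a b : V N} (h : ∀ y ∈ flat Γ₀, a ⬝ᵥ y = b ⬝ᵥ y) :
    dotGerm x₀ a = dotGerm x₀ b :=
  germ_congr (Filter.Eventually.of_forall fun y => h y y.2)

theorem dotGerm_neg (a : V N) : dotGerm x₀ (-a) = -dotGerm x₀ a :=
  germ_congr (Filter.Eventually.of_forall fun y => neg_dotProduct a (y : V N))

theorem ringInverse_neg {A : Type*} [Ring A] {a : A} (h : IsUnit a) :
    Ring.inverse (-a) = -Ring.inverse a := by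
  obtain ⟨u, rfl⟩ := h
  rw [Ring.inverse_unit, ← Units.val_neg, Ring.inverse_unit, inv_neg, Units.val_neg]

/-! ### Orthogonal projection in orthonormal coordinates -/

section OrthonormalCoordinates

variable {n : ℕ} {b : Module.Basis (Fin n) ℂ (flat Γ₀)}

theorem coe_orthProj (b : Module.Basis (Fin n) ℂ (flat Γ₀)) (α : V N) :
    (orthProj b α : V N) = ∑ j, (α ⬝ᵥ (b j : V N)) • (b j : V N) := by
  simp [orthProj]

theorem orthProj_neg (b : Module.Basis (Fin n) ℂ (flat Γ₀)) (α : V N) :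
    orthProj b (-α) = -orthProj b α :=
  Subtype.ext (by
    rw [coe_orthProj, Submodule.coe_neg, coe_orthProj]
    simp only [neg_dotProduct, neg_smul, Finset.sum_neg_distrib])

variable (hb : IsOrthonormal b)
include hb

theorem IsOrthonormal.orthProj_dot (α : V N) {y : V N} (hy : y ∈ flat Γ₀) :
    (orthProj b α : V N) ⬝ᵥ y = α ⬝ᵥ y := by
  have h : dotForm (orthProj b α : V N) ∘ₗ (flat Γ₀).subtype = dotForm α ∘ₗ (flat Γ₀).subtype := by
    refine b.ext fun k => ?_
    change (orthProj b α : V N) ⬝ᵥ (b k : V N) = α ⬝ᵥ (b k : V N)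
    rw [coe_orthProj, sum_dotProduct]
    simp [smul_dotProduct, hb _ k]
  exact LinearMap.congr_fun h ⟨y, hy⟩

theorem IsOrthonormal.orthProj_eq_zero_iff (α : V N) : orthProj b α = 0 ↔ IsOrth Γ₀ α := by
  constructor
  · intro h y hy
    rw [← hb.orthProj_dot α hy, h]
    exact zero_dotProduct y
  · intro h
    exact Finset.sum_eq_zero fun j _ => by rw [h _ (b j).2, zero_smul]

theorem IsOrthonormal.orthProj_unique {α v : V N} (hv : v ∈ flat Γ₀)
    (h : ∀ y ∈ flat Γ₀, v ⬝ᵥ y = α ⬝ᵥ y) : (orthProj b α : V N) = v := by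
  have h1 : orthProj b α = ∑ j, b.repr ⟨v, hv⟩ j • b j := by
    refine Finset.sum_congr rfl fun j _ => ?_
    congr 1
    rw [← h _ (b j).2]
    have h2 : v = ∑ k, b.repr ⟨v, hv⟩ k • (b k : V N) := by
      have := congrArg (flat Γ₀).subtype (b.sum_repr ⟨v, hv⟩)
      rw [map_sum] at this
      exact this.symm
    conv_lhs => rw [h2, sum_dotProduct]
    simp [smul_dotProduct, hb _ j]
  rw [h1, b.sum_repr]

end OrthonormalCoordinates

/-! ### The Dunkl Laplacian restricted to the flat -/

section DunklLaplacian

variable (hR : IsClassical R) {c : V N → ℂ}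
  (hc : ∀ w ∈ reflGroup R, ∀ α ∈ R, c (w α) = c α)

open Classical in
include hR hc in
/-- The transversal components of the first order terms cancel by symmetry. -/
theorem sum_smul_inverse_dotGerm (β : R) (hβ : IsOrth Γ₀ (β : V N)) :
    ∑ α : R, (if IsOrth Γ₀ (α : V N) then 0 else
      (c α * ((β : V N) ⬝ᵥ α)) • Ring.inverse (dotGerm x₀ (α : V N))) = 0 := by
  -- Reindexing by `s_β` fixes `c_α` and the restriction of `(α, ·)` to `π`, but negates `(β, α)`;
  -- so the sum equals its own negative.
  have key := Equiv.sum_comp (rootAct hR (sElt β)) (fun α : R =>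
    (if IsOrth Γ₀ (α : V N) then 0 else
      (c α * ((β : V N) ⬝ᵥ α)) • Ring.inverse (dotGerm x₀ (α : V N))))
  have hy : ∀ α : V N, ∀ y ∈ flat Γ₀, reflection (β : V N) α ⬝ᵥ y = α ⬝ᵥ y := by
    intro α y hy
    rw [reflection_apply, sub_dotProduct, smul_dotProduct, hβ y hy, smul_zero, sub_zero]
  have h1 : ∀ α : R, (if IsOrth Γ₀ (rootAct hR (sElt β) α : V N) then 0 else
      (c (rootAct hR (sElt β) α) * ((β : V N) ⬝ᵥ (rootAct hR (sElt β) α : V N))) •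
        Ring.inverse (dotGerm x₀ (rootAct hR (sElt β) α : V N))) =
      -(if IsOrth Γ₀ (α : V N) then 0 else
      (c α * ((β : V N) ⬝ᵥ α)) • Ring.inverse (dotGerm x₀ (α : V N))) := by
    intro α
    have h2 : IsOrth Γ₀ (rootAct hR (sElt β) α : V N) ↔ IsOrth Γ₀ (α : V N) :=
      forall₂_congr fun y hy' => by rw [coe_rootAct, coe_sElt, hy _ y hy']
    have h3 : dotGerm x₀ (rootAct hR (sElt β) α : V N) = dotGerm x₀ (α : V N) :=
      dotGerm_congr (hy α)
    have h4 : (β : V N) ⬝ᵥ (rootAct hR (sElt β) α : V N) = -((β : V N) ⬝ᵥ α) := by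
      have := reflection_dot_reflection (β : V N) β α
      rw [reflection_self (hR.dot_self_ne_zero β.2), neg_dotProduct, neg_eq_iff_eq_neg] at this
      exact this
    have h5 : c (rootAct hR (sElt β) α) = c α := hc _ (sElt β).2 _ α.2
    by_cases h : IsOrth Γ₀ (α : V N)
    · rw [if_pos (h2.mpr h), if_pos h, neg_zero]
    · rw [if_neg (fun h' => h (h2.mp h')), if_neg h, h3, h4, h5, mul_neg, neg_smul]
  rw [Finset.sum_congr rfl fun α _ => h1 α, Finset.sum_neg_distrib, neg_eq_iff_add_eq_zero,
    ← two_smul ℂ] at key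
  exact (smul_eq_zero.mp key).resolve_left two_ne_zero

variable (R) in
theorem flatDir_dot (c : V N → ℂ) (ξ : V N) {y : V N} (hy : y ∈ flat Γ₀) :
    flatDir R Γ₀ c ξ ⬝ᵥ y = ξ ⬝ᵥ y := by
  rw [flatDir, sub_dotProduct, sum_dotProduct, Finset.sum_eq_zero, sub_zero]
  intro α _
  rw [smul_dotProduct]
  split_ifs with h
  · rw [h y hy, smul_zero]
  · rw [zero_smul]

variable (hflat : ∀ ξ, flatDir R Γ₀ c ξ ∈ flat Γ₀) {n : ℕ}
  {b : Module.Basis (Fin n) ℂ (flat Γ₀)} (hb : IsOrthonormal b)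
include hflat hb

/-- By construction `flatDir ξ` differs from `ξ` by a vector orthogonal to `π`. Once it lies in `π`
it has to be the projection, so the roots orthogonal to `π`, weighted by `c`, reproduce the
transversal part of every vector. -/
theorem flatDir_eq_orthProj (ξ : V N) : flatDir R Γ₀ c ξ = (orthProj b ξ : V N) :=
  (hb.orthProj_unique (hflat ξ) fun _ hy => flatDir_dot R c ξ hy).symm

open Classical in
theorem dirDeriv_eq_orthProj_add (ξ : V N) (F : Amb (orbit R (x₀ : V N))) :
    dirDeriv _ ξ F = dirDeriv _ (orthProj b ξ : V N) F + ∑ β : R,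
      (if IsOrth Γ₀ β then c β / ((β : V N) ⬝ᵥ β) * ((β : V N) ⬝ᵥ ξ) else 0) •
        dirDeriv _ (β : V N) F := by
  have h : ξ = (orthProj b ξ : V N) + ∑ β : R,
      (if IsOrth Γ₀ β then c β / ((β : V N) ⬝ᵥ β) * ((β : V N) ⬝ᵥ ξ) else 0) • (β : V N) := by
    rw [← flatDir_eq_orthProj hflat hb, flatDir, sub_add_cancel]
  conv_lhs => rw [h, ← dirDerivₗ_apply, map_add, map_sum, LinearMap.add_apply, LinearMap.sum_apply]
  simp only [map_smul, LinearMap.smul_apply, dirDerivₗ_apply]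

-- Only the inner derivative `∂_i` is split into tangential and transversal parts. Summing over `i`
-- then assembles the outer derivatives into `∂_{b_j}` and `∂_β`.
open Classical in
theorem toFlat_laplacian (F : Amb (orbit R (x₀ : V N))) :
    toFlat R Γ₀ x₀ (∑ i, dirDeriv _ (e i) (dirDeriv _ (e i) F)) =
      ∑ j, dirDeriv {x₀} (b j) (dirDeriv {x₀} (b j) (toFlat R Γ₀ x₀ F)) +
      ∑ α : R, (if IsOrth Γ₀ α then c α / ((α : V N) ⬝ᵥ α) else 0) •
        toFlat R Γ₀ x₀ (dirDeriv _ (α : V N) (dirDeriv _ (α : V N) F)) := by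
  have hsum : ∀ (v : V N) (G : Amb (orbit R (x₀ : V N))),
      ∑ i, (v ⬝ᵥ e i) • dirDeriv _ (e i) G = dirDeriv _ v G := by
    intro v G
    have := congrArg (fun v => dirDerivₗ (orbit R (x₀ : V N)) v G) (sum_dot_e_smul v)
    simpa [map_sum, LinearMap.sum_apply] using this
  have h1 : ∑ i, dirDeriv (orbit R (x₀ : V N)) (e i) (dirDeriv _ (orthProj b (e i) : V N) F) =
      ∑ j, dirDeriv _ (b j : V N) (dirDeriv _ (b j : V N) F) := by
    have h2 : ∀ i, dirDeriv (orbit R (x₀ : V N)) (orthProj b (e i) : V N) F =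
        ∑ j, ((b j : V N) ⬝ᵥ e i) • dirDeriv _ (b j : V N) F := by
      intro i
      rw [coe_orthProj, ← dirDerivₗ_apply, map_sum, LinearMap.sum_apply]
      simp only [map_smul, LinearMap.smul_apply, dirDerivₗ_apply, dotProduct_comm]
    simp only [h2, map_sum, map_smul]
    rw [Finset.sum_comm]
    exact Finset.sum_congr rfl fun j _ => hsum _ _
  have h3 : ∑ i, dirDeriv (orbit R (x₀ : V N)) (e i) (∑ β : R,
      (if IsOrth Γ₀ β then c β / ((β : V N) ⬝ᵥ β) * ((β : V N) ⬝ᵥ e i) else 0) •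
        dirDeriv _ (β : V N) F) =
      ∑ β : R, (if IsOrth Γ₀ β then c β / ((β : V N) ⬝ᵥ β) else 0) •
        dirDeriv _ (β : V N) (dirDeriv _ (β : V N) F) := by
    simp only [map_sum, map_smul]
    rw [Finset.sum_comm]
    refine Finset.sum_congr rfl fun β _ => ?_
    rw [← hsum β (dirDeriv _ (β : V N) F), Finset.smul_sum]
    refine Finset.sum_congr rfl fun i _ => ?_
    rw [smul_smul, ite_mul, zero_mul]
  rw [Finset.sum_congr rfl fun i _ => congrArg (dirDeriv _ (e i))
    (dirDeriv_eq_orthProj_add (x₀ := x₀) hflat hb (e i) F)]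
  simp only [map_add, Finset.sum_add_distrib]
  rw [h1, h3]
  simp only [map_sum, map_smul, toFlat_dirDeriv]

include hR hc
-- Splitting `α` into its projection and roots `β` orthogonal to `π`, the coefficient of each `∂_β
-- F` is the sum that vanishes by `sum_smul_inverse_dotGerm`.
open Classical in
theorem sum_smul_inverse_mul_dirDeriv (F : Amb (orbit R (x₀ : V N))) :
    ∑ α : R, (if IsOrth Γ₀ (α : V N) then 0 else c α •
      (Ring.inverse (dotGerm x₀ (α : V N)) * toFlat R Γ₀ x₀ (dirDeriv _ (α : V N) F))) =
    ∑ α : R, (if IsOrth Γ₀ (α : V N) then 0 else c α •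
      (Ring.inverse (dotGerm x₀ (α : V N)) *
        dirDeriv {x₀} (orthProj b (α : V N)) (toFlat R Γ₀ x₀ F))) := by
  have h1 : ∀ α : R, (if IsOrth Γ₀ (α : V N) then 0 else c α •
      (Ring.inverse (dotGerm x₀ (α : V N)) * toFlat R Γ₀ x₀ (dirDeriv _ (α : V N) F))) =
      (if IsOrth Γ₀ (α : V N) then 0 else c α •
      (Ring.inverse (dotGerm x₀ (α : V N)) *
        dirDeriv {x₀} (orthProj b (α : V N)) (toFlat R Γ₀ x₀ F))) +
      ∑ β : R, (if IsOrth Γ₀ β then c β / ((β : V N) ⬝ᵥ β) else 0) •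
        ((if IsOrth Γ₀ (α : V N) then 0 else
          (c α * ((β : V N) ⬝ᵥ α)) • Ring.inverse (dotGerm x₀ (α : V N))) *
          toFlat R Γ₀ x₀ (dirDeriv _ (β : V N) F)) := by
    intro α
    by_cases h : IsOrth Γ₀ (α : V N)
    · simp [h]
    simp only [if_neg h]
    rw [dirDeriv_eq_orthProj_add hflat hb (α : V N) F, map_add, map_sum, toFlat_dirDeriv, mul_add,
      smul_add, Finset.mul_sum, Finset.smul_sum]
    congr 1
    refine Finset.sum_congr rfl fun β _ => ?_
    rw [map_smul, mul_smul_comm, smul_mul_assoc, smul_smul, smul_smul]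
    split_ifs
    · congr 1
      ring
    · rw [mul_zero, zero_mul]
  rw [Finset.sum_congr rfl fun α _ => h1 α, Finset.sum_add_distrib, add_eq_left, Finset.sum_comm]
  refine Finset.sum_eq_zero fun β _ => ?_
  split_ifs with hβ
  · rw [← Finset.smul_sum, ← Finset.sum_mul, sum_smul_inverse_dotGerm hR hc β hβ, zero_mul,
      smul_zero]
  · simp

open Classical in
theorem toFlat_sum_nab_sq (hx₀ : IsGeneric R Γ₀ x₀) {t : Fin N → ℝ} (ht : ∀ α ∈ R, height t α ≠ 0)
    (F : Amb (orbit R (x₀ : V N))) :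
    toFlat R Γ₀ x₀ (∑ i, nab hR (weylStable_orbit R (x₀ : V N)) c (e i)
      (nab hR (weylStable_orbit R (x₀ : V N)) c (e i) F)) =
    ∑ j, dirDeriv {x₀} (b j) (dirDeriv {x₀} (b j) (toFlat R Γ₀ x₀ F)) -
      ∑ α : posRoots R t, (if orthProj b (α : V N) = 0 then 0 else (2 * c α) •
        (Ring.inverse (dotGerm x₀ (orthProj b (α : V N) : V N)) *
          dirDeriv {x₀} (orthProj b (α : V N)) (toFlat R Γ₀ x₀ F))) +
      ∑ α : posRoots R t, (if orthProj b (α : V N) = 0 then 0 else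
        (c α * ((α : V N) ⬝ᵥ (α : V N))) •
          (Ring.inverse (dotGerm x₀ (orthProj b (α : V N) : V N)) ^ 2 * (toFlat R Γ₀ x₀ F -
            toFlat R Γ₀ x₀ (act (weylStable_orbit R (x₀ : V N))
              (reflElt (mem_of_mem_posRoots α.2)) F)))) := by
  have hdot : ∀ α : V N, dotGerm x₀ (orthProj b α : V N) = dotGerm x₀ α := fun α =>
    dotGerm_congr fun y hy => hb.orthProj_dot α hy
  simp only [hb.orthProj_eq_zero_iff, hdot]
  have horth : ∀ α : R, IsOrth Γ₀ (negRoot hR α : V N) ↔ IsOrth Γ₀ (α : V N) := fun α => by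
    simp only [IsOrth, coe_negRoot, neg_dotProduct, neg_eq_zero]
  have s1 := sum_posRoots hR ht (fun α : R => if IsOrth Γ₀ (α : V N) then 0 else (2 * c α) •
        (Ring.inverse (dotGerm x₀ (α : V N)) *
          dirDeriv {x₀} (orthProj b (α : V N)) (toFlat R Γ₀ x₀ F))) (by
    intro α
    by_cases h : IsOrth Γ₀ (α : V N)
    · simp only [if_pos h, if_pos ((horth α).mpr h)]
    · simp only [if_neg h, if_neg (fun h' => h ((horth α).mp h')), apply_negRoot hR hc α]
      rw [coe_negRoot, dotGerm_neg, ringInverse_neg (isUnit_dotGerm hx₀ α.2 h), orthProj_neg,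
        ← dirDerivₗ_apply, map_neg, LinearMap.neg_apply, neg_mul_neg, dirDerivₗ_apply])
  have s2 := sum_posRoots hR ht (fun α : R => if IsOrth Γ₀ (α : V N) then 0 else
        (c α * ((α : V N) ⬝ᵥ (α : V N))) •
          (Ring.inverse (dotGerm x₀ (α : V N)) ^ 2 * (toFlat R Γ₀ x₀ F -
            toFlat R Γ₀ x₀ (act (weylStable_orbit R (x₀ : V N)) (sElt α) F)))) (by
    intro α
    by_cases h : IsOrth Γ₀ (α : V N)
    · simp only [if_pos h, if_pos ((horth α).mpr h)]
    · simp only [if_neg h, if_neg (fun h' => h ((horth α).mp h')), apply_negRoot hR hc α,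
        sElt_negRoot]
      rw [coe_negRoot, dotGerm_neg, ringInverse_neg (isUnit_dotGerm hx₀ α.2 h), neg_sq,
        neg_dotProduct_neg])
  have s3 := sum_smul_inverse_mul_dirDeriv hR hc hflat hb F
  -- For `α` orthogonal to `π` the transversal part of the Laplacian cancels exactly against `½ c_α
  -- (∂_α q_α + q_α ∂_α)`. The other roots produce the first order and inverse square terms.
  have s4 : ∀ α : R, (if IsOrth Γ₀ α then c α / ((α : V N) ⬝ᵥ α) else 0) •
        toFlat R Γ₀ x₀ (dirDeriv _ (α : V N) (dirDeriv _ (α : V N) F)) -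
      (1 / 2 * c α) • (toFlat R Γ₀ x₀ (dirDeriv _ (α : V N)
          (quot hR (weylStable_orbit R (x₀ : V N)) α F)) +
        toFlat R Γ₀ x₀ (quot hR (weylStable_orbit R (x₀ : V N)) α (dirDeriv _ (α : V N) F))) =
      (1 / 2 : ℂ) • (if IsOrth Γ₀ (α : V N) then 0 else
        (c α * ((α : V N) ⬝ᵥ (α : V N))) •
          (Ring.inverse (dotGerm x₀ (α : V N)) ^ 2 * (toFlat R Γ₀ x₀ F -
            toFlat R Γ₀ x₀ (act (weylStable_orbit R (x₀ : V N)) (sElt α) F)))) -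
      (if IsOrth Γ₀ (α : V N) then 0 else c α •
        (Ring.inverse (dotGerm x₀ (α : V N)) * toFlat R Γ₀ x₀ (dirDeriv _ (α : V N) F))) := by
    intro α
    by_cases h : IsOrth Γ₀ (α : V N)
    · simp only [if_pos h]
      rw [toFlat_dirDeriv_quot_of_isOrth hR h, toFlat_quot_of_isOrth hR h, zero_add, smul_smul,
        ← sub_smul, smul_zero, sub_zero]
      convert zero_smul ℂ _
      ring
    · simp only [if_neg h]
      rw [toFlat_dirDeriv_quot hR hx₀ h]
      module
  have s5 : ∀ α : R, (if IsOrth Γ₀ (α : V N) then 0 else (2 * c α) •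
        (Ring.inverse (dotGerm x₀ (α : V N)) *
          dirDeriv {x₀} (orthProj b (α : V N)) (toFlat R Γ₀ x₀ F))) =
      (2 : ℂ) • (if IsOrth Γ₀ (α : V N) then 0 else c α •
        (Ring.inverse (dotGerm x₀ (α : V N)) *
          dirDeriv {x₀} (orthProj b (α : V N)) (toFlat R Γ₀ x₀ F))) := fun α => by
    rw [smul_ite, smul_zero, smul_smul]
  rw [s1, s2, sum_nab_sq hR _ ht hc, map_sub, toFlat_laplacian hflat hb, map_sum, add_sub_assoc,
    ← Finset.sum_sub_distrib]
  simp only [map_smul, map_add, s4, s5]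
  rw [Finset.sum_sub_distrib, s3, ← Finset.smul_sum, ← Finset.smul_sum, smul_smul]
  module

end DunklLaplacian

end

section

variable {N : ℕ} {R Γ₀ : Finset (V N)} {x₀ : flat Γ₀}

theorem IsClassical.finite_orbit (hR : IsClassical R) (x : V N) : (orbit R x).Finite := by
  have := hR.finite_weyl
  refine (Set.finite_range fun w : reflGroup R => (w : V N ≃ₗ[ℂ] V N) x).subset ?_
  rintro _ ⟨w, hw, rfl⟩
  exact ⟨⟨w, hw⟩, rfl⟩

/-! ### Extension of germs from the flat to the orbit -/

section Extension

theorem exists_separating_radius {S : Set (V N)} (hS : S.Finite) (x : V N) :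
    ∃ δ > 0, ∀ y ∈ S, y ≠ x → δ < dist y x := by
  have h1 : (S \ {x})ᶜ ∈ 𝓝 x :=
    (hS.subset Set.sdiff_subset).isClosed.isOpen_compl.mem_nhds fun h => h.2 rfl
  obtain ⟨δ, hδ, h⟩ := Metric.mem_nhds_iff.mp h1
  refine ⟨δ / 2, half_pos hδ, fun y hy hyx => ?_⟩
  by_contra! h2
  exact h (Metric.mem_ball.mpr (h2.trans_lt (half_lt_self hδ))) ⟨hy, hyx⟩

open Classical in
/-- The function `h` near `x`, extended by zero. -/
def cutoff (x : V N) (δ : ℝ) (h : V N → ℂ) (y : V N) : ℂ := if dist y x < δ then h y else 0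

theorem cutoff_eventuallyEq {x : V N} {δ : ℝ} (hδ : 0 < δ) (h : V N → ℂ) :
    ∀ᶠ y in 𝓝 x, cutoff x δ h y = h y := by
  filter_upwards [Metric.ball_mem_nhds x hδ] with y hy
  exact if_pos hy

theorem cutoff_eventuallyEq_zero {x y : V N} {δ : ℝ} (hy : δ < dist y x) (h : V N → ℂ) :
    ∀ᶠ z in 𝓝 y, cutoff x δ h z = 0 := by
  have : ∀ᶠ z in 𝓝 y, δ < dist z x :=
    ((continuous_id.dist continuous_const).tendsto y).eventually (lt_mem_nhds hy)
  filter_upwards [this] with z hz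
  exact if_neg hz.not_gt

theorem analyticOnNhd_cutoff {S : Set (V N)} {x : V N} {δ : ℝ} (hδ : 0 < δ)
    (hS : ∀ y ∈ S, y ≠ x → δ < dist y x) {h : V N → ℂ} (hh : AnalyticAt ℂ h x) :
    AnalyticOnNhd ℂ (cutoff x δ h) S := by
  intro y hy
  by_cases hyx : y = x
  · subst hyx
    exact hh.congr ((cutoff_eventuallyEq hδ h).mono fun _ h => h.symm)
  · exact analyticAt_const.congr
      ((cutoff_eventuallyEq_zero (hS y hy hyx) h).mono fun _ h => h.symm)

/-- Compose with a linear projection onto `π`, and cut off to zero near the other points of the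
orbit, where the composition need not be analytic. -/
theorem toFlat_surjective (hR : IsClassical R) : Function.Surjective (toFlat R Γ₀ x₀) := by
  intro G
  obtain ⟨g, hg, rfl⟩ := exists_germ G
  obtain ⟨δ, hδ, hS⟩ := exists_separating_radius (hR.finite_orbit (x₀ : V N)) (x₀ : V N)
  obtain ⟨P, hP⟩ := LinearMap.exists_leftInverse_of_injective (flat Γ₀).subtype
    (Submodule.ker_subtype _)
  have hP' : ∀ y : flat Γ₀, P (y : V N) = y := fun y => LinearMap.congr_fun hP y
  have hg' : AnalyticAt ℂ (fun x => g (P x)) (x₀ : V N) := by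
    refine AnalyticAt.comp ?_ (analyticOnNhd_linear P Set.univ _ trivial)
    rw [hP']
    exact hg x₀ rfl
  refine ⟨germ Set.univ _ (analyticOnNhd_cutoff hδ hS hg'), germ_congr ?_⟩
  rw [nhdsSet_singleton]
  filter_upwards [(continuous_subtype_val.tendsto x₀).eventually
    (cutoff_eventuallyEq hδ fun x => g (P x))] with y hy
  refine hy.trans ?_
  rw [hP']

/-- Germs near a finite set decompose over its points; `ε` is the unit of the component at `x₀`. -/
theorem exists_idempotent (hR : IsClassical R) : ∃ ε : Amb (orbit R (x₀ : V N)),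
    toFlat R Γ₀ x₀ ε = 1 ∧ ∀ w : reflGroup R, (w : V N ≃ₗ[ℂ] V N) (x₀ : V N) ≠ x₀ →
      toFlat R Γ₀ x₀ (act (weylStable_orbit R (x₀ : V N)) w ε) = 0 := by
  obtain ⟨δ, hδ, hS⟩ := exists_separating_radius (hR.finite_orbit (x₀ : V N)) (x₀ : V N)
  refine ⟨germ Set.univ _ (analyticOnNhd_cutoff (h := fun _ => 1) hδ hS analyticAt_const),
    germ_congr (g := fun _ => 1) (hg := analyticOnNhd_const) ?_, fun w hw =>
    germ_congr (g := fun _ => 0) (hg := analyticOnNhd_const) ?_⟩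
  · rw [nhdsSet_singleton]
    exact (continuous_subtype_val.tendsto x₀).eventually (cutoff_eventuallyEq hδ fun _ => 1)
  · rw [nhdsSet_singleton]
    have hw' : (w : V N ≃ₗ[ℂ] V N)⁻¹ (x₀ : V N) ≠ x₀ := by
      intro h
      apply hw
      conv_lhs => rw [← h, weyl_apply_inv_apply]
    have h1 : Filter.Tendsto (fun y : flat Γ₀ => (w : V N ≃ₗ[ℂ] V N)⁻¹ (y : V N)) (𝓝 x₀)
        (𝓝 ((w : V N ≃ₗ[ℂ] V N)⁻¹ (x₀ : V N))) :=
      ((LinearMap.toContinuousLinearMap (((w : V N ≃ₗ[ℂ] V N)⁻¹ : V N ≃ₗ[ℂ] V N) :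
        V N →ₗ[ℂ] V N)).continuous.comp continuous_subtype_val).tendsto x₀
    exact h1.eventually (cutoff_eventuallyEq_zero
      (hS _ ⟨_, inv_mem w.2, rfl⟩ hw') fun _ => 1)

-- Any linear section of the restriction, multiplied by the idempotent at `x₀`. The case distinction
-- is whether `w` fixes `x₀`, and the stabilizer theorem identifies this with membership in `W₀`.
open Classical in
theorem exists_extension (hR : IsClassical R) {t : Fin N → ℝ}
    (ht : ∀ α ∈ R, height t α ≠ 0) (hΓ₀ : ∀ β ∈ Γ₀, IsSimpleRoot R t β)
    (hx₀ : IsGeneric R Γ₀ x₀) :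
    ∃ E : FlatGerms Γ₀ x₀ →ₗ[ℂ] OrbitGerms R Γ₀ x₀, ∀ (w : reflGroup R) g,
      restrictScalar R Γ₀ x₀ (weylAct R Γ₀ x₀ w (E g)) =
        if (w : V N ≃ₗ[ℂ] V N) ∈ reflGroup Γ₀ then g else 0 := by
  obtain ⟨σ, hσ⟩ := LinearMap.exists_rightInverse_of_surjective (toFlat R Γ₀ x₀).toLinearMap
    (LinearMap.range_eq_top.mpr (toFlat_surjective hR))
  obtain ⟨ε, hε, hε'⟩ := exists_idempotent (x₀ := x₀) hR
  refine ⟨(toOrbit R Γ₀ x₀).toLinearMap ∘ₗ LinearMap.mulLeft ℂ ε ∘ₗ σ, fun w g => ?_⟩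
  change restrictScalar R Γ₀ x₀ (weylAct R Γ₀ x₀ w (toOrbit R Γ₀ x₀ (ε * σ g))) = _
  rw [weylAct_toOrbit, restrictScalar_toOrbit]
  split_ifs with hw
  · have h2 : toFlat R Γ₀ x₀ (σ g) = g := LinearMap.congr_fun hσ g
    rw [toFlat_act R Γ₀ x₀ hw, map_mul, hε, one_mul, h2]
  · rw [map_mul, map_mul, hε', zero_mul]
    exact fun h => hw (mem_parabolic_of_fixes hR ht hΓ₀ hx₀ w.2 h)

end Extension

/-! ### Bijectivity of restriction on invariants -/

section Bijectivity

variable {U : Type*} [AddCommGroup U] [Module ℂ U]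
  (ρ : Representation ℂ (reflGroup R)ᵐᵒᵖ U)

theorem restrict_apply (F : orbitInv ρ Γ₀ x₀) :
    (restrict ρ Γ₀ x₀ F : U ⊗[ℂ] FlatGerms Γ₀ x₀) =
      (restrictScalar R Γ₀ x₀).toLinearMap.lTensor U (F : U ⊗[ℂ] OrbitGerms R Γ₀ x₀) := rfl

theorem weylAct_mul (u w : reflGroup R) (f : OrbitGerms R Γ₀ x₀) :
    weylAct R Γ₀ x₀ (u * w) f = weylAct R Γ₀ x₀ u (weylAct R Γ₀ x₀ w f) := by
  obtain ⟨F, rfl⟩ := toOrbit_surjective R Γ₀ x₀ f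
  rw [weylAct_toOrbit, weylAct_toOrbit, weylAct_toOrbit, act_mul]

theorem diagAct_mul (u w : reflGroup R) : diagAct ρ Γ₀ x₀ (u * w) =
    diagAct ρ Γ₀ x₀ u ∘ₗ diagAct ρ Γ₀ x₀ w := by
  rw [diagAct, diagAct, diagAct, ← TensorProduct.map_comp]
  congr 1
  · rw [mul_inv_rev, MulOpposite.op_mul, map_mul]
    rfl
  · exact LinearMap.ext fun f => weylAct_mul u w f

/-- Invariance reads `F(w⁻¹ x) = F(x) · w`, so the action on the argument can be traded for the
action on `U`. This is how `P_α` arises from `s_α`. -/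
theorem lTensor_weylAct_of_mem (w : reflGroup R) {F : U ⊗[ℂ] OrbitGerms R Γ₀ x₀}
    (hF : F ∈ orbitInv ρ Γ₀ x₀) : (weylAct R Γ₀ x₀ w).toLinearMap.lTensor U F =
      (ρ (MulOpposite.op w)).rTensor (OrbitGerms R Γ₀ x₀) F := by
  conv_rhs => rw [← hF w]
  rw [diagAct, LinearMap.rTensor, ← LinearMap.comp_apply, ← TensorProduct.map_comp]
  have h : ρ (MulOpposite.op w) ∘ₗ ρ (MulOpposite.op w⁻¹) = LinearMap.id := by
    change ρ (MulOpposite.op w) * ρ (MulOpposite.op w⁻¹) = 1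
    rw [← map_mul, ← MulOpposite.op_mul, inv_mul_cancel, MulOpposite.op_one, map_one]
  rw [h]
  rfl

theorem lTensor_restrictScalar_weylAct (w : reflGroup R) (F : orbitInv ρ Γ₀ x₀) :
    ((restrictScalar R Γ₀ x₀).toLinearMap ∘ₗ (weylAct R Γ₀ x₀ w).toLinearMap).lTensor U
      (F : U ⊗[ℂ] OrbitGerms R Γ₀ x₀) =
    (ρ (MulOpposite.op w)).rTensor _ (restrict ρ Γ₀ x₀ F : U ⊗[ℂ] FlatGerms Γ₀ x₀) := by
  rw [LinearMap.lTensor_comp, LinearMap.comp_apply, lTensor_weylAct_of_mem ρ w F.2, restrict_apply,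
    ← LinearMap.comp_apply, ← LinearMap.comp_apply, LinearMap.lTensor_comp_rTensor,
    LinearMap.rTensor_comp_lTensor]

theorem restrict_injective (hR : IsClassical R) (hΓ : Γ₀ ⊆ R) (hx₀ : IsGeneric R Γ₀ x₀) :
    Function.Injective (restrict ρ Γ₀ x₀) := by
  classical
  have := hR.finite_weyl
  have := Fintype.ofFinite (reflGroup R)
  rw [injective_iff_map_eq_zero]
  intro F hF
  -- Recording the restrictions of all translates is injective on scalar germs, and stays so after
  -- tensoring with `U` by flatness. On an invariant element every component is determined by the
  -- restriction at `x₀`.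
  let Φ : OrbitGerms R Γ₀ x₀ →ₗ[ℂ] reflGroup R → FlatGerms Γ₀ x₀ :=
    ∑ w, LinearMap.single ℂ (fun _ => FlatGerms Γ₀ x₀) w ∘ₗ
      ((restrictScalar R Γ₀ x₀).toLinearMap ∘ₗ (weylAct R Γ₀ x₀ w).toLinearMap)
  have hΦ : Function.Injective Φ := by
    rw [injective_iff_map_eq_zero]
    intro f hf
    obtain ⟨G, rfl⟩ := toOrbit_surjective R Γ₀ x₀ f
    rw [toOrbit_eq_zero_iff hR hΓ hx₀]
    intro w
    have h1 := congrFun hf w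
    simp only [Φ, LinearMap.sum_apply, Finset.sum_apply, LinearMap.comp_apply,
      LinearMap.single_apply, Pi.zero_apply] at h1
    rw [Finset.sum_pi_single] at h1
    simp only [Finset.mem_univ, if_true] at h1
    rw [← restrictScalar_toOrbit, ← weylAct_toOrbit]
    exact h1
  apply Subtype.ext
  refine Module.Flat.lTensor_preserves_injective_linearMap (M := U) Φ hΦ ?_
  change Φ.lTensor U _ = Φ.lTensor U 0
  rw [map_zero]
  have h2 : Φ.lTensor U = ∑ w, (LinearMap.single ℂ (fun _ => FlatGerms Γ₀ x₀) w ∘ₗ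
      ((restrictScalar R Γ₀ x₀).toLinearMap ∘ₗ (weylAct R Γ₀ x₀ w).toLinearMap)).lTensor U :=
    map_sum (LinearMap.lTensorHom (R := ℂ) U) _ _
  rw [h2, LinearMap.sum_apply]
  refine Finset.sum_eq_zero fun w _ => ?_
  rw [LinearMap.lTensor_comp, LinearMap.comp_apply, lTensor_restrictScalar_weylAct, hF]
  simp

theorem restrict_surjective (hR : IsClassical R) {t : Fin N → ℝ}
    (ht : ∀ α ∈ R, height t α ≠ 0) (hΓ₀ : ∀ β ∈ Γ₀, IsSimpleRoot R t β)
    (hx₀ : IsGeneric R Γ₀ x₀) : Function.Surjective (restrict ρ Γ₀ x₀) := by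
  classical
  have := hR.finite_weyl
  have := Fintype.ofFinite (reflGroup R)
  intro G
  obtain ⟨E, hE⟩ := exists_extension hR ht hΓ₀ hx₀
  set W₀ : Finset (reflGroup R) :=
    Finset.univ.filter fun w => (w : V N ≃ₗ[ℂ] V N) ∈ reflGroup Γ₀ with hW₀
  have hcard : (W₀.card : ℂ) ≠ 0 := by
    rw [Nat.cast_ne_zero, ← Nat.pos_iff_ne_zero, Finset.card_pos]
    exact ⟨1, Finset.mem_filter.mpr ⟨Finset.mem_univ _, one_mem _⟩⟩
  -- Averaging the extension by zero over `W`: at `x₀` only the summands from `W₀` survive, each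
  -- equal to `G` by its `W₀`-invariance, which explains the division by the order of `W₀`.
  let F : U ⊗[ℂ] OrbitGerms R Γ₀ x₀ := ∑ w, diagAct ρ Γ₀ x₀ w (E.lTensor U G)
  have hF : F ∈ orbitInv ρ Γ₀ x₀ := by
    intro u
    rw [map_sum]
    refine Eq.trans ?_ (Equiv.sum_comp (Equiv.mulLeft u)
      fun w => diagAct ρ Γ₀ x₀ w (E.lTensor U G))
    exact Finset.sum_congr rfl fun w _ => by rw [Equiv.coe_mulLeft, diagAct_mul]; rfl
  refine ⟨(W₀.card : ℂ)⁻¹ • ⟨F, hF⟩, ?_⟩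
  rw [map_smul, inv_smul_eq_iff₀ hcard]
  apply Subtype.ext
  rw [restrict_apply]
  have h1 : ∀ w, (restrictScalar R Γ₀ x₀).toLinearMap.lTensor U
      (diagAct ρ Γ₀ x₀ w (E.lTensor U G)) =
      if (w : V N ≃ₗ[ℂ] V N) ∈ reflGroup Γ₀ then (G : U ⊗[ℂ] FlatGerms Γ₀ x₀) else 0 := by
    intro w
    have h2 : (restrictScalar R Γ₀ x₀).toLinearMap.lTensor U
        (diagAct ρ Γ₀ x₀ w (E.lTensor U G)) = TensorProduct.map (ρ (MulOpposite.op w⁻¹))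
          ((restrictScalar R Γ₀ x₀).toLinearMap ∘ₗ (weylAct R Γ₀ x₀ w).toLinearMap ∘ₗ E)
          (G : U ⊗[ℂ] FlatGerms Γ₀ x₀) := by
      rw [diagAct, LinearMap.lTensor, LinearMap.lTensor, ← LinearMap.comp_apply,
        ← LinearMap.comp_apply, ← TensorProduct.map_comp, ← TensorProduct.map_comp]
      rfl
    rw [h2]
    split_ifs with hw
    · have h3 : (restrictScalar R Γ₀ x₀).toLinearMap ∘ₗ (weylAct R Γ₀ x₀ w).toLinearMap ∘ₗ E =
          LinearMap.id := LinearMap.ext fun g => by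
        have := hE w g
        rwa [if_pos hw] at this
      rw [h3]
      exact G.2 w hw
    · have h3 : (restrictScalar R Γ₀ x₀).toLinearMap ∘ₗ (weylAct R Γ₀ x₀ w).toLinearMap ∘ₗ E =
          0 := LinearMap.ext fun g => by
        have := hE w g
        rwa [if_neg hw] at this
      rw [h3, TensorProduct.map_zero_right, LinearMap.zero_apply]
  change (restrictScalar R Γ₀ x₀).toLinearMap.lTensor U F = (W₀.card : ℂ) • (G : U ⊗[ℂ] _)
  rw [map_sum, Finset.sum_congr rfl fun w _ => h1 w, ← Finset.sum_filter, Finset.sum_const,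
    Nat.cast_smul_eq_nsmul]

end Bijectivity

end

/-! ### Orthonormal bases and restricted operators -/

section

variable {N : ℕ} {R Γ₀ : Finset (V N)} {x₀ : flat Γ₀}

theorem IsClassical.star_mem_flat (hR : IsClassical R) (hΓ : Γ₀ ⊆ R) {x : V N}
    (hx : x ∈ flat Γ₀) : star x ∈ flat Γ₀ := by
  intro β hβ
  have h1 : star β = β := funext fun i => hR.conj_eq (hΓ hβ) i
  rw [← h1, Matrix.star_dotProduct_star, dotProduct_comm, hx β hβ, star_zero]

-- The flat is cut out by real equations, hence stable under complex conjugation, so the bilinear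
-- form stays nondegenerate on it. An orthogonal basis can then be rescaled by complex square roots.
open scoped ComplexOrder in
theorem exists_isOrthonormal (hR : IsClassical R) (hΓ : Γ₀ ⊆ R) :
    ∃ (n : ℕ) (b : Module.Basis (Fin n) ℂ (flat Γ₀)), IsOrthonormal b := by
  let B : LinearMap.BilinForm ℂ (flat Γ₀) :=
    LinearMap.mk₂ ℂ (fun x y : flat Γ₀ => (x : V N) ⬝ᵥ (y : V N))
      (fun _ _ _ => add_dotProduct _ _ _) (fun _ _ _ => smul_dotProduct _ _ _)
      (fun _ _ _ => dotProduct_add _ _ _) (fun _ _ _ => dotProduct_smul _ _ _)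
  have hB : LinearMap.IsSymm B := ⟨fun x y => dotProduct_comm (x : V N) (y : V N)⟩
  have : Invertible (2 : ℂ) := invertibleOfNonzero two_ne_zero
  obtain ⟨v, hv⟩ := LinearMap.BilinForm.exists_orthogonal_basis (B := B) hB
  have hv' : ∀ i j, i ≠ j → (v i : V N) ⬝ᵥ (v j : V N) = 0 := fun i j hij => hv hij
  have hne : ∀ i, (v i : V N) ⬝ᵥ (v i : V N) ≠ 0 := by
    intro i h0
    -- An isotropic basis vector would be orthogonal to all of `π`, in particular to its own
    -- conjugate, and so would have Hermitian norm zero.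
    have h1 : B (v i) = 0 := v.ext fun j => by
      by_cases hij : i = j
      · subst hij
        exact h0
      · exact hv' i j hij
    have h2 : (v i : V N) ⬝ᵥ star (v i : V N) = 0 :=
      LinearMap.congr_fun h1 ⟨_, hR.star_mem_flat hΓ (v i).2⟩
    exact v.ne_zero i (Subtype.ext (dotProduct_self_star_eq_zero.mp h2))
  have hz : ∀ i, ∃ z : ℂˣ, (z : ℂ) ^ 2 * ((v i : V N) ⬝ᵥ (v i : V N)) = 1 := by
    intro i
    obtain ⟨z, hz⟩ := IsAlgClosed.exists_pow_nat_eq ((v i : V N) ⬝ᵥ (v i : V N))⁻¹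
      (n := 2) two_pos
    have hz0 : z ≠ 0 := by
      rintro rfl
      rw [zero_pow two_ne_zero, eq_comm, inv_eq_zero] at hz
      exact hne i hz
    exact ⟨Units.mk0 z hz0, by rw [Units.val_mk0, hz, inv_mul_cancel₀ (hne i)]⟩
  choose z hz using hz
  refine ⟨_, v.unitsSMul z, fun j k => ?_⟩
  have h3 : ∀ i, ((v.unitsSMul z i : flat Γ₀) : V N) = (z i : ℂ) • (v i : V N) := fun i => by
    rw [Module.Basis.unitsSMul_apply]
    rfl
  rw [h3, h3, smul_dotProduct, dotProduct_smul, smul_eq_mul, smul_eq_mul]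
  split_ifs with h
  · subst h
    rw [← mul_assoc, ← sq, hz]
  · rw [hv' j k h, mul_zero, mul_zero]

section Operators

variable {U : Type*} [AddCommGroup U] [Module ℂ U]
  (ρ : Representation ℂ (reflGroup R)ᵐᵒᵖ U)

theorem lTensor_mem_orbitInv {a : Module.End ℂ (OrbitGerms R Γ₀ x₀)}
    (ha : ∀ w, Commute (weylAct R Γ₀ x₀ w).toLinearMap a) {F : U ⊗[ℂ] OrbitGerms R Γ₀ x₀}
    (hF : F ∈ orbitInv ρ Γ₀ x₀) : a.lTensor U F ∈ orbitInv ρ Γ₀ x₀ := by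
  intro w
  have h : (weylAct R Γ₀ x₀ w).toLinearMap ∘ₗ a = a ∘ₗ (weylAct R Γ₀ x₀ w).toLinearMap := ha w
  conv_rhs => rw [← hF w]
  rw [diagAct, ← LinearMap.comp_apply, ← LinearMap.comp_apply, LinearMap.map_comp_lTensor,
    LinearMap.lTensor_comp_map, h]

/-- The restriction to the flat of an operator on germs on the stratum which commutes with the
Weyl group. -/
theorem exists_isRes (hρ : Function.Bijective (restrict ρ Γ₀ x₀))
    {a : Module.End ℂ (OrbitGerms R Γ₀ x₀)}
    (ha : ∀ w, Commute (weylAct R Γ₀ x₀ w).toLinearMap a) :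
    ∃ T : Module.End ℂ (flatInv ρ Γ₀ x₀), IsRes ρ a T := by
  let E := LinearEquiv.ofBijective _ hρ
  let A : Module.End ℂ (orbitInv ρ Γ₀ x₀) :=
    (a.lTensor U).restrict fun F hF => lTensor_mem_orbitInv ρ ha hF
  refine ⟨E.toLinearMap ∘ₗ A ∘ₗ E.symm.toLinearMap, fun F =>
    ⟨lTensor_mem_orbitInv ρ ha F.2, ?_⟩⟩
  have h : E.symm (restrict ρ Γ₀ x₀ F) = F := E.symm_apply_apply F
  change E (A (E.symm (restrict ρ Γ₀ x₀ F))) = _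
  rw [h]
  rfl

variable {ρ}

theorem IsRes.commute (hρ : Function.Surjective (restrict ρ Γ₀ x₀))
    {a₁ a₂ : Module.End ℂ (OrbitGerms R Γ₀ x₀)} {T₁ T₂ : Module.End ℂ (flatInv ρ Γ₀ x₀)}
    (h₁ : IsRes ρ a₁ T₁) (h₂ : IsRes ρ a₂ T₂) (h : Commute a₁ a₂) : Commute T₁ T₂ := by
  refine LinearMap.ext fun G => ?_
  obtain ⟨F, rfl⟩ := hρ G
  obtain ⟨m₁, e₁⟩ := h₁ F
  obtain ⟨m₂, e₂⟩ := h₂ F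
  obtain ⟨m₁₂, e₁₂⟩ := h₁ ⟨_, m₂⟩
  obtain ⟨m₂₁, e₂₁⟩ := h₂ ⟨_, m₁⟩
  rw [Module.End.mul_apply, Module.End.mul_apply, e₂, e₁, e₁₂, e₂₁]
  congr 2
  change a₁.lTensor U (a₂.lTensor U F) = a₂.lTensor U (a₁.lTensor U F)
  have h' : a₁ ∘ₗ a₂ = a₂ ∘ₗ a₁ := h
  rw [← LinearMap.lTensor_comp_apply, ← LinearMap.lTensor_comp_apply, h']

theorem IsRes.apply_restrict {a : Module.End ℂ (OrbitGerms R Γ₀ x₀)}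
    {T : Module.End ℂ (flatInv ρ Γ₀ x₀)} (h : IsRes ρ a T) (F : orbitInv ρ Γ₀ x₀) :
    (T (restrict ρ Γ₀ x₀ F) : U ⊗[ℂ] FlatGerms Γ₀ x₀) =
      ((restrictScalar R Γ₀ x₀).toLinearMap ∘ₗ a).lTensor U (F : U ⊗[ℂ] OrbitGerms R Γ₀ x₀) := by
  obtain ⟨m, e⟩ := h F
  rw [e, restrict_apply, LinearMap.lTensor_comp]
  rfl

end Operators

end

section

variable {N : ℕ} {R Γ₀ : Finset (V N)} {x₀ : flat Γ₀}

theorem lTensor_sum {ι U M M' : Type*} [AddCommGroup U] [Module ℂ U] [AddCommGroup M] [Module ℂ M]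
    [AddCommGroup M'] [Module ℂ M'] (s : Finset ι) (f : ι → M →ₗ[ℂ] M') :
    (∑ i ∈ s, f i).lTensor U = ∑ i ∈ s, (f i).lTensor U :=
  map_sum (LinearMap.lTensorHom (R := ℂ) U) _ _

/-! ### The spin Calogero–Moser formula -/

section ScalarFormula

variable (hR : IsClassical R) {c : V N → ℂ}
  (hc : ∀ w ∈ reflGroup R, ∀ α ∈ R, c (w α) = c α) (hx₀ : IsGeneric R Γ₀ x₀)
  (hflat : ∀ ξ, flatDir R Γ₀ c ξ ∈ flat Γ₀)
  {nabla : Fin N → Module.End ℂ (OrbitGerms R Γ₀ x₀)}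
  (hn : ∀ i, Induces (nab hR (weylStable_orbit R (x₀ : V N)) c (e i)) (nabla i))
  {t : Fin N → ℝ} (ht : ∀ α ∈ R, height t α ≠ 0) {n : ℕ}
  {b : Module.Basis (Fin n) ℂ (flat Γ₀)} (hb : IsOrthonormal b)
include hR hc hx₀ hflat hn ht hb

open Classical in
theorem restrictScalar_comp_sum_nabla_sq :
    (restrictScalar R Γ₀ x₀).toLinearMap ∘ₗ (∑ i, nabla i ^ 2) =
      (∑ j, dirDeriv {x₀} (b j) ^ 2) ∘ₗ (restrictScalar R Γ₀ x₀).toLinearMap -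
      ∑ α : posRoots R t, (if orthProj b (α : V N) = 0 then 0 else (2 * c α) •
        (LinearMap.mulLeft ℂ (Ring.inverse (dotGerm x₀ (orthProj b (α : V N) : V N))) *
          dirDeriv {x₀} (orthProj b (α : V N))) ∘ₗ (restrictScalar R Γ₀ x₀).toLinearMap) +
      ∑ α : posRoots R t, (if orthProj b (α : V N) = 0 then 0 else
        (c α * ((α : V N) ⬝ᵥ (α : V N))) •
          LinearMap.mulLeft ℂ (Ring.inverse (dotGerm x₀ (orthProj b (α : V N) : V N)) ^ 2) ∘ₗ
            ((restrictScalar R Γ₀ x₀).toLinearMap - (restrictScalar R Γ₀ x₀).toLinearMap ∘ₗ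
              (weylAct R Γ₀ x₀ (reflElt (mem_of_mem_posRoots α.2))).toLinearMap)) := by
  refine LinearMap.ext fun f => ?_
  obtain ⟨F, rfl⟩ := toOrbit_surjective R Γ₀ x₀ f
  have h1 : restrictScalar R Γ₀ x₀ ((∑ i, nabla i ^ 2) (toOrbit R Γ₀ x₀ F)) =
      toFlat R Γ₀ x₀ (∑ i, nab hR (weylStable_orbit R (x₀ : V N)) c (e i)
        (nab hR (weylStable_orbit R (x₀ : V N)) c (e i) F)) := by
    rw [Induces.sum fun i _ => (hn i).pow 2, restrictScalar_toOrbit, LinearMap.sum_apply]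
    simp only [sq, Module.End.mul_apply]
  refine h1.trans ((toFlat_sum_nab_sq hR hc hflat hb hx₀ ht F).trans ?_)
  simp only [LinearMap.add_apply, LinearMap.sub_apply, LinearMap.sum_apply, LinearMap.comp_apply,
    AlgHom.toLinearMap_apply, restrictScalar_toOrbit, sq, Module.End.mul_apply]
  congr 1
  · congr 1
    refine Finset.sum_congr rfl fun α _ => ?_
    split_ifs
    · rfl
    · simp only [LinearMap.smul_apply, LinearMap.comp_apply, Module.End.mul_apply,
        LinearMap.mulLeft_apply, AlgHom.toLinearMap_apply, restrictScalar_toOrbit]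
  · refine Finset.sum_congr rfl fun α _ => ?_
    split_ifs
    · rfl
    · simp only [LinearMap.smul_apply, LinearMap.comp_apply, LinearMap.sub_apply,
        LinearMap.mulLeft_apply, AlgHom.toLinearMap_apply, restrictScalar_toOrbit,
        weylAct_toOrbit]

variable {U : Type*} [AddCommGroup U] [Module ℂ U]
  (ρ : Representation ℂ (reflGroup R)ᵐᵒᵖ U)

/-- The scalar formula still contains restrictions of `s_α`-translates. Tensored with `U` and
applied to an invariant element, these become `P_α` applied to the restriction. -/
theorem lTensor_restrictScalar_comp_sum_nabla_sq (F : orbitInv ρ Γ₀ x₀) :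
    ((restrictScalar R Γ₀ x₀).toLinearMap ∘ₗ (∑ i, nabla i ^ 2)).lTensor U
      (F : U ⊗[ℂ] OrbitGerms R Γ₀ x₀) =
      spinCM ρ t c b x₀ (restrict ρ Γ₀ x₀ F : U ⊗[ℂ] FlatGerms Γ₀ x₀) := by
  rw [restrictScalar_comp_sum_nabla_sq hR hc hx₀ hflat hn ht hb, spinCM, LinearMap.lTensor_add,
    LinearMap.lTensor_sub, lTensor_sum, lTensor_sum, LinearMap.add_apply, LinearMap.add_apply,
    LinearMap.sub_apply, LinearMap.sub_apply, LinearMap.lTensor_comp, LinearMap.comp_apply]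
  simp only [LinearMap.sum_apply]
  congr 1
  · congr 1
    refine Finset.sum_congr rfl fun α _ => ?_
    split_ifs
    · rw [LinearMap.lTensor_zero, LinearMap.zero_apply, LinearMap.zero_apply]
    · rw [LinearMap.lTensor_smul, LinearMap.lTensor_comp]
      rfl
  · refine Finset.sum_congr rfl fun α _ => ?_
    split_ifs
    · rw [LinearMap.lTensor_zero, LinearMap.zero_apply, LinearMap.zero_apply]
    · rw [LinearMap.lTensor_smul, LinearMap.lTensor_comp, LinearMap.smul_apply,
        LinearMap.smul_apply, LinearMap.comp_apply, LinearMap.lTensor_sub, LinearMap.sub_apply,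
        lTensor_restrictScalar_weylAct, ← restrict_apply, ← LinearMap.lTensor_comp_rTensor,
        LinearMap.comp_apply, LinearMap.rTensor_sub, LinearMap.sub_apply]
      congr 3
      exact (LinearMap.rTensor_id_apply _ _ _).symm

end ScalarFormula

end

end SpinCM

end

theorem mainTheorem6 {N : ℕ}
    (R : Finset (SpinCM.V N)) (hR : SpinCM.IsClassical R)
    (t : Fin N → ℝ) (ht : ∀ α ∈ R, SpinCM.height t α ≠ 0)
    (c : SpinCM.V N → ℂ) (hc : ∀ w ∈ SpinCM.reflGroup R, ∀ α ∈ R, c (w α) = c α)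
    (Γ₀ : Finset (SpinCM.V N)) (hΓ₀ : ∀ β ∈ Γ₀, SpinCM.IsSimpleRoot R t β)
    (hinv : SpinCM.IdealInvariant R (SpinCM.posRoots R t) Γ₀ c)
    (x₀ : SpinCM.flat Γ₀) (hx₀ : SpinCM.IsGeneric R Γ₀ x₀)
    {U : Type*} [AddCommGroup U] [Module ℂ U]
    (ρ : Representation ℂ (SpinCM.reflGroup R)ᵐᵒᵖ U) (ω : ℂ) :
    -- restriction to `x₀` identifies the `W`-invariant germs with the `W₀`-invariant ones
    Function.Bijective (SpinCM.restrict ρ Γ₀ x₀) ∧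
    -- the Dunkl operators act on germs on the stratum
    ∃ nabla : Fin N → Module.End ℂ (SpinCM.OrbitGerms R Γ₀ x₀),
      (∀ i, SpinCM.IsDunklAction (SpinCM.posRoots R t) c (SpinCM.e i) (nabla i)) ∧
      -- the restrictions to `π` exist
      ∃ (H₂ Hhm : Module.End ℂ (SpinCM.flatInv ρ Γ₀ x₀))
        (H : ℕ → Module.End ℂ (SpinCM.flatInv ρ Γ₀ x₀)),
        SpinCM.IsRes ρ (∑ i, nabla i ^ 2) H₂ ∧
        SpinCM.IsRes ρ (SpinCM.KTilde nabla ω) Hhm ∧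
        (∀ m, SpinCM.IsRes ρ (SpinCM.K nabla ω m) (H m)) ∧
        -- in orthonormal coordinates on `π`, `H₂` has the generalised spin Calogero--Moser form
        (∃ (n : ℕ) (b : Module.Basis (Fin n) ℂ (SpinCM.flat Γ₀)), SpinCM.IsOrthonormal b) ∧
        (∀ (n : ℕ) (b : Module.Basis (Fin n) ℂ (SpinCM.flat Γ₀)), SpinCM.IsOrthonormal b →
          ∀ G : SpinCM.flatInv ρ Γ₀ x₀,
            ((H₂ G : SpinCM.flatInv ρ Γ₀ x₀) : TensorProduct ℂ U (SpinCM.FlatGerms Γ₀ x₀)) =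
              SpinCM.spinCM ρ t c b x₀ G) ∧
        -- `Hhm = H₂ - ω² (y, y)`
        (∀ G : SpinCM.flatInv ρ Γ₀ x₀,
          ((Hhm G : SpinCM.flatInv ρ Γ₀ x₀) : TensorProduct ℂ U (SpinCM.FlatGerms Γ₀ x₀)) =
            (H₂ G : TensorProduct ℂ U (SpinCM.FlatGerms Γ₀ x₀)) -
              ω ^ 2 • (LinearMap.mulLeft ℂ (SpinCM.sqGerm x₀)).lTensor U
                (G : TensorProduct ℂ U (SpinCM.FlatGerms Γ₀ x₀))) ∧
        -- the `H m` are pairwise commuting quantum integrals of `Hhm`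
        (∀ m, Commute Hhm (H m)) ∧
        (∀ m m', Commute (H m) (H m')) := by 
  have hΓ : Γ₀ ⊆ R := SpinCM.subset_of_isSimpleRoot hΓ₀
  have hbij : Function.Bijective (SpinCM.restrict ρ Γ₀ x₀) :=
    ⟨SpinCM.restrict_injective ρ hR hΓ hx₀, SpinCM.restrict_surjective ρ hR ht hΓ₀ hx₀⟩
  have hS : SpinCM.WeylStable R (SpinCM.orbit R (x₀ : SpinCM.V N)) :=
    SpinCM.weylStable_orbit R (x₀ : SpinCM.V N)
  have hflat : ∀ ξ, SpinCM.flatDir R Γ₀ c ξ ∈ SpinCM.flat Γ₀ :=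
    SpinCM.flatDir_mem hR hΓ hx₀ ht hc hinv
  choose nabla hn using fun i : Fin N =>
    SpinCM.exists_induces_nab hR hΓ hx₀ ht hc hinv (SpinCM.e i)
  have hT : ∀ ω', ∀ w,
      Commute (SpinCM.weylAct R Γ₀ x₀ w).toLinearMap (SpinCM.KTilde nabla ω') := fun ω' w =>
    (SpinCM.induces_actOp w).commute (SpinCM.induces_KTilde hR hn ω')
      (SpinCM.actOp_mul_sum_sq_sub_sq hR hS hc ω' w)
  have hK : ∀ m, ∀ w,
      Commute (SpinCM.weylAct R Γ₀ x₀ w).toLinearMap (SpinCM.K nabla ω m) := fun m w =>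
    (SpinCM.induces_actOp w).commute (SpinCM.induces_K hR hn ω m)
      (SpinCM.actOp_mul_sum_hOp_pow hR hS hc ω m w)
  -- The operator `∑ ∇_i²` is the case `ω = 0` of `KTilde`, so its Weyl invariance comes from the
  -- same lemma.
  obtain ⟨H₂, hH₂⟩ := SpinCM.exists_isRes ρ hbij (hT 0)
  obtain ⟨Hhm, hHhm⟩ := SpinCM.exists_isRes ρ hbij (hT ω)
  choose H hH using fun m => SpinCM.exists_isRes ρ hbij (hK m)
  rw [SpinCM.KTilde_zero] at hH₂
  refine ⟨hbij, nabla, SpinCM.isDunklAction_of_induces hR hn ht hc, H₂, Hhm, H, hH₂, hHhm, hH,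
    SpinCM.exists_isOrthonormal hR hΓ, fun n b hb G => ?_, fun G => ?_,
    fun m => hHhm.commute hbij.2 (hH m) ((SpinCM.induces_KTilde hR hn ω).commute
      (SpinCM.induces_K hR hn ω m) (SpinCM.commute_sum_sq_sub_sq hR hS hc ht ω m)),
    fun m m' => (hH m).commute hbij.2 (hH m') ((SpinCM.induces_K hR hn ω m).commute
      (SpinCM.induces_K hR hn ω m') (SpinCM.commute_sum_hOp_pow hR hS hc ht ω m m'))⟩
  · obtain ⟨F, rfl⟩ := hbij.2 G
    rw [hH₂.apply_restrict]
    exact SpinCM.lTensor_restrictScalar_comp_sum_nabla_sq hR hc hx₀ hflat hn ht hb ρ F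
  · obtain ⟨F, rfl⟩ := hbij.2 G
    rw [hH₂.apply_restrict, hHhm.apply_restrict, SpinCM.restrict_apply,
      ← LinearMap.lTensor_comp_apply, ← LinearMap.smul_apply, ← LinearMap.lTensor_smul,
      ← LinearMap.sub_apply, ← LinearMap.lTensor_sub]
    congr 2
    exact LinearMap.ext fun f => SpinCM.restrictScalar_KTilde ω f
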